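/- Let $M\ge 1$, let $\lambda_1,\dots,\lambda_M>0$ and $\Lambda=\mathrm{diag}(\lambda_1,\dots,\lambda_M)$. Let $\mathcal H_M$ be the space of Hermitian $M\times M$ matrices $H=(h_{ij})$ with $dH=\prod_i dh_{ii}\prod_{i<j}d(\mathrm{Re}\,h_{ij})\,d(\mathrm{Im}\,h_{ij})$, let $d^2z=d(\mathrm{Re}\,z)\,d(\mathrm{Im}\,z)$ on $\mathbb C$, and let $B=\sqrt{\Lambda^2-\bar z}$. Then, as formal matrix integrals, $$ \frac1{2\pi}\int_{\mathcal H_M\times\mathbb C} e^{\frac16\mathrm{tr}H^3-\frac12\mathrm{tr}H^2\Lambda-\frac12|z|^2+\frac16z^3}\det\frac{\Lambda+B-H+z}{\Lambda+B-H-z}\,\det\frac{\Lambda}{B}\;dH\,d^2z =\int_{\mathcal H_M}e^{\frac16\mathrm{tr}H^3-\frac12\mathrm{tr}H^2\Lambda}\,\frac{\det\Lambda}{\det(\Lambda-H)}\;dH . $$ Here the left-hand side is the integral that represents $\tau^{o,ext}/c_{\Lambda,M}$, with $\tau^{o,ext}$ the extended open partition function at $t_i=(2i-1)!!\,\mathrm{tr}\Lambda^{-2i-1}$,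 $s_i=2^i i!\,\mathrm{tr}\Lambda^{-2i-2}$ and $c_{\Lambda,M}=(2\pi)^{-M^2/2}\prod_i\sqrt{\lambda_i}\prod_{i<j}(\lambda_i+\lambda_j)$; the right-hand side is the $N=1$ Kontsevich--Penner integral. The formal integrals are defined as follows. Give $H$ degree $1$ and $\Lambda^{-1}$ degree $2$. Expand everything on the left except the Gaussian factor $e^{-\frac12\mathrm{tr}H^2\Lambda-\frac12|z|^2}$ as a formal series $\sum_{a,b,m\ge0}z^a\bar z^{\,b}P_{a,b,m}(H)$, where $P_{a,b,m}$ is a polynomial in the entries of $H$ and $\Lambda^{-1}$ of degree $m$ (in particular $B=\Lambda\sqrt{1-\bar z\Lambda^{-2}}$ is expanded by the binomial series, and $\det\frac{\Lambda+B-H+z}{\Lambda+B-H-z}$ in powers of $H\Lambda^{-1}$, $z\Lambda^{-1}$, $\bar z\Lambda^{-2}$). Likewise expand $e^{\frac16\mathrm{tr}H^3}\det\Lambda/\det(\Lambda-H)=e^{\frac16\mathrm{tr}H^3}\det(1-H\Lambda^{-1})^{-1}$ as $\sum_{m\ge0}Q_m(H)$ with $Q_m$ of degree $m$. The claim is that,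 for every $m\ge0$, all integrals in $$ \frac1{2\pi}\sum_{a,b\ge0}\int_{\mathcal H_M\times\mathbb C}z^a\bar z^{\,b}P_{a,b,m}(H)\,e^{-\frac12\mathrm{tr}H^2\Lambda-\frac12|z|^2}\,dH\,d^2z=\int_{\mathcal H_M}Q_m(H)\,e^{-\frac12\mathrm{tr}H^2\Lambda}\,dH $$ converge absolutely, only finitely many summands on the left are non-zero, and the equality holds. -/

import Mathlib

namespace KontsevichPenner

noncomputable section

/-! ### Hermitian matrices and their volume form -/

/-- The Hermitian matrix with real coordinates `x`: `h i i = x i i`, and for `i < j` the entry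
`h i j` has real part `x i j` and imaginary part `x j i`. In these coordinates the Lebesgue measure
`volume` on `Fin M → Fin M → ℝ` is `dH = ∏ dh_ii ∏_{i<j} d(Re h_ij) d(Im h_ij)`. -/
def hermitian {M : ℕ} (x : Fin M → Fin M → ℝ) : Matrix (Fin M) (Fin M) ℂ :=
  Matrix.of fun i j =>
    if i < j then (x i j : ℂ) + x j i * Complex.I
    else if j < i then (x j i : ℂ) - x i j * Complex.I
    else (x i i : ℂ)

theorem hermitian_isHermitian {M : ℕ} (x : Fin M → Fin M → ℝ) : (hermitian x).IsHermitian := by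
  ext i j
  rcases lt_trichotomy i j with h | h | h
  · simp [hermitian, Matrix.conjTranspose_apply, h, h.not_gt, sub_eq_add_neg]
  · subst h
    simp [hermitian, Matrix.conjTranspose_apply]
  · simp [hermitian, Matrix.conjTranspose_apply, h, h.not_gt, sub_eq_add_neg]

/-- Every Hermitian matrix has exactly one system of coordinates. -/
theorem existsUnique_hermitian {M : ℕ} (H : Matrix (Fin M) (Fin M) ℂ) (hH : H.IsHermitian) :
    ∃! x : Fin M → Fin M → ℝ, hermitian x = H := by
  refine ⟨fun i j => if i < j then (H i j).re else if j < i then (H j i).im else (H i i).re,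
    ?_, ?_⟩
  · ext i j
    have hij : H i j = star (H j i) := (hH.apply i j).symm
    rcases lt_trichotomy i j with h | h | h
    · simp [hermitian, h, h.not_gt, Complex.re_add_im]
    · subst h
      have him : (H i i).im = 0 := by
        have := congrArg Complex.im hij
        simp at this
        linarith
      apply Complex.ext <;> simp [hermitian, him]
    · rw [hij]
      apply Complex.ext <;> simp [hermitian, h, h.not_gt]
  · rintro y rfl
    ext i j
    rcases lt_trichotomy i j with h | h | h
    · simp [hermitian, h]
    · subst h
      simp [hermitian]
    · simp [hermitian, h, h.not_gt]

/-- The diagonal matrix `Λ = diag(λ₁, …, λ_M)`. -/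
def Lam {M : ℕ} (lam : Fin M → ℝ) : Matrix (Fin M) (Fin M) ℂ :=
  Matrix.diagonal fun i => (lam i : ℂ)

/-- The Gaussian weight `exp(-½ tr H²Λ)`. -/
def gaussH {M : ℕ} (lam : Fin M → ℝ) (H : Matrix (Fin M) (Fin M) ℂ) : ℂ :=
  Complex.exp (-(1 / 2) * (H ^ 2 * Lam lam).trace)

/-- The Gaussian weight `exp(-½ z z̄)`. -/
def gaussZ (z : ℂ) : ℂ :=
  Complex.exp (-(1 / 2) * (z * starRingEnd ℂ z))

/-! ### Formal expansions

A formal variable `ε` records the degree in which `H` has degree `1` and `Λ⁻¹` has degree `2`, that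
is, `H` is replaced by `ε H` and `Λ⁻¹` by `ε² Λ⁻¹`. -/

/-- `ε H`, with entries in a `ℂ`-algebra that contains `ε`. -/
def gradedH {A : Type*} [CommRing A] [Algebra ℂ A] {M : ℕ} (ε : A)
    (H : Matrix (Fin M) (Fin M) ℂ) : Matrix (Fin M) (Fin M) A :=
  ε • H.map (algebraMap ℂ A)

/-- `ε² Λ⁻¹`, with entries in a `ℂ`-algebra that contains `ε`. -/
def gradedLamInv {A : Type*} [CommRing A] [Algebra ℂ A] {M : ℕ} (ε : A) (lam : Fin M → ℝ) :
    Matrix (Fin M) (Fin M) A :=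
  Matrix.diagonal fun i => (lam i : ℂ)⁻¹ • ε ^ 2

/-- `exp f`, for a formal power series `f` without constant term. -/
def expSeries {σ : Type*} (f : MvPowerSeries σ ℂ) : MvPowerSeries σ ℂ :=
  PowerSeries.subst f (PowerSeries.exp ℂ)

/-- `√(1 + f) = ∑ₖ binom(1/2, k) fᵏ`, for a formal power series `f` without constant term. -/
def sqrtOneAdd {σ : Type*} (f : MvPowerSeries σ ℂ) : MvPowerSeries σ ℂ :=
  PowerSeries.subst f (PowerSeries.binomialSeries ℂ (1 / 2 : ℚ))

/-! ### The formal integral over `H_M × ℂ` -/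

/-- The formal variable that stands for `z`. -/
def zVar : MvPowerSeries (Fin 3) ℂ := MvPowerSeries.X 0

/-- The formal variable that stands for `z̄`. -/
def zbarVar : MvPowerSeries (Fin 3) ℂ := MvPowerSeries.X 1

/-- The grading parameter `ε`. -/
def epsVar : MvPowerSeries (Fin 3) ℂ := MvPowerSeries.X 2

/-- The diagonal matrix `B Λ⁻¹ = √(1 - z̄ Λ⁻²)`, where `B = √(Λ² - z̄)`. -/
def sqrtMatrix {M : ℕ} (lam : Fin M → ℝ) :
    Matrix (Fin M) (Fin M) (MvPowerSeries (Fin 3) ℂ) :=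
  Matrix.diagonal fun i => sqrtOneAdd (-(zbarVar * (gradedLamInv epsVar lam i i) ^ 2))

/-- The expansion of
`exp(tr H³/6 + z³/6) · det((Λ + B - H + z) / (Λ + B - H - z)) · det(Λ / B)`, `B = √(Λ² - z̄)`,
as a power series in `z`, `z̄` and `ε`. Here
`Λ + B - H ± z = (1 + √(1 - z̄Λ⁻²) - HΛ⁻¹ ± zΛ⁻¹) Λ`, and the factors `det Λ` cancel. -/
def openIntegrand {M : ℕ} (lam : Fin M → ℝ) (H : Matrix (Fin M) (Fin M) ℂ) :
    MvPowerSeries (Fin 3) ℂ :=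
  expSeries ((1 / 6 : ℂ) • ((gradedH epsVar H ^ 3).trace + zVar ^ 3)) *
    (1 + sqrtMatrix lam - gradedH epsVar H * gradedLamInv epsVar lam
      + zVar • gradedLamInv epsVar lam).det *
    ((1 + sqrtMatrix lam - gradedH epsVar H * gradedLamInv epsVar lam
      - zVar • gradedLamInv epsVar lam).det)⁻¹ *
    ((sqrtMatrix lam).det)⁻¹

/-- The coefficient of `zᵃ z̄ᵇ εᵐ` in the expansion, a polynomial in the entries of `H`. -/
def openCoeff {M : ℕ} (lam : Fin M → ℝ) (a b m : ℕ) (H : Matrix (Fin M) (Fin M) ℂ) : ℂ :=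
  MvPowerSeries.coeff (Finsupp.single 0 a + Finsupp.single 1 b + Finsupp.single 2 m)
    (openIntegrand lam H)

/-- One term of the expansion, times the Gaussian weight, as a function on `H_M × ℂ`. -/
def openTerm {M : ℕ} (lam : Fin M → ℝ) (a b m : ℕ) (p : (Fin M → Fin M → ℝ) × ℂ) : ℂ :=
  gaussH lam (hermitian p.1) * gaussZ p.2 *
    (openCoeff lam a b m (hermitian p.1) * p.2 ^ a * (starRingEnd ℂ p.2) ^ b)

/-- The formal integral
`(1/2π) ∫_{H_M × ℂ} e^{-tr H²Λ/2 - |z|²/2} e^{tr H³/6 + z³/6}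
  det((Λ + B - H + z) / (Λ + B - H - z)) det(Λ/B) dH d²z`: term-wise integration, the part of
degree `m` being the coefficient of the power series in the grading parameter. -/
def openFormalIntegral {M : ℕ} (lam : Fin M → ℝ) : PowerSeries ℂ :=
  PowerSeries.mk fun m =>
    (1 / (2 * Real.pi : ℂ)) *
      ∑ᶠ ab : ℕ × ℕ, ∫ p : (Fin M → Fin M → ℝ) × ℂ, openTerm lam ab.1 ab.2 m p

/-! ### The Kontsevich-Penner formal integral -/

/-- The expansion of `exp(tr H³/6) · (det Λ / det(Λ - H))^N = exp(tr H³/6) det(1 - HΛ⁻¹)^{-N}`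
as a power series in `ε`. -/
def pennerIntegrand {M : ℕ} (N : ℕ) (lam : Fin M → ℝ) (H : Matrix (Fin M) (Fin M) ℂ) :
    PowerSeries ℂ :=
  expSeries ((1 / 6 : ℂ) • (gradedH (PowerSeries.X : PowerSeries ℂ) H ^ 3).trace) *
    (((1 - gradedH (PowerSeries.X : PowerSeries ℂ) H *
      gradedLamInv (PowerSeries.X : PowerSeries ℂ) lam).det)⁻¹) ^ N

/-- The part of degree `m` of the expansion, times the Gaussian weight, as a function on `H_M`. -/
def pennerTerm {M : ℕ} (N : ℕ) (lam : Fin M → ℝ) (m : ℕ) (x : Fin M → Fin M → ℝ) : ℂ :=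
  gaussH lam (hermitian x) * PowerSeries.coeff m (pennerIntegrand N lam (hermitian x))

/-- The formal integral `∫_{H_M} e^{tr H³/6 - tr H²Λ/2} (det Λ / det(Λ - H))^N dH`. -/
def pennerFormalIntegral {M : ℕ} (N : ℕ) (lam : Fin M → ℝ) : PowerSeries ℂ :=
  PowerSeries.mk fun m => ∫ x : Fin M → Fin M → ℝ, pennerTerm N lam m x

end

end KontsevichPenner

/-! The identity is a chain of changes of variables. The weight in `z` is invariant under rotations,
so only monomials with `a = b` have non-zero integrals. Hence `z` may be replaced by `εz` and `z̄`
by `ε⁻¹z̄`, after which both integrands are series in `κ = ε³`.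

Up to constants, the factor `1 / det(B(Λ + B - κH - κz))` is a Gaussian integral over a vector `w`
and its conjugate covector `u`, with exponent `-½ p B(Λ + B - κH - κz) w` and `p = u(2Λ)⁻¹`
(`expect_gaussian`). Then: (1) `H` is translated to `H - κ w p`. Since `p` does not involve `H`,
there is no Jacobian (`expect_translate`). (2) `u` is changed linearly so that `p` becomes `u(Λ + B
- κH + κz)⁻¹`. The Jacobian is a determinant (`expect_change_covector`). (3) Put `y = κ p w`.
Because `B² = Λ² - κz̄`, the exponent collapses to `κ/6 (tr H³ + (z - y)³) + κ/2 u(H + z - y)w + ½ y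
z̄` (`exponentAt_rankOne`), and the product of the determinants collapses to `1 - ∂y/∂z`. This is
the Jacobian of `z ↦ z - y` at fixed `z̄`, and `½ y z̄` is the corresponding change of `-½ z z̄`, so
`z - y` may be replaced by `z` (`expect_shift_z`). (4) What remains does not involve `z̄`, so its
mean over `z` is its value at `z = 0` (`expect_expoZ`). (5) The Gaussian integral over `w` and `u`
of `e^{κ/2 uHw}` is `det(1 - κHΛ⁻¹)⁻¹`.

The chain is carried out algebraically, in the ring `Ser M` of power series in `ε` whose
coefficients are polynomials in the real coordinates. The integral becomes a linear functional given
by moments. A change of variables is interpolated by a parameter `t`, and the `t`-derivative of the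
integrand is shown to be a divergence with respect to the Gaussian weight, which the functional
kills by integration by parts. Analysis enters only through the one-dimensional Gaussian moments and
Fubini for products. -/

namespace KontsevichPenner

noncomputable section

/-! ### Derivations of power series rings and substitution -/

open PowerSeries in
/-- The coefficientwise extension of a derivation to power series. -/
def liftDer {S : Type*} [CommRing S] [Algebra ℂ S] (d : Derivation ℂ S S) :
    Derivation ℂ (PowerSeries S) (PowerSeries S) :=
  Derivation.mk'
    { toFun := fun F => PowerSeries.mk fun n => d (coeff n F)
      map_add' := fun F G => by ext n; simp
      map_smul' := fun c F => by ext n; simp }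
    (fun F G => by
      ext n
      simp only [LinearMap.coe_mk, AddHom.coe_mk, coeff_mk, smul_eq_mul, map_add, coeff_mul,
        map_sum, Derivation.leibniz, Finset.sum_add_distrib]
      congr 1
      rw [← Finset.Nat.sum_antidiagonal_swap]
      simp)

@[simp]
theorem coeff_liftDer {S : Type*} [CommRing S] [Algebra ℂ S] (d : Derivation ℂ S S)
    (F : PowerSeries S) (n : ℕ) :
    PowerSeries.coeff n (liftDer d F) = d (PowerSeries.coeff n F) := by
  simp [liftDer]

theorem liftDer_C {S : Type*} [CommRing S] [Algebra ℂ S] (d : Derivation ℂ S S) (s : S) :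
    liftDer d (PowerSeries.C s) = PowerSeries.C (d s) := by
  ext n
  rw [coeff_liftDer, PowerSeries.coeff_C, PowerSeries.coeff_C]
  split_ifs <;> simp

theorem liftDer_X {S : Type*} [CommRing S] [Algebra ℂ S] (d : Derivation ℂ S S) :
    liftDer d (PowerSeries.X : PowerSeries S) = 0 := by
  ext n
  rw [coeff_liftDer, PowerSeries.coeff_X]
  split_ifs <;> simp

/-- The chain rule for the substitution of a power series without constant term. -/
theorem derivation_subst {S : Type*} [CommRing S] [Algebra ℂ S]
    (δ : Derivation ℂ (PowerSeries S) (PowerSeries S)) {f : PowerSeries S}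
    (hf : PowerSeries.constantCoeff f = 0) (p : PowerSeries ℂ) :
    δ (PowerSeries.subst f p) =
      PowerSeries.subst f (PowerSeries.derivative ℂ p) * δ f := by
  have hs : PowerSeries.HasSubst f := PowerSeries.HasSubst.of_constantCoeff_zero hf
  have hX : (PowerSeries.X : PowerSeries S) ∣ f := PowerSeries.X_dvd_iff.2 hf
  -- No continuity of `δ` is assumed, so the rule is checked modulo every power of `X`: `p` is split
  -- into a polynomial, for which it is the Leibniz rule, and a tail whose contributions are all
  -- divisible by `f ^ N`.
  have key : ∀ N : ℕ, (PowerSeries.X : PowerSeries S) ^ N ∣ δ (PowerSeries.subst f p) -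
      PowerSeries.subst f (PowerSeries.derivative ℂ p) * δ f := by
    intro N
    have hp : p = (PowerSeries.trunc (N + 1) p : PowerSeries ℂ) +
        PowerSeries.X ^ (N + 1) * PowerSeries.mk fun i => PowerSeries.coeff (i + (N + 1)) p := by
      rw [add_comm]
      exact PowerSeries.eq_X_pow_mul_shift_add_trunc (N + 1) p
    set r := PowerSeries.mk fun i => PowerSeries.coeff (i + (N + 1)) p
    have e1 : PowerSeries.subst f p = Polynomial.aeval f (PowerSeries.trunc (N + 1) p) +
        f ^ (N + 1) * PowerSeries.subst f r := by
      conv_lhs => rw [hp]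
      rw [PowerSeries.subst_add hs, PowerSeries.subst_coe hs, PowerSeries.subst_mul hs,
        PowerSeries.subst_pow hs, PowerSeries.subst_X hs]
    have e2 : PowerSeries.subst f (PowerSeries.derivative ℂ p) =
        Polynomial.aeval f (Polynomial.derivative (PowerSeries.trunc (N + 1) p)) +
        f ^ N * PowerSeries.subst f ((N + 1 : ℕ) • r + PowerSeries.X *
          PowerSeries.derivative ℂ r) := by
      conv_lhs => rw [hp]
      rw [map_add, PowerSeries.derivative_coe, PowerSeries.subst_add hs,
        PowerSeries.subst_coe hs, Derivation.leibniz, Derivation.leibniz_pow,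
        PowerSeries.derivative_X]
      conv_rhs => rw [show f ^ N = PowerSeries.subst f (PowerSeries.X ^ N : PowerSeries ℂ) by
        rw [PowerSeries.subst_pow hs, PowerSeries.subst_X hs], ← PowerSeries.subst_mul hs]
      congr 2
      simp only [smul_eq_mul, nsmul_eq_mul, Nat.add_sub_cancel, mul_one, pow_succ]
      ring
    rw [e1, e2, map_add, Derivation.map_aeval, Derivation.leibniz, Derivation.leibniz_pow]
    have : Polynomial.aeval f (Polynomial.derivative (PowerSeries.trunc (N + 1) p)) • δ f +
        (f ^ (N + 1) • δ (PowerSeries.subst f r) +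
          PowerSeries.subst f r • (N + 1) • f ^ (N + 1 - 1) • δ f) -
        (Polynomial.aeval f (Polynomial.derivative (PowerSeries.trunc (N + 1) p)) +
        f ^ N * PowerSeries.subst f ((N + 1 : ℕ) • r + PowerSeries.X *
          PowerSeries.derivative ℂ r)) * δ f =
        f ^ N * (f * δ (PowerSeries.subst f r) + PowerSeries.subst f r * (N + 1 : ℕ) * δ f -
          PowerSeries.subst f ((N + 1 : ℕ) • r + PowerSeries.X *
          PowerSeries.derivative ℂ r) * δ f) := by
      simp only [smul_eq_mul, nsmul_eq_mul, Nat.add_sub_cancel]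
      ring
    rw [this]
    exact Dvd.dvd.mul_right (pow_dvd_pow_of_dvd hX N) _
  rw [← sub_eq_zero]
  ext n
  exact PowerSeries.X_pow_dvd_iff.1 (key (n + 1)) n (Nat.lt_succ_self n)

/-- `exp f`, for a power series `f` in one variable without constant term. -/
abbrev expS {S : Type*} [CommRing S] [Algebra ℂ S] (f : PowerSeries S) : PowerSeries S :=
  PowerSeries.subst f (PowerSeries.exp ℂ)

theorem derivation_expS {S : Type*} [CommRing S] [Algebra ℂ S]
    (δ : Derivation ℂ (PowerSeries S) (PowerSeries S)) {f : PowerSeries S}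
    (hf : PowerSeries.constantCoeff f = 0) : δ (expS f) = expS f * δ f := by
  rw [expS, derivation_subst δ hf, PowerSeries.derivative_exp]

theorem derivation_subst_eq_zero {S : Type*} [CommRing S] [Algebra ℂ S]
    (δ : Derivation ℂ (PowerSeries S) (PowerSeries S)) {f : PowerSeries S}
    (hf : PowerSeries.constantCoeff f = 0) (hδ : δ f = 0) (p : PowerSeries ℂ) :
    δ (PowerSeries.subst f p) = 0 := by
  rw [derivation_subst δ hf, hδ, mul_zero]

/-- Substitution commutes with a change of coefficients. -/
theorem map_subst_algHom {S S' τ : Type*} [CommRing S] [Algebra ℂ S] [CommRing S'] [Algebra ℂ S']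
    (h : S →ₐ[ℂ] S') {f : MvPowerSeries τ S} (hf : MvPowerSeries.constantCoeff f = 0)
    (p : PowerSeries ℂ) :
    MvPowerSeries.map (h : S →+* S') (PowerSeries.subst f p) =
      PowerSeries.subst (MvPowerSeries.map (h : S →+* S') f) p := by
  have hs : PowerSeries.HasSubst f := PowerSeries.HasSubst.of_constantCoeff_zero hf
  have hs' : PowerSeries.HasSubst (MvPowerSeries.map (h : S →+* S') f) :=
    PowerSeries.HasSubst.of_constantCoeff_zero (by simp [hf])
  ext e
  rw [MvPowerSeries.coeff_map, PowerSeries.coeff_subst hs, PowerSeries.coeff_subst hs']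
  have := AddMonoidHom.map_finsum ((h : S →+* S') : S →+ S') (PowerSeries.coeff_subst_finite hs p e)
  simp only [AddMonoidHom.coe_coe] at this
  rw [this]
  refine finsum_congr fun d => ?_
  rw [← map_pow, MvPowerSeries.coeff_map]
  simp

/-! ### Derivatives of determinants and inverse matrices -/

section Matrices

variable {A : Type*} [CommRing A] [Algebra ℂ A] (D : Derivation ℂ A A)
variable {n : Type*} [Fintype n]

theorem derivation_prod {ι : Type*} [DecidableEq ι] (s : Finset ι) (f : ι → A) :
    D (∏ i ∈ s, f i) = ∑ i ∈ s, (∏ j ∈ s.erase i, f j) * D (f i) := by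
  induction s using Finset.induction_on with
  | empty => simp
  | insert a s ha ih =>
    rw [Finset.prod_insert ha, Derivation.leibniz, ih, Finset.sum_insert ha,
      Finset.erase_insert ha, smul_eq_mul, smul_eq_mul, add_comm, Finset.mul_sum]
    congr 1
    refine Finset.sum_congr rfl fun i hi => ?_
    have hia : a ≠ i := fun h => ha (h ▸ hi)
    rw [Finset.erase_insert_of_ne hia, Finset.prod_insert (fun h => ha (Finset.mem_of_mem_erase h)),
      mul_assoc]

/-- Jacobi's formula. -/
theorem derivation_det [DecidableEq n] (K : Matrix n n A) :
    D K.det = (K.adjugate * K.map D).trace := by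
  have h1 : D K.det = ∑ i, (K.updateCol i fun k => D (K k i)).det := by
    simp only [Matrix.det_apply, map_sum]
    rw [Finset.sum_comm]
    refine Finset.sum_congr rfl fun σ _ => ?_
    rw [Units.smul_def, ← Int.cast_smul_eq_zsmul ℂ, D.map_smul, derivation_prod, Finset.smul_sum]
    refine Finset.sum_congr rfl fun i _ => ?_
    rw [Units.smul_def, ← Int.cast_smul_eq_zsmul ℂ,
      ← Finset.mul_prod_erase Finset.univ _ (Finset.mem_univ i), mul_comm]
    congr 2
    · simp
    · refine Finset.prod_congr rfl fun j hj => ?_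
      rw [Matrix.updateCol_ne (Finset.ne_of_mem_erase hj)]
  rw [h1, Matrix.trace]
  refine Finset.sum_congr rfl fun i _ => ?_
  rw [← Matrix.cramer_apply, Matrix.cramer_eq_adjugate_mulVec]
  simp [Matrix.mulVec, dotProduct, Matrix.mul_apply]

theorem derivation_matrix_mul {m p : Type*} (K : Matrix m n A) (K' : Matrix n p A) :
    (K * K').map D = K.map D * K' + K * K'.map D := by
  ext i j
  simp only [Matrix.map_apply, Matrix.mul_apply, map_sum, Derivation.leibniz, smul_eq_mul,
    Matrix.add_apply, Finset.sum_add_distrib]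
  rw [add_comm]
  congr 1
  exact Finset.sum_congr rfl fun _ _ => mul_comm _ _

/-- Jacobi's formula is used with the adjugate, so `N` need not be invertible. If `N` describes a
linear flow generated by `Q`, then `tr Q` is the divergence of the velocity field. -/
theorem derivation_det_of_eq_mul [DecidableEq n] {N Q : Matrix n n A} (h : N.map D = Q * N) :
    D N.det = Q.trace * N.det := by
  rw [derivation_det, h, Matrix.trace_mul_comm, mul_assoc, Matrix.mul_adjugate,
    Matrix.mul_smul, mul_one, Matrix.trace_smul, smul_eq_mul, mul_comm]

theorem derivation_det_eq_zero [DecidableEq n] {N : Matrix n n A} (h : N.map D = 0) :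
    D N.det = 0 := by
  rw [derivation_det, h, mul_zero, Matrix.trace_zero]

theorem derivation_inv [DecidableEq n] {K : Matrix n n A} (hK : IsUnit K.det) :
    (K⁻¹).map D = -(K⁻¹ * K.map D * K⁻¹) := by
  have h1 : (K⁻¹ * K).map D = 0 := by
    rw [Matrix.nonsing_inv_mul _ hK]
    ext i j
    rcases eq_or_ne i j with rfl | h
    · simp
    · simp [h]
  rw [derivation_matrix_mul] at h1
  have h2 : (K⁻¹).map D * K * K⁻¹ = -(K⁻¹ * K.map D * K⁻¹) := by
    rw [eq_neg_of_add_eq_zero_left h1, neg_mul]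
  rwa [Matrix.mul_assoc, Matrix.mul_nonsing_inv _ hK, Matrix.mul_one] at h2

theorem derivation_inv_eq_zero [DecidableEq n] {K : Matrix n n A} (hK : IsUnit K.det)
    (h : K.map D = 0) : (K⁻¹).map D = 0 := by
  rw [derivation_inv D hK, h]
  simp

/-- `Ring.inverse` is `0` off the units, so no invertibility is needed. -/
theorem derivation_ringInverse_eq_zero {a : A} (h : D a = 0) :
    D (Ring.inverse a) = 0 := by
  by_cases ha : IsUnit a
  · have h1 : D (a * Ring.inverse a) = 0 := by rw [Ring.mul_inverse_cancel a ha]; simp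
    rw [Derivation.leibniz, h, smul_zero, add_zero, smul_eq_mul] at h1
    exact (ha.mul_right_eq_zero).1 h1
  · rw [Ring.inverse_non_unit a ha, map_zero]

end Matrices

end

end KontsevichPenner

namespace KontsevichPenner

noncomputable section

/-! ### Functionals given by moments -/

/-- The functional on polynomials under which the variables are independent with moments `μ`. -/
def momentFunctional {σ : Type*} [Fintype σ] (μ : σ → ℕ → ℂ) : MvPolynomial σ ℂ →ₗ[ℂ] ℂ :=
  (MvPolynomial.basisMonomials σ ℂ).constr ℂ fun d => ∏ s, μ s (d s)

/-- Evaluation of one variable at a constant. -/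
def evalAt {σ : Type*} [DecidableEq σ] (s : σ) (c : ℂ) : MvPolynomial σ ℂ →ₐ[ℂ] MvPolynomial σ ℂ :=
  MvPolynomial.aeval fun r => if r = s then MvPolynomial.C c else MvPolynomial.X r

theorem evalAt_X_self {σ : Type*} [DecidableEq σ] (s : σ) (c : ℂ) :
    evalAt s c (MvPolynomial.X s) = MvPolynomial.C c := by simp [evalAt]

theorem evalAt_X_of_ne {σ : Type*} [DecidableEq σ] {s r : σ} (h : r ≠ s) (c : ℂ) :
    evalAt s c (MvPolynomial.X r) = MvPolynomial.X r := by simp [evalAt, h]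

section moments

variable {σ : Type*} [Fintype σ]

theorem momentFunctional_monomial (μ : σ → ℕ → ℂ) (d : σ →₀ ℕ) (a : ℂ) :
    momentFunctional μ (MvPolynomial.monomial d a) = a * ∏ s, μ s (d s) := by
  have h : (MvPolynomial.monomial d a : MvPolynomial σ ℂ) =
      a • (MvPolynomial.basisMonomials σ ℂ) d := by
    simp [MvPolynomial.smul_monomial]
  rw [h, map_smul, momentFunctional, Module.Basis.constr_basis, smul_eq_mul]

theorem prod_update_exponent [DecidableEq σ] (μ : σ → ℕ → ℂ) {d e : σ →₀ ℕ} {s : σ}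
    (h : ∀ r, r ≠ s → d r = e r) :
    ∏ r, μ r (d r) = μ s (d s) * ∏ r ∈ Finset.univ.erase s, μ r (e r) := by
  rw [← Finset.mul_prod_erase Finset.univ _ (Finset.mem_univ s)]
  congr 1
  exact Finset.prod_congr rfl fun r hr => by rw [h r (Finset.ne_of_mem_erase hr)]

/-- Integration by parts for a variable whose moments satisfy the Gaussian recursion. -/
theorem momentFunctional_pderiv [DecidableEq σ] (μ : σ → ℕ → ℂ) (s : σ) (c : ℂ)
    (h : ∀ k, c * μ s (k + 1) = k * μ s (k - 1)) (F : MvPolynomial σ ℂ) :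
    momentFunctional μ (MvPolynomial.pderiv s F) =
      c * momentFunctional μ (MvPolynomial.X s * F) := by
  induction F using MvPolynomial.induction_on' with
  | add p q hp hq => rw [map_add, map_add, mul_add, map_add, mul_add, hp, hq]
  | monomial d a =>
    rw [MvPolynomial.pderiv_monomial, MvPolynomial.X, MvPolynomial.monomial_mul, one_mul,
      momentFunctional_monomial, momentFunctional_monomial,
      prod_update_exponent μ (e := d) (s := s), prod_update_exponent μ (e := d) (s := s)]
    · have := h (d s)
      simp only [Finsupp.coe_tsub, Pi.sub_apply, Finsupp.single_eq_same, Finsupp.coe_add,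
        Pi.add_apply, add_comm 1 (d s)]
      linear_combination (-a * ∏ r ∈ Finset.univ.erase s, μ r (d r)) * this
    · intro r hr
      simp [hr.symm]
    · intro r hr
      simp [hr.symm]

/-- A constant `c` has moments `c ^ k`, so fixing a variable is a choice of its moments. The
condition `μ s 0 = 1` accounts for the variable that no longer occurs after evaluation. -/
theorem momentFunctional_evalAt [DecidableEq σ] (μ : σ → ℕ → ℂ) (s : σ) (c : ℂ)
    (h : μ s 0 = 1) (F : MvPolynomial σ ℂ) :
    momentFunctional μ (evalAt s c F) =
      momentFunctional (Function.update μ s fun k => c ^ k) F := by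
  induction F using MvPolynomial.induction_on' with
  | add p q hp hq => rw [map_add, map_add, map_add, hp, hq]
  | monomial d a =>
    have e : evalAt s c (MvPolynomial.monomial d a) =
        MvPolynomial.monomial (d.erase s) (c ^ d s * a) := by
      rw [evalAt, MvPolynomial.aeval_monomial, Finsupp.prod_fintype _ _ (fun _ => pow_zero _),
        ← Finset.mul_prod_erase Finset.univ _ (Finset.mem_univ s), if_pos rfl,
        MvPolynomial.monomial_eq, Finsupp.prod_fintype _ _ (fun _ => pow_zero _),
        ← Finset.mul_prod_erase Finset.univ _ (Finset.mem_univ s), Finsupp.erase_same, pow_zero,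
        one_mul, MvPolynomial.algebraMap_eq, MvPolynomial.C_mul, MvPolynomial.C_pow]
      rw [Finset.prod_congr rfl (g := fun r => (MvPolynomial.X r : MvPolynomial σ ℂ) ^
        (d.erase s) r)]
      · ring
      · intro r hr
        rw [if_neg (Finset.ne_of_mem_erase hr), Finsupp.erase_ne (Finset.ne_of_mem_erase hr)]
    rw [e, momentFunctional_monomial, momentFunctional_monomial,
      prod_update_exponent μ (e := d) (s := s), prod_update_exponent _ (e := d) (s := s)]
    · rw [Finsupp.erase_same, h, Function.update_self, Finset.prod_congr rfl (g := fun r =>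
        Function.update μ s (fun k => c ^ k) r (d r))]
      · ring
      · intro r hr
        rw [Function.update_of_ne (Finset.ne_of_mem_erase hr)]
    · exact fun _ _ => rfl
    · exact fun r hr => Finsupp.erase_ne hr

/-- The fundamental theorem of calculus in one variable. -/
theorem momentFunctional_evalAt_one_sub [DecidableEq σ] (μ : σ → ℕ → ℂ) (s : σ)
    (h : μ s 0 = 1) (F : MvPolynomial σ ℂ) :
    momentFunctional μ (evalAt s 1 F) - momentFunctional μ (evalAt s 0 F) =
      momentFunctional (Function.update μ s fun k => ((k : ℂ) + 1)⁻¹)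
        (MvPolynomial.pderiv s F) := by
  rw [momentFunctional_evalAt μ s 1 h, momentFunctional_evalAt μ s 0 h]
  induction F using MvPolynomial.induction_on' with
  | add p q hp hq => rw [map_add, map_add, map_add, map_add, ← hp, ← hq]; ring
  | monomial d a =>
    have aux : ∀ (f : ℕ → ℂ) (e : σ →₀ ℕ), (∀ r, r ≠ s → e r = d r) →
        ∏ r, Function.update μ s f r (e r) =
          f (e s) * ∏ r ∈ Finset.univ.erase s, μ r (d r) := by
      intro f e he
      rw [prod_update_exponent _ he, Function.update_self]
      congr 1
      exact Finset.prod_congr rfl fun r hr => by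
        rw [Function.update_of_ne (Finset.ne_of_mem_erase hr)]
    rw [MvPolynomial.pderiv_monomial, momentFunctional_monomial, momentFunctional_monomial,
      momentFunctional_monomial, aux _ _ fun _ _ => rfl, aux _ _ fun _ _ => rfl, aux]
    -- For the exponent `k = d s` the claim is `1 ^ k - 0 ^ k = k · (1 / k)`. At `k = 0` both sides
    -- vanish, because `0 ^ 0 = 1`.
    · rcases Nat.eq_zero_or_pos (d s) with h0 | h0
      · simp [h0]
      · obtain ⟨k, hk⟩ := Nat.exists_eq_succ_of_ne_zero h0.ne'
        have hk' : ((k : ℂ) + 1) ≠ 0 := Nat.cast_add_one_ne_zero k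
        simp [hk]
        field_simp
    · intro r hr
      simp [hr.symm]

/-- Variables outside the range of `f` occur with exponent `0` and must contribute the factor `1`.
-/
theorem momentFunctional_rename {σ' : Type*} [Fintype σ'] (μ : σ → ℕ → ℂ) (f : σ' → σ)
    (hf : Function.Injective f) (h : ∀ s, s ∉ Set.range f → μ s 0 = 1) (F : MvPolynomial σ' ℂ) :
    momentFunctional μ (MvPolynomial.rename f F) = momentFunctional (fun s => μ (f s)) F := by
  classical
  induction F using MvPolynomial.induction_on' with
  | add p q hp hq => rw [map_add, map_add, map_add, hp, hq]
  | monomial d a =>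
    rw [MvPolynomial.rename_monomial, momentFunctional_monomial, momentFunctional_monomial]
    congr 1
    symm
    refine Fintype.prod_of_injective f hf _ _ ?_ ?_
    · intro s hs
      rw [Finsupp.mapDomain_of_notMem_range _ _ hs, h s hs]
    · intro i
      rw [Finsupp.mapDomain_apply hf]

end moments

/-! ### Moments of the Gaussian weight on the line -/

/-- The normalized moments of `exp(-c x² / 2)`. -/
def gaussMoment (c : ℝ) (k : ℕ) : ℂ :=
  (∫ x : ℝ, (x : ℂ) ^ k * Complex.exp (-(c / 2) * x ^ 2)) /
    ∫ x : ℝ, Complex.exp (-(c / 2) * (x : ℂ) ^ 2)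

theorem integrable_pow_mul_gauss {c : ℝ} (hc : 0 < c) (k : ℕ) :
    MeasureTheory.Integrable fun x : ℝ => (x : ℂ) ^ k * Complex.exp (-(c / 2) * x ^ 2) := by
  have h := integrable_rpow_mul_exp_neg_mul_sq (b := c / 2) (by positivity) (s := k)
    (by have : (0 : ℝ) ≤ k := Nat.cast_nonneg k
        linarith)
  refine h.ofReal.congr (Filter.Eventually.of_forall fun x => ?_)
  change ((x ^ (k : ℝ) * Real.exp (-(c / 2) * x ^ 2) : ℝ) : ℂ) = _
  rw [Real.rpow_natCast]
  push_cast
  rfl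

theorem integral_gauss_ne_zero {c : ℝ} (hc : 0 < c) :
    (∫ x : ℝ, Complex.exp (-(c / 2) * (x : ℂ) ^ 2)) ≠ 0 := by
  have h := integral_gaussian (c / 2)
  have e : (∫ x : ℝ, Complex.exp (-(c / 2) * (x : ℂ) ^ 2)) =
      ((∫ x : ℝ, Real.exp (-(c / 2) * x ^ 2) : ℝ) : ℂ) := by
    rw [← integral_complex_ofReal]
    congr 1
    ext x
    push_cast
    rfl
  rw [e, h]
  have : 0 < √(Real.pi / (c / 2)) := Real.sqrt_pos.2 (by positivity)
  exact_mod_cast this.ne'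

theorem gaussMoment_zero {c : ℝ} (hc : 0 < c) : gaussMoment c 0 = 1 := by
  simp only [gaussMoment, pow_zero, one_mul]
  exact div_self (integral_gauss_ne_zero hc)

/-- Integration by parts: the derivative of `x ^ k e^{-cx²/2}` has integral zero. The truncated `k -
1` at `k = 0` is harmless, since its coefficient is `0`. -/
theorem gaussMoment_succ {c : ℝ} (hc : 0 < c) (k : ℕ) :
    (c : ℂ) * gaussMoment c (k + 1) = k * gaussMoment c (k - 1) := by
  have hd : ∀ x : ℝ, HasDerivAt
      (fun x : ℝ => (x : ℂ) ^ k * Complex.exp (-(c / 2) * (x : ℂ) ^ 2))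
      ((k : ℂ) * ((x : ℂ) ^ (k - 1) * Complex.exp (-(c / 2) * (x : ℂ) ^ 2)) -
        c * ((x : ℂ) ^ (k + 1) * Complex.exp (-(c / 2) * (x : ℂ) ^ 2))) x := by
    intro x
    have h1 : HasDerivAt (fun z : ℂ => z ^ k * Complex.exp (-(c / 2) * z ^ 2))
        ((k : ℂ) * (x : ℂ) ^ (k - 1) * Complex.exp (-(c / 2) * (x : ℂ) ^ 2) +
          (x : ℂ) ^ k * (Complex.exp (-(c / 2) * (x : ℂ) ^ 2) *
            (-(c / 2) * (2 * (x : ℂ))))) (x : ℂ) := by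
      refine HasDerivAt.mul (hasDerivAt_pow k _) (HasDerivAt.cexp ?_)
      simpa using (hasDerivAt_pow 2 (x : ℂ)).const_mul (-(c / 2 : ℂ))
    convert h1.comp_ofReal using 1
    ring
  have hi := ((integrable_pow_mul_gauss hc (k - 1)).const_mul (k : ℂ)).sub
    ((integrable_pow_mul_gauss hc (k + 1)).const_mul (c : ℂ))
  have h0 := MeasureTheory.integral_eq_zero_of_hasDerivAt_of_integrable hd hi
    (integrable_pow_mul_gauss hc k)
  rw [MeasureTheory.integral_sub ((integrable_pow_mul_gauss hc (k - 1)).const_mul (k : ℂ))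
    ((integrable_pow_mul_gauss hc (k + 1)).const_mul (c : ℂ)),
    MeasureTheory.integral_const_mul, MeasureTheory.integral_const_mul, sub_eq_zero] at h0
  rw [gaussMoment, gaussMoment, ← mul_div_assoc, ← mul_div_assoc, h0]

end

end KontsevichPenner

namespace KontsevichPenner

noncomputable section

/-! ### The ring of formal integrands -/

/-- The real coordinates of `H`, of `z`, of an auxiliary vector `w`, and a deformation parameter. -/
abbrev Coord (M : ℕ) := (Fin M × Fin M) ⊕ (Fin 2 ⊕ ((Fin M × Fin 2) ⊕ Unit))

/-- Power series in the grading parameter, with polynomials in the coordinates as coefficients. -/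
abbrev Ser (M : ℕ) := PowerSeries (MvPolynomial (Coord M) ℂ)

variable {M : ℕ}

/-- A coordinate, as a formal integrand. -/
def coordS (s : Coord M) : Ser M := PowerSeries.C (MvPolynomial.X s)

/-- The derivative in the direction of a coordinate. -/
def dCoord (s : Coord M) : Derivation ℂ (Ser M) (Ser M) := liftDer (MvPolynomial.pderiv s)

theorem dCoord_coordS (s r : Coord M) : dCoord s (coordS r) = if s = r then 1 else 0 := by
  rw [dCoord, coordS, liftDer_C, MvPolynomial.pderiv_X, Pi.single_apply]
  simp only [eq_comm (a := s)]
  split_ifs <;> simp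

theorem dCoord_X (s : Coord M) : dCoord s (PowerSeries.X : Ser M) = 0 := liftDer_X _

/-- The generic Hermitian matrix `H`. -/
def hS : Matrix (Fin M) (Fin M) (Ser M) := Matrix.of fun i j =>
  if i < j then coordS (Sum.inl (i, j)) + Complex.I • coordS (Sum.inl (j, i))
  else if j < i then coordS (Sum.inl (j, i)) - Complex.I • coordS (Sum.inl (i, j))
  else coordS (Sum.inl (i, i))

/-- The variable `z`. -/
def zS : Ser M := coordS (Sum.inr (Sum.inl 0)) + Complex.I • coordS (Sum.inr (Sum.inl 1))

/-- The variable `z̄`. -/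
def zbS : Ser M := coordS (Sum.inr (Sum.inl 0)) - Complex.I • coordS (Sum.inr (Sum.inl 1))

/-- The auxiliary vector `w`. -/
def wS (i : Fin M) : Ser M :=
  coordS (Sum.inr (Sum.inr (Sum.inl (i, 0)))) +
    Complex.I • coordS (Sum.inr (Sum.inr (Sum.inl (i, 1))))

/-- The auxiliary covector `w†`. -/
def uS (i : Fin M) : Ser M :=
  coordS (Sum.inr (Sum.inr (Sum.inl (i, 0)))) -
    Complex.I • coordS (Sum.inr (Sum.inr (Sum.inl (i, 1))))

/-- The deformation parameter. -/
def tS : Ser M := coordS (Sum.inr (Sum.inr (Sum.inr ())))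

/-- The cube of the grading parameter. -/
def kap : Ser M := PowerSeries.X ^ 3

/-- The derivative with respect to the entry `h_ij`, where `h_ij` and `h_ji` count as independent
variables; off the diagonal it is a Wirtinger derivative in the two real coordinates. -/
def dH (i j : Fin M) : Derivation ℂ (Ser M) (Ser M) :=
  if i < j then (1 / 2 : ℂ) • (dCoord (Sum.inl (i, j)) - Complex.I • dCoord (Sum.inl (j, i)))
  else if j < i then
    (1 / 2 : ℂ) • (dCoord (Sum.inl (j, i)) + Complex.I • dCoord (Sum.inl (i, j)))
  else dCoord (Sum.inl (i, i))

def dZ : Derivation ℂ (Ser M) (Ser M) :=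
  (1 / 2 : ℂ) • (dCoord (Sum.inr (Sum.inl 0)) - Complex.I • dCoord (Sum.inr (Sum.inl 1)))

def dZb : Derivation ℂ (Ser M) (Ser M) :=
  (1 / 2 : ℂ) • (dCoord (Sum.inr (Sum.inl 0)) + Complex.I • dCoord (Sum.inr (Sum.inl 1)))

/-- The derivative in `u_i` at fixed `w`. As `u` is the conjugate of `w`, it has the sign of an
antiholomorphic derivative. -/
def dU (i : Fin M) : Derivation ℂ (Ser M) (Ser M) :=
  (1 / 2 : ℂ) • (dCoord (Sum.inr (Sum.inr (Sum.inl (i, 0)))) +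
    Complex.I • dCoord (Sum.inr (Sum.inr (Sum.inl (i, 1)))))

def dT : Derivation ℂ (Ser M) (Ser M) := dCoord (Sum.inr (Sum.inr (Sum.inr ())))

/-! ### Action of the derivations on the generators -/

section table

theorem I_mul_half_mul_I : Complex.I * ((2 : ℂ)⁻¹ * Complex.I) = -2⁻¹ := by
  rw [mul_left_comm, Complex.I_mul_I]; ring

theorem half_mul_I_mul_I : (2 : ℂ)⁻¹ * Complex.I * Complex.I = -2⁻¹ := by
  rw [mul_assoc, Complex.I_mul_I]; ring

theorem half_smul_one_add : (2 : ℂ)⁻¹ • (1 : Ser M) + (2 : ℂ)⁻¹ • (1 : Ser M) = 1 := by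
  rw [← add_smul]; norm_num

@[simp] theorem dT_hS (i j : Fin M) : dT (hS i j) = 0 := by
  simp only [dT, hS, Matrix.of_apply]; split_ifs <;> simp [dCoord_coordS]
@[simp] theorem dT_zS : dT (zS : Ser M) = 0 := by simp [dT, zS, dCoord_coordS]
@[simp] theorem dT_zbS : dT (zbS : Ser M) = 0 := by simp [dT, zbS, dCoord_coordS]
@[simp] theorem dT_wS (i : Fin M) : dT (wS i) = 0 := by simp [dT, wS, dCoord_coordS]
@[simp] theorem dT_uS (i : Fin M) : dT (uS i) = 0 := by simp [dT, uS, dCoord_coordS]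
@[simp] theorem dT_tS : dT (tS : Ser M) = 1 := by simp [dT, tS, dCoord_coordS]
@[simp] theorem dT_kap : dT (kap : Ser M) = 0 := by simp [dT, kap, dCoord_X]

@[simp] theorem dU_hS (k i j : Fin M) : dU k (hS i j) = 0 := by
  simp only [dU, hS, Matrix.of_apply]; split_ifs <;> simp [dCoord_coordS]
@[simp] theorem dU_zS (k : Fin M) : dU k (zS : Ser M) = 0 := by simp [dU, zS, dCoord_coordS]
@[simp] theorem dU_zbS (k : Fin M) : dU k (zbS : Ser M) = 0 := by simp [dU, zbS, dCoord_coordS]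
@[simp] theorem dU_wS (k i : Fin M) : dU k (wS i) = 0 := by
  simp only [dU, wS, Derivation.smul_apply, Derivation.add_apply, map_add, Derivation.map_smul,
    dCoord_coordS]
  by_cases h : k = i <;> simp [h, smul_smul, I_mul_half_mul_I]
@[simp] theorem dU_uS (k i : Fin M) : dU k (uS i) = if k = i then 1 else 0 := by
  simp only [dU, uS, Derivation.smul_apply, Derivation.add_apply, map_sub, Derivation.map_smul,
    dCoord_coordS]
  by_cases h : k = i <;> simp [h, smul_smul, I_mul_half_mul_I, half_smul_one_add]
@[simp] theorem dU_tS (k : Fin M) : dU k (tS : Ser M) = 0 := by simp [dU, tS, dCoord_coordS]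
@[simp] theorem dU_kap (k : Fin M) : dU k (kap : Ser M) = 0 := by simp [dU, kap, dCoord_X]

@[simp] theorem dZ_hS (i j : Fin M) : dZ (hS i j) = 0 := by
  simp only [dZ, hS, Matrix.of_apply]; split_ifs <;> simp [dCoord_coordS]
@[simp] theorem dZ_zS : dZ (zS : Ser M) = 1 := by
  simp [dZ, zS, dCoord_coordS, smul_smul, half_smul_one_add]
@[simp] theorem dZ_zbS : dZ (zbS : Ser M) = 0 := by
  simp [dZ, zbS, dCoord_coordS, smul_smul]
@[simp] theorem dZ_wS (i : Fin M) : dZ (wS i) = 0 := by simp [dZ, wS, dCoord_coordS]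
@[simp] theorem dZ_uS (i : Fin M) : dZ (uS i) = 0 := by simp [dZ, uS, dCoord_coordS]
@[simp] theorem dZ_tS : dZ (tS : Ser M) = 0 := by simp [dZ, tS, dCoord_coordS]
@[simp] theorem dZ_kap : dZ (kap : Ser M) = 0 := by simp [dZ, kap, dCoord_X]

@[simp] theorem dZb_hS (i j : Fin M) : dZb (hS i j) = 0 := by
  simp only [dZb, hS, Matrix.of_apply]; split_ifs <;> simp [dCoord_coordS]
@[simp] theorem dZb_zS : dZb (zS : Ser M) = 0 := by
  simp [dZb, zS, dCoord_coordS, smul_smul, half_mul_I_mul_I]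
@[simp] theorem dZb_wS (i : Fin M) : dZb (wS i) = 0 := by simp [dZb, wS, dCoord_coordS]
@[simp] theorem dZb_uS (i : Fin M) : dZb (uS i) = 0 := by simp [dZb, uS, dCoord_coordS]
@[simp] theorem dZb_tS : dZb (tS : Ser M) = 0 := by simp [dZb, tS, dCoord_coordS]
@[simp] theorem dZb_kap : dZb (kap : Ser M) = 0 := by simp [dZb, kap, dCoord_X]

@[simp] theorem dH_zS (i j : Fin M) : dH i j (zS : Ser M) = 0 := by
  simp only [dH]; split_ifs <;> simp [zS, dCoord_coordS]
@[simp] theorem dH_zbS (i j : Fin M) : dH i j (zbS : Ser M) = 0 := by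
  simp only [dH]; split_ifs <;> simp [zbS, dCoord_coordS]
@[simp] theorem dH_wS (i j k : Fin M) : dH i j (wS k) = 0 := by
  simp only [dH]; split_ifs <;> simp [wS, dCoord_coordS]
@[simp] theorem dH_uS (i j k : Fin M) : dH i j (uS k) = 0 := by
  simp only [dH]; split_ifs <;> simp [uS, dCoord_coordS]
@[simp] theorem dH_tS (i j : Fin M) : dH i j (tS : Ser M) = 0 := by
  simp only [dH]; split_ifs <;> simp [tS, dCoord_coordS]
@[simp] theorem dH_kap (i j : Fin M) : dH i j (kap : Ser M) = 0 := by
  simp only [dH]; split_ifs <;> simp [kap, dCoord_X]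
theorem dH_hS (i j k l : Fin M) :
    dH i j (hS k l) = if i = k ∧ j = l then 1 else 0 := by
  rcases lt_trichotomy i j with h | h | h <;> rcases lt_trichotomy k l with h' | h' | h'
  all_goals
    simp only [dH, hS, Matrix.of_apply, h, h', h.not_gt, h'.not_gt, if_true, if_false, lt_irrefl,
      Derivation.smul_apply, Derivation.add_apply, Derivation.sub_apply, map_add, map_sub,
      Derivation.map_smul, dCoord_coordS, Sum.inl.injEq, Prod.mk.injEq]
  all_goals
    by_cases e1 : i = k <;> by_cases e2 : j = l <;> by_cases e3 : i = l <;> by_cases e4 : j = k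
  all_goals first | omega | skip
  all_goals simp_all [smul_smul, I_mul_half_mul_I, half_smul_one_add]

end table

/-! ### The formal integral as a functional -/

variable (lam : Fin M → ℝ)

/-- The moments of the coordinates; those of the deformation parameter are `τ`. -/
def coordMoment (τ : ℕ → ℂ) : Coord M → ℕ → ℂ
  | Sum.inl (i, j) => gaussMoment (if i = j then lam i else lam i + lam j)
  | Sum.inr (Sum.inl _) => gaussMoment 1
  | Sum.inr (Sum.inr (Sum.inl (i, _))) => gaussMoment (lam i)
  | Sum.inr (Sum.inr (Sum.inr _)) => τ

/-- The expectation of the coefficient of degree `n`. -/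
def expect (τ : ℕ → ℂ) (n : ℕ) : Ser M →ₗ[ℂ] ℂ :=
  momentFunctional (coordMoment lam τ) ∘ₗ
    (PowerSeries.coeff (R := MvPolynomial (Coord M) ℂ) n).restrictScalars ℂ

/-- The expectation at deformation parameter `0`. -/
abbrev expect₀ (n : ℕ) : Ser M →ₗ[ℂ] ℂ := expect lam (fun k => 0 ^ k) n

/-- The expectation, integrated over the deformation parameter in `[0, 1]`. -/
abbrev expectInt (n : ℕ) : Ser M →ₗ[ℂ] ℂ := expect lam (fun k => ((k : ℂ) + 1)⁻¹) n

variable {lam}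

theorem expect_dCoord (τ : ℕ → ℂ) (n : ℕ) (s : Coord M) {c : ℝ} (hc : 0 < c)
    (h : coordMoment lam τ s = gaussMoment c) (F : Ser M) :
    expect lam τ n (dCoord s F) = c * expect lam τ n (coordS s * F) := by
  have := momentFunctional_pderiv (coordMoment lam τ) s c
    (fun k => by rw [h]; exact gaussMoment_succ hc k) (PowerSeries.coeff n F)
  simpa [expect, dCoord, coordS] using this

/-- Gaussian integration by parts: `½ tr H²Λ` has derivative `½(λ_i + λ_j) h_ji` in the direction
`h_ij`. -/
theorem expect_dH (hlam : ∀ i, 0 < lam i) (τ : ℕ → ℂ) (n : ℕ) (i j : Fin M) (F : Ser M) :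
    expect lam τ n (dH i j F) = (lam i + lam j) / 2 * expect lam τ n (hS j i * F) := by
  have hij : 0 < lam i + lam j := add_pos (hlam i) (hlam j)
  have hji : 0 < lam j + lam i := add_pos (hlam j) (hlam i)
  rcases lt_trichotomy i j with h | h | h
  · simp only [dH, hS, Matrix.of_apply, h, h.not_gt, if_true, if_false, Derivation.smul_apply,
      Derivation.sub_apply, map_smul, map_sub, sub_mul, smul_mul_assoc]
    rw [expect_dCoord τ n _ hij (by simp [coordMoment, h.ne]),
      expect_dCoord τ n _ hji (by simp [coordMoment, h.ne'])]
    push_cast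
    simp only [smul_eq_mul]
    ring
  · subst h
    simp only [dH, hS, Matrix.of_apply, lt_irrefl, if_false]
    rw [expect_dCoord τ n _ (hlam i) (by simp [coordMoment])]
    ring
  · simp only [dH, hS, Matrix.of_apply, h, h.not_gt, if_true, if_false, Derivation.smul_apply,
      Derivation.add_apply, map_smul, map_add, add_mul, smul_mul_assoc]
    rw [expect_dCoord τ n _ hji (by simp [coordMoment, h.ne]),
      expect_dCoord τ n _ hij (by simp [coordMoment, h.ne'])]
    push_cast
    simp only [smul_eq_mul]
    ring

theorem expect_dZ (τ : ℕ → ℂ) (n : ℕ) (F : Ser M) :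
    expect lam τ n (dZ F) = 1 / 2 * expect lam τ n (zbS * F) := by
  simp only [dZ, zbS, Derivation.smul_apply,
      Derivation.sub_apply, map_smul, map_sub, sub_mul, smul_mul_assoc]
  rw [expect_dCoord τ n _ one_pos rfl, expect_dCoord τ n _ one_pos rfl]
  simp

theorem expect_dZb (τ : ℕ → ℂ) (n : ℕ) (F : Ser M) :
    expect lam τ n (dZb F) = 1 / 2 * expect lam τ n (zS * F) := by
  simp only [dZb, zS, Derivation.smul_apply,
      Derivation.add_apply, map_smul, map_add, add_mul, smul_mul_assoc]
  rw [expect_dCoord τ n _ one_pos rfl, expect_dCoord τ n _ one_pos rfl]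
  simp

theorem expect_dU (hlam : ∀ i, 0 < lam i) (τ : ℕ → ℂ) (n : ℕ) (i : Fin M) (F : Ser M) :
    expect lam τ n (dU i F) = lam i / 2 * expect lam τ n (wS i * F) := by
  simp only [dU, wS, Derivation.smul_apply,
      Derivation.add_apply, map_smul, map_add, add_mul, smul_mul_assoc]
  rw [expect_dCoord τ n _ (hlam i) rfl, expect_dCoord τ n _ (hlam i) rfl]
  simp only [smul_eq_mul]
  ring

/-- Evaluation of the deformation parameter. -/
def evT (c : ℂ) : Ser M →ₐ[ℂ] Ser M :=
  PowerSeries.mapAlgHom (evalAt (Sum.inr (Sum.inr (Sum.inr ()))) c)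

theorem coeff_evT (c : ℂ) (n : ℕ) (F : Ser M) : PowerSeries.coeff n (evT c F) =
    evalAt (Sum.inr (Sum.inr (Sum.inr ()))) c (PowerSeries.coeff n F) :=
  PowerSeries.coeff_map _ _ _

theorem evT_C (c : ℂ) (a : MvPolynomial (Coord M) ℂ) : evT c (PowerSeries.C a) =
    PowerSeries.C (evalAt (Sum.inr (Sum.inr (Sum.inr ()))) c a) :=
  PowerSeries.map_C _ _

theorem evT_coordS (c : ℂ) {s : Coord M} (h : s ≠ Sum.inr (Sum.inr (Sum.inr ()))) :
    evT c (coordS s) = coordS s := by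
  rw [coordS, evT_C, evalAt_X_of_ne h]

@[simp] theorem evT_hS (c : ℂ) (i j : Fin M) : evT c (hS i j) = hS i j := by
  simp only [hS, Matrix.of_apply]; split_ifs <;> simp [evT_coordS]
@[simp] theorem evT_zS (c : ℂ) : evT c (zS : Ser M) = zS := by simp [zS, evT_coordS]
@[simp] theorem evT_zbS (c : ℂ) : evT c (zbS : Ser M) = zbS := by simp [zbS, evT_coordS]
@[simp] theorem evT_wS (c : ℂ) (i : Fin M) : evT c (wS i) = wS i := by simp [wS, evT_coordS]
@[simp] theorem evT_uS (c : ℂ) (i : Fin M) : evT c (uS i) = uS i := by simp [uS, evT_coordS]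
@[simp] theorem evT_tS (c : ℂ) : evT c (tS : Ser M) = algebraMap ℂ (Ser M) c := by
  rw [tS, coordS, evT_C, evalAt_X_self, PowerSeries.algebraMap_apply, MvPolynomial.algebraMap_eq]
@[simp] theorem evT_kap (c : ℂ) : evT c (kap : Ser M) = kap := by
  rw [kap, map_pow]
  exact congrArg (· ^ 3) (PowerSeries.map_X _)

theorem evT_subst (c : ℂ) {f : Ser M} (hf : PowerSeries.constantCoeff f = 0)
    (p : PowerSeries ℂ) :
    evT c (PowerSeries.subst f p) = PowerSeries.subst (evT c f) p :=
  map_subst_algHom _ hf p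

/-- The fundamental theorem of calculus in `t`: the moments `0 ^ k` put `t = 0`, and the moments `1
/ (k + 1)` integrate over `[0, 1]`. All changes of variables below have this form: two integrands
are joined by a family whose `t`-derivative has expectation zero. -/
theorem expect_evT_eq {F F₀ F₁ : Ser M} (h₀ : evT 0 F = F₀)
    (h₁ : evT 1 F = F₁) (h : ∀ n, expectInt lam n (dT F) = 0) (n : ℕ) :
    expect₀ lam n F₁ = expect₀ lam n F₀ := by
  have key := momentFunctional_evalAt_one_sub (coordMoment lam fun k => 0 ^ k)
    (Sum.inr (Sum.inr (Sum.inr ()))) (by simp [coordMoment]) (PowerSeries.coeff n F)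
  have e : Function.update (coordMoment lam fun k => 0 ^ k) (Sum.inr (Sum.inr (Sum.inr ())))
      (fun k => ((k : ℂ) + 1)⁻¹) = coordMoment lam fun k => ((k : ℂ) + 1)⁻¹ := by
    ext s k
    rcases s with ⟨i, j⟩ | s | ⟨i, j⟩ | s <;> simp [Function.update, coordMoment]
  rw [e] at key
  have h' := h n
  rw [← sub_eq_zero, ← h', ← h₀, ← h₁]
  simpa [expect, coeff_evT, dT, dCoord] using key

end

end KontsevichPenner

namespace KontsevichPenner

noncomputable section

variable {M : ℕ}

/-! ### Changes of variables in formal integrals -/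

/-- A constant integrand. -/
abbrev cst (c : ℂ) : Ser M := algebraMap ℂ (Ser M) c

/-- The diagonal matrix `Λ`. -/
def lamS (lam : Fin M → ℝ) : Matrix (Fin M) (Fin M) (Ser M) :=
  Matrix.diagonal fun i => cst (lam i)

/-- The diagonal matrix `Λ⁻¹`. -/
def lamInvS (lam : Fin M → ℝ) : Matrix (Fin M) (Fin M) (Ser M) :=
  Matrix.diagonal fun i => cst (lam i)⁻¹

theorem map_diagonal_cst (D : Derivation ℂ (Ser M) (Ser M)) (c : Fin M → ℂ) :
    (Matrix.diagonal fun i => (cst (c i) : Ser M)).map D = 0 := by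
  ext i j
  rcases eq_or_ne i j with rfl | h
  · simp
  · simp [h]

@[simp] theorem map_lamS (D : Derivation ℂ (Ser M) (Ser M)) (lam : Fin M → ℝ) :
    (lamS lam).map D = 0 := map_diagonal_cst D _

theorem derivation_dotProduct (D : Derivation ℂ (Ser M) (Ser M)) (v v' : Fin M → Ser M) :
    D (v ⬝ᵥ v') = (fun i => D (v i)) ⬝ᵥ v' + v ⬝ᵥ fun i => D (v' i) := by
  simp only [dotProduct, map_sum, Derivation.leibniz, smul_eq_mul, Finset.sum_add_distrib]
  rw [add_comm]
  congr 1
  exact Finset.sum_congr rfl fun _ _ => mul_comm _ _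

theorem derivation_mulVec (D : Derivation ℂ (Ser M) (Ser M)) (K : Matrix (Fin M) (Fin M) (Ser M))
    (v : Fin M → Ser M) :
    (fun i => D ((K.mulVec v) i)) = (K.map D).mulVec v + K.mulVec fun i => D (v i) := by
  ext1 i
  simp only [Matrix.mulVec, derivation_dotProduct, Pi.add_apply]
  rfl

theorem derivation_vecMul (D : Derivation ℂ (Ser M) (Ser M)) (K : Matrix (Fin M) (Fin M) (Ser M))
    (v : Fin M → Ser M) :
    (fun i => D ((Matrix.vecMul v K) i)) =
      Matrix.vecMul (fun i => D (v i)) K + Matrix.vecMul v (K.map D) := by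
  ext1 i
  simp only [Matrix.vecMul, derivation_dotProduct, Pi.add_apply]
  rfl

variable {lam : Fin M → ℝ}

/-- Invariance under the linear change of variables `u ↦ u N`, where `N` depends on the deformation
parameter. -/
theorem expectInt_linear_change (hlam : ∀ i, 0 < lam i)
    {N Q : Matrix (Fin M) (Fin M) (Ser M)} {P G : Ser M}
    (hN : N.map dT = Q * N) (hNu : ∀ k, N.map (dU k) = 0) (hQu : ∀ k, Q.map (dU k) = 0)
    (hP : dT P = ∑ k, Matrix.vecMul uS Q k * dU k P)
    (hG : dT G = ∑ k, Matrix.vecMul uS Q k * dU k G)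
    (h0 : PowerSeries.constantCoeff (G + cst (1 / 2) * (uS ⬝ᵥ (lamS lam).mulVec wS)) = 0) (n : ℕ) :
    expectInt lam n
      (dT (N.det * P * expS (G + cst (1 / 2) * (uS ⬝ᵥ (lamS lam).mulVec wS)))) = 0 := by
  -- Adding `q` cancels the weight `e^{-½uΛw}` contained in the expectation, so the actual integrand
  -- is `det N · P · e^G`.
  set q : Ser M := cst (1 / 2) * (uS ⬝ᵥ (lamS lam).mulVec wS) with hq
  set F := N.det * P * expS (G + q) with hF
  have hqT : dT q = 0 := by
    simp [hq, dotProduct, Matrix.mulVec, lamS, Matrix.diagonal_apply]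
  have hqU : ∀ k, dU k q = cst (1 / 2) * (cst (lam k) * wS k) := by
    intro k
    simp [hq, dotProduct, lamS, Matrix.mulVec_diagonal]
  have hFT : dT F = Q.trace * F + N.det * expS (G + q) * dT P + N.det * P * expS (G + q) * dT G := by
    rw [hF, Derivation.leibniz, Derivation.leibniz, derivation_expS _ h0,
      derivation_det_of_eq_mul _ hN, map_add, hqT]
    simp only [smul_eq_mul]
    ring
  have hFU : ∀ k, dU k F = N.det * expS (G + q) * dU k P +
      N.det * P * expS (G + q) * (dU k G + cst (1 / 2) * (cst (lam k) * wS k)) := by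
    intro k
    rw [hF, Derivation.leibniz, Derivation.leibniz, derivation_expS _ h0,
      derivation_det_eq_zero _ (hNu k), map_add, hqU]
    simp only [smul_eq_mul]
    ring
  -- Summed over `k`, this gives the divergence `tr Q` of the field `uQ`, which is also the
  -- logarithmic derivative of `det N`.
  have hg : ∀ k, dU k (Matrix.vecMul uS Q k) = Q k k := by
    intro k
    have := congrFun (derivation_vecMul (dU k) Q uS) k
    rw [this, hQu]
    simp [Matrix.vecMul, dotProduct]
  -- The `t`-derivative is the divergence of `(uQ)F` with respect to the Gaussian weight;
  -- `expect_dU` annihilates each summand.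
  have key : dT F = ∑ k, (dU k (Matrix.vecMul uS Q k * F) -
      cst (lam k / 2) * (wS k * (Matrix.vecMul uS Q k * F))) := by
    have : ∀ k, dU k (Matrix.vecMul uS Q k * F) -
        cst (lam k / 2) * (wS k * (Matrix.vecMul uS Q k * F)) =
        Q k k * F + N.det * expS (G + q) * (Matrix.vecMul uS Q k * dU k P) +
        N.det * P * expS (G + q) * (Matrix.vecMul uS Q k * dU k G) := by
      intro k
      rw [Derivation.leibniz, hg, hFU, show cst (M := M) (lam k / 2) = cst (1 / 2) * cst (lam k) by
        rw [← map_mul]; congr 1; ring]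
      simp only [smul_eq_mul, hF]
      ring
    rw [Finset.sum_congr rfl fun k _ => this k, Finset.sum_add_distrib, Finset.sum_add_distrib,
      ← Finset.mul_sum, ← Finset.mul_sum, ← Finset.sum_mul, ← hP, ← hG, hFT]
    rfl
  rw [key, map_sum]
  refine Finset.sum_eq_zero fun k _ => ?_
  rw [map_sub, expect_dU hlam, ← Algebra.smul_def, map_smul, smul_eq_mul, sub_self]

end

end KontsevichPenner

/-! ### Parameters and Gaussian integration over the auxiliary vector -/

namespace KontsevichPenner

noncomputable section

variable {M : ℕ}

/-- The integrands that involve neither the deformation parameter nor the covector `u`. -/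
def paramRing (M : ℕ) : Subalgebra ℂ (Ser M) where
  carrier := {F | (∀ c, evT c F = F) ∧ dT F = 0 ∧ ∀ k, dU k F = 0}
  mul_mem' := fun {a b} ha hb =>
    ⟨fun c => by rw [map_mul, ha.1, hb.1], by rw [Derivation.leibniz, ha.2.1, hb.2.1]; simp,
      fun k => by rw [Derivation.leibniz, ha.2.2, hb.2.2]; simp⟩
  add_mem' := fun {a b} ha hb =>
    ⟨fun c => by rw [map_add, ha.1, hb.1], by rw [map_add, ha.2.1, hb.2.1, add_zero],
      fun k => by rw [map_add, ha.2.2, hb.2.2, add_zero]⟩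
  algebraMap_mem' := fun r => ⟨fun c => AlgHom.commutes _ _, by simp, fun k => by simp⟩

section paramRing

theorem hS_mem (i j : Fin M) : hS i j ∈ paramRing M := ⟨by simp, by simp, by simp⟩
theorem zS_mem : zS ∈ paramRing M := ⟨by simp, by simp, by simp⟩
theorem zbS_mem : zbS ∈ paramRing M := ⟨by simp, by simp, by simp⟩
theorem kap_mem : kap ∈ paramRing M := ⟨by simp, by simp, by simp⟩
theorem wS_mem (i : Fin M) : wS i ∈ paramRing M := ⟨by simp, by simp, by simp⟩
theorem cst_mem (c : ℂ) : cst c ∈ paramRing M := Subalgebra.algebraMap_mem _ _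

theorem subst_mem {f : Ser M} (h0 : PowerSeries.constantCoeff f = 0) (hf : f ∈ paramRing M)
    (p : PowerSeries ℂ) : PowerSeries.subst f p ∈ paramRing M :=
  ⟨fun c => by rw [evT_subst c h0, hf.1], derivation_subst_eq_zero _ h0 hf.2.1 p,
    fun k => derivation_subst_eq_zero _ h0 (hf.2.2 k) p⟩

theorem map_ringInverse_of_isUnit {A B F : Type*} [CommRing A] [CommRing B] [FunLike F A B]
    [RingHomClass F A B] (φ : F) {a : A} (ha : IsUnit a) :
    φ (Ring.inverse a) = Ring.inverse (φ a) := by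
  have h1 : φ a * φ (Ring.inverse a) = 1 := by
    rw [← map_mul, Ring.mul_inverse_cancel a ha, map_one]
  have h2 : φ a * Ring.inverse (φ a) = 1 := Ring.mul_inverse_cancel _ (ha.map φ)
  calc φ (Ring.inverse a) = φ (Ring.inverse a) * (φ a * Ring.inverse (φ a)) := by rw [h2, mul_one]
    _ = (φ a * φ (Ring.inverse a)) * Ring.inverse (φ a) := by ring
    _ = _ := by rw [h1, one_mul]

theorem ringInverse_mem {a : Ser M} (ha : a ∈ paramRing M) : Ring.inverse a ∈ paramRing M := by
  refine ⟨fun c => ?_, derivation_ringInverse_eq_zero _ ha.2.1,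
    fun k => derivation_ringInverse_eq_zero _ (ha.2.2 k)⟩
  by_cases hu : IsUnit a
  · rw [map_ringInverse_of_isUnit _ hu, ha.1]
  · rw [Ring.inverse_non_unit _ hu, map_zero]

theorem det_mem {K : Matrix (Fin M) (Fin M) (Ser M)} (h : ∀ i j, K i j ∈ paramRing M) :
    K.det ∈ paramRing M := by
  rw [Matrix.det_apply]
  refine Subalgebra.sum_mem _ fun σ _ => ?_
  rw [Units.smul_def, ← Int.cast_smul_eq_zsmul ℂ]
  exact Subalgebra.smul_mem _ (Subalgebra.prod_mem _ fun i _ => h _ _) _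

theorem matrix_mul_mem {K K' : Matrix (Fin M) (Fin M) (Ser M)} (h : ∀ i j, K i j ∈ paramRing M)
    (h' : ∀ i j, K' i j ∈ paramRing M) (i j : Fin M) : (K * K') i j ∈ paramRing M := by
  rw [Matrix.mul_apply]
  exact Subalgebra.sum_mem _ fun k _ => Subalgebra.mul_mem _ (h _ _) (h' _ _)

theorem diagonal_mem {d : Fin M → Ser M} (h : ∀ i, d i ∈ paramRing M) (i j : Fin M) :
    Matrix.diagonal d i j ∈ paramRing M := by
  rw [Matrix.diagonal_apply]
  split_ifs
  exacts [h i, Subalgebra.zero_mem _]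

theorem one_matrix_mem (i j : Fin M) :
    (1 : Matrix (Fin M) (Fin M) (Ser M)) i j ∈ paramRing M :=
  diagonal_mem (fun _ => Subalgebra.one_mem _) i j

theorem trace_mem {K : Matrix (Fin M) (Fin M) (Ser M)} (h : ∀ i j, K i j ∈ paramRing M) :
    K.trace ∈ paramRing M := Subalgebra.sum_mem _ fun i _ => h i i

end paramRing

/-- A matrix is invertible if its constant term is. -/
theorem isUnit_det_of_map_constantCoeff {S : Type*} [CommRing S]
    {K : Matrix (Fin M) (Fin M) (PowerSeries S)}
    {K₀ : Matrix (Fin M) (Fin M) S}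
    (h : K.map PowerSeries.constantCoeff = K₀) (h₀ : IsUnit K₀.det) : IsUnit K.det := by
  rw [PowerSeries.isUnit_iff_constantCoeff, RingHom.map_det, RingHom.mapMatrix_apply, h]
  exact h₀

theorem lamInvS_mul_lamS {lam : Fin M → ℝ} (hlam : ∀ i, 0 < lam i) :
    lamInvS lam * lamS lam = 1 := by
  rw [lamInvS, lamS, Matrix.diagonal_mul_diagonal, ← Matrix.diagonal_one]
  congr 1
  ext1 i
  rw [← map_mul, inv_mul_cancel₀ (by exact_mod_cast (hlam i).ne'), map_one]

theorem lamS_mul_lamInvS {lam : Fin M → ℝ} (hlam : ∀ i, 0 < lam i) :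
    lamS lam * lamInvS lam = 1 := mul_eq_one_comm.1 (lamInvS_mul_lamS hlam)

variable {lam : Fin M → ℝ}

theorem map_matrix_eq_zero {D : Derivation ℂ (Ser M) (Ser M)}
    {K : Matrix (Fin M) (Fin M) (Ser M)} (h : ∀ i j, D (K i j) = 0) : K.map D = 0 := by
  ext1 i j
  exact h i j

/-- Gaussian integration over the auxiliary vector. -/
theorem expect_gaussian (hlam : ∀ i, 0 < lam i) {K : Matrix (Fin M) (Fin M) (Ser M)}
    {S c : Ser M} (hK : ∀ i j, K i j ∈ paramRing M) (hS : S ∈ paramRing M) (hc : c ∈ paramRing M)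
    (hK0 : ∀ i j, PowerSeries.constantCoeff (K i j) = 0)
    (hS0 : PowerSeries.constantCoeff S = 0) (n : ℕ) :
    expect₀ lam n (c * expS (S - cst (1 / 2) * (uS ⬝ᵥ K.mulVec wS))) =
      expect₀ lam n (c * Ring.inverse (1 + K * lamInvS lam).det * expS S) := by
  set K' := K * lamInvS lam with hK'
  have hK'mem : ∀ i j, K' i j ∈ paramRing M :=
    matrix_mul_mem hK (diagonal_mem fun _ => cst_mem _)
  have hK'0 : K'.map PowerSeries.constantCoeff = 0 := by
    ext1 i j
    simp [hK', Matrix.mul_apply, hK0]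
  have hK'L : K' * lamS lam = K := by
    rw [hK', Matrix.mul_assoc, lamInvS_mul_lamS hlam, Matrix.mul_one]
  -- Since `K'Λ = K`, the change `u ↦ u(1 + tK')` turns the weight `e^{-½uΛw}` into `e^{-½u(Λ +
  -- tK)w}`, with Jacobian `det(1 + tK')`.
  set N : Matrix (Fin M) (Fin M) (Ser M) := 1 + (tS : Ser M) • K' with hN
  have hNu : IsUnit N.det := by
    refine isUnit_det_of_map_constantCoeff (K₀ := 1) ?_ (by simp)
    ext1 i j
    have := congrFun (congrFun hK'0 i) j
    simp only [Matrix.map_apply, Matrix.zero_apply] at this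
    simp only [hN, Matrix.map_apply, Matrix.add_apply, Matrix.smul_apply, smul_eq_mul, map_add,
      map_mul, this, mul_zero, add_zero]
    rcases eq_or_ne i j with rfl | h
    · simp
    · simp [h]
  have hunit : IsUnit (1 + K').det := by
    refine isUnit_det_of_map_constantCoeff (K₀ := 1) ?_ (by simp)
    ext1 i j
    have := congrFun (congrFun hK'0 i) j
    simp only [Matrix.map_apply, Matrix.zero_apply] at this
    simp only [Matrix.map_apply, Matrix.add_apply, map_add, this, add_zero]
    rcases eq_or_ne i j with rfl | h
    · simp
    · simp [h]
  -- The added factor involves neither `t` nor `u`. It cancels the Jacobian at `t = 1` and survives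
  -- at `t = 0`, where the Jacobian is `1`.
  set c' := c * Ring.inverse (1 + K').det with hc'
  have hc'm : c' ∈ paramRing M := Subalgebra.mul_mem _ hc
    (ringInverse_mem (det_mem fun i j => Subalgebra.add_mem _ (one_matrix_mem i j) (hK'mem i j)))
  set G : Ser M := S - cst (1 / 2) * (uS ⬝ᵥ (N * lamS lam).mulVec wS) with hG
  have hGq : G + cst (1 / 2) * (uS ⬝ᵥ (lamS lam).mulVec wS) =
      S - cst (1 / 2) * (tS * (uS ⬝ᵥ K.mulVec wS)) := by
    rw [hG, hN, Matrix.add_mul, Matrix.one_mul, Matrix.smul_mul, hK'L, Matrix.add_mulVec,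
      dotProduct_add, Matrix.smul_mulVec, dotProduct_smul, smul_eq_mul]
    ring
  have hNT : N.map dT = K' := by
    ext1 i j
    have h1 : dT ((1 : Matrix (Fin M) (Fin M) (Ser M)) i j) = 0 := (one_matrix_mem i j).2.1
    simp [hN, h1, (hK'mem i j).2.1]
  have hNU : ∀ k, N.map (dU k) = 0 := by
    intro k
    ext1 i j
    have h1 : dU k ((1 : Matrix (Fin M) (Fin M) (Ser M)) i j) = 0 := (one_matrix_mem i j).2.2 k
    simp [hN, h1, (hK'mem i j).2.2 k]
  have hQN : N.map dT = (K' * N⁻¹) * N := by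
    rw [hNT, Matrix.mul_assoc, Matrix.nonsing_inv_mul _ hNu, Matrix.mul_one]
  have hQU : ∀ k, (K' * N⁻¹).map (dU k) = 0 := by
    intro k
    rw [derivation_matrix_mul, derivation_inv_eq_zero _ hNu (hNU k),
      map_matrix_eq_zero fun i j => (hK'mem i j).2.2 k]
    simp
  have hGT : dT G = ∑ k, Matrix.vecMul uS (K' * N⁻¹) k * dU k G := by
    have h1 : dT G = -(cst (1 / 2) * (uS ⬝ᵥ (K' * lamS lam).mulVec wS)) := by
      rw [hG, map_sub, hS.2.1, Derivation.leibniz, derivation_dotProduct, derivation_mulVec,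
        derivation_matrix_mul, hNT]
      simp [← Pi.zero_def]
    have h2 : ∀ k, dU k G = -(cst (1 / 2) * ((N * lamS lam).mulVec wS k)) := by
      intro k
      rw [hG, map_sub, hS.2.2, Derivation.leibniz, derivation_dotProduct, derivation_mulVec,
        derivation_matrix_mul, hNU]
      simp [← Pi.zero_def, dotProduct]
    have h3 : ∑ k, Matrix.vecMul uS (K' * N⁻¹) k * dU k G =
        -(cst (1 / 2) * (Matrix.vecMul uS (K' * N⁻¹) ⬝ᵥ (N * lamS lam).mulVec wS)) := by
      rw [dotProduct, Finset.mul_sum, ← Finset.sum_neg_distrib]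
      exact Finset.sum_congr rfl fun k _ => by rw [h2]; ring
    rw [h3, h1, ← Matrix.dotProduct_mulVec, Matrix.mulVec_mulVec, ← Matrix.mul_assoc,
      Matrix.mul_assoc K', Matrix.nonsing_inv_mul _ hNu, Matrix.mul_one]
  have h0 : PowerSeries.constantCoeff
      (G + cst (1 / 2) * (uS ⬝ᵥ (lamS lam).mulVec wS)) = 0 := by
    rw [hGq, map_sub, hS0]
    simp [dotProduct, Matrix.mulVec, hK0]
  have key := expectInt_linear_change hlam (P := c') hQN hNU hQU
    (by simp [hc'm.2.1, hc'm.2.2]) hGT h0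
  have hev : ∀ x, evT x (G + cst (1 / 2) * (uS ⬝ᵥ (lamS lam).mulVec wS)) =
      S - cst (1 / 2) * (cst x * (uS ⬝ᵥ K.mulVec wS)) := by
    intro x
    rw [hGq, map_sub, hS.1]
    simp [dotProduct, Matrix.mulVec, (hK _ _).1]
  have hevN : ∀ x, evT x N.det = (1 + (cst x : Ser M) • K').det := by
    intro x
    rw [AlgHom.map_det]
    congr 1
    ext1 i j
    simp [hN, (hK'mem i j).1, (one_matrix_mem i j).1]
    rw [Algebra.smul_def]
  refine expect_evT_eq ?_ ?_ key n
  · rw [map_mul, map_mul, evT_subst _ h0, hev, hevN, hc'm.1]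
    simp
  · rw [map_mul, map_mul, evT_subst _ h0, hev, hevN, hc'm.1, hc']
    simp only [map_one, one_mul, one_smul]
    rw [mul_comm c, ← mul_assoc (Matrix.det _), Ring.mul_inverse_cancel _ hunit, one_mul]

end

end KontsevichPenner

namespace KontsevichPenner

noncomputable section

/-! ### The algebraic identity behind the change of variables -/

section identity

variable {A : Type*} [CommRing A] {n : Type*} [Fintype n]

theorem trace_vecMulVec_mul (w p : n → A) (K : Matrix n n A) :
    (Matrix.vecMulVec w p * K).trace = p ⬝ᵥ K.mulVec w := by
  rw [Matrix.vecMulVec_mul, Matrix.trace_vecMulVec, dotProduct_comm, Matrix.dotProduct_mulVec]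

theorem vecMulVec_mul_mul_vecMulVec (w p : n → A) (K : Matrix n n A) :
    Matrix.vecMulVec w p * K * Matrix.vecMulVec w p =
      (p ⬝ᵥ K.mulVec w) • Matrix.vecMulVec w p := by
  rw [Matrix.vecMulVec_mul, Matrix.vecMulVec_mul_vecMulVec, Matrix.dotProduct_mulVec,
    Matrix.vecMulVec_smul]

variable [DecidableEq n]

/-- Two rank-one factors contract by `W K W = (p K w) W`, and the trace of `W K` is the scalar `p K
w`. The same two rules give the cubic formula below. -/
theorem trace_sub_rankOne_sq_mul (H L : Matrix n n A) (w p : n → A) (κ : A) :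
    ((H - κ • Matrix.vecMulVec w p) ^ 2 * L).trace = (H ^ 2 * L).trace -
      κ * (p ⬝ᵥ (H * L).mulVec w + p ⬝ᵥ (L * H).mulVec w) +
      κ ^ 2 * ((p ⬝ᵥ w) * (p ⬝ᵥ L.mulVec w)) := by
  set W := Matrix.vecMulVec w p with hW
  -- The factor `1` in `W * 1 * W` gives the product the shape of the contraction rule.
  have e : (H - κ • W) ^ 2 * L = H ^ 2 * L - κ • (W * (H * L)) - κ • (H * (W * L)) +
      κ ^ 2 • ((W * 1 * W) * L) := by
    simp only [pow_two, sub_mul, mul_sub, Matrix.smul_mul, Matrix.mul_smul, smul_smul,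
      Matrix.mul_assoc, Matrix.one_mul]
    abel
  rw [e, Matrix.trace_add, Matrix.trace_sub, Matrix.trace_sub, Matrix.trace_smul,
    Matrix.trace_smul, Matrix.trace_smul, Matrix.trace_mul_comm H, Matrix.mul_assoc W L H,
    vecMulVec_mul_mul_vecMulVec, Matrix.smul_mul, Matrix.trace_smul, trace_vecMulVec_mul,
    trace_vecMulVec_mul, trace_vecMulVec_mul, Matrix.one_mulVec]
  simp only [smul_eq_mul]
  ring

theorem trace_sub_rankOne_cube (H : Matrix n n A) (w p : n → A) (κ : A) :
    ((H - κ • Matrix.vecMulVec w p) ^ 3).trace = (H ^ 3).trace -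
      3 * κ * (p ⬝ᵥ (H * H).mulVec w) + 3 * κ ^ 2 * ((p ⬝ᵥ w) * (p ⬝ᵥ H.mulVec w)) -
      κ ^ 3 * (p ⬝ᵥ w) ^ 3 := by
  set W := Matrix.vecMulVec w p with hW
  have e : (H - κ • W) ^ 3 = H ^ 3 - κ • (W * (H * H)) - κ • (H * (W * H)) - κ • (H * H * W) +
      κ ^ 2 • (W * H * W) + κ ^ 2 • (W * 1 * W * H) + κ ^ 2 • (H * (W * 1 * W)) -
      κ ^ 3 • ((W * 1 * W) * 1 * W) := by
    simp only [pow_succ, pow_zero, one_mul, sub_mul, mul_sub, Matrix.smul_mul, Matrix.mul_smul,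
      smul_smul, mul_assoc]
    abel
  have t1 : (W * (H * H)).trace = p ⬝ᵥ (H * H).mulVec w := trace_vecMulVec_mul _ _ _
  have t2 : (H * (W * H)).trace = p ⬝ᵥ (H * H).mulVec w := by
    rw [Matrix.trace_mul_comm, Matrix.mul_assoc, t1]
  have t3 : (H * H * W).trace = p ⬝ᵥ (H * H).mulVec w := by rw [Matrix.trace_mul_comm, t1]
  have t0 : W.trace = p ⬝ᵥ w := by rw [hW, Matrix.trace_vecMulVec, dotProduct_comm]
  have t4 : (W * H).trace = p ⬝ᵥ H.mulVec w := trace_vecMulVec_mul _ _ _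
  have t5 : (H * W).trace = p ⬝ᵥ H.mulVec w := by rw [Matrix.trace_mul_comm, t4]
  have w1 : W * 1 * W = (p ⬝ᵥ w) • W := by
    rw [hW, vecMulVec_mul_mul_vecMulVec, Matrix.one_mulVec]
  have w2 : W * H * W = (p ⬝ᵥ H.mulVec w) • W := vecMulVec_mul_mul_vecMulVec _ _ _
  rw [e, w1, w2]
  simp only [Matrix.trace_add, Matrix.trace_sub, Matrix.trace_smul, Matrix.smul_mul,
    Matrix.mul_smul, w1, t0, t1, t2, t3, t4, t5, smul_eq_mul]
  ring

/-- The exponent in terms of `H` and a covector `p`, without the Gaussian weight. Here `c₆` and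
`c₂` stand for `1 / 6` and `1 / 2`. -/
def exponentAt (c₆ c₂ κ z : A) (L b : Matrix n n A) (w : n → A) (H : Matrix n n A) (p : n → A) : A :=
  c₆ * (κ * ((H ^ 3).trace + z ^ 3)) -
    c₂ * (p ⬝ᵥ (b * (L + b - κ • H - (κ * z) • 1)).mulVec w) - c₂ * (H ^ 2 * L).trace

/-- The computation on which the theorem rests. Written through `p`, the term `½uΛw` cancels the
contributions of `pBΛw`, `pHΛw` and `pΛ²w`, the last one against `pB²w`. The relation `B² = Λ² -
κz̄` then leaves `½κ(p w)z̄`. The remaining terms agree after expanding the cube of `z - κ(p w)`,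
because `3 · 1/6 = 1/2`. -/
theorem exponentAt_rankOne {c₆ c₂ κ z zb : A} {L b H : Matrix n n A} {w p u : n → A}
    (h3 : 3 * c₆ = c₂) (hb : b * b = L * L - (κ * zb) • 1)
    (hu : u = Matrix.vecMul p (L + b - κ • H + (κ * z) • 1)) :
    exponentAt c₆ c₂ κ z L b w (H - κ • Matrix.vecMulVec w p) p + c₂ * (H ^ 2 * L).trace +
        c₂ * (u ⬝ᵥ L.mulVec w) =
      c₆ * (κ * ((H ^ 3).trace + (z - κ * (p ⬝ᵥ w)) ^ 3)) +
        c₂ * (κ * (u ⬝ᵥ (H + (z - κ * (p ⬝ᵥ w)) • 1).mulVec w)) +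
        c₂ * (κ * (p ⬝ᵥ w) * zb) := by
  have hbb : p ⬝ᵥ (b * b).mulVec w = p ⬝ᵥ (L * L).mulVec w - κ * zb * (p ⬝ᵥ w) := by
    rw [hb, Matrix.sub_mulVec, dotProduct_sub, Matrix.smul_mulVec, dotProduct_smul,
      Matrix.one_mulVec, smul_eq_mul]
  have hW : p ⬝ᵥ (b * Matrix.vecMulVec w p).mulVec w = (p ⬝ᵥ b.mulVec w) * (p ⬝ᵥ w) := by
    rw [← Matrix.mulVec_mulVec, Matrix.vecMulVec_mulVec, op_smul_eq_smul, Matrix.mulVec_smul,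
      dotProduct_smul, smul_eq_mul, mul_comm]
  rw [exponentAt, trace_sub_rankOne_cube, trace_sub_rankOne_sq_mul, hu]
  simp only [← Matrix.dotProduct_mulVec, Matrix.mulVec_mulVec, Matrix.mul_add, Matrix.mul_sub,
    Matrix.add_mul, Matrix.sub_mul, Matrix.mul_smul, Matrix.smul_mul, Matrix.mul_one,
    Matrix.one_mul, Matrix.add_mulVec, Matrix.sub_mulVec, Matrix.smul_mulVec, dotProduct_add,
    dotProduct_sub, dotProduct_smul, smul_eq_mul, smul_sub, Matrix.one_mulVec, hbb, hW]
  have h6 : c₂ = 3 * c₆ := h3.symm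
  subst h6
  ring

end identity

end

end KontsevichPenner

/-! ### Naturality of the exponent under homomorphisms and derivations -/

namespace KontsevichPenner

noncomputable section

section generic

variable {A : Type*} [CommRing A] {n : Type*} [Fintype n] [DecidableEq n]

theorem map_exponentAt {B : Type*} [CommRing B] (φ : A →+* B) (c₆ c₂ κ z : A) (L b : Matrix n n A)
    (w : n → A) (H : Matrix n n A) (p : n → A) :
    φ (exponentAt c₆ c₂ κ z L b w H p) =
      exponentAt (φ c₆) (φ c₂) (φ κ) (φ z) (φ.mapMatrix L) (φ.mapMatrix b) (φ ∘ w)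
        (φ.mapMatrix H) (φ ∘ p) := by
  have h1 : ∀ K : Matrix n n A, φ K.trace = (φ.mapMatrix K).trace := fun K => by
    simp [Matrix.trace]
  have h2 : ∀ (a : A) (K : Matrix n n A), φ.mapMatrix (a • K) = φ a • φ.mapMatrix K := by
    intro a K
    ext i j
    simp
  have h3 : ∀ K : Matrix n n A, φ (p ⬝ᵥ K.mulVec w) = (φ ∘ p) ⬝ᵥ (φ.mapMatrix K).mulVec (φ ∘ w) := by
    intro K
    simp [dotProduct, Matrix.mulVec]
  simp only [exponentAt, map_sub, map_mul, map_add, map_pow, h1, h2, h3, map_one]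

theorem map_inv_of_isUnit_det {B : Type*} [CommRing B] (φ : A →+* B) {K : Matrix n n A}
    (h : IsUnit K.det) : φ.mapMatrix K⁻¹ = (φ.mapMatrix K)⁻¹ := by
  symm
  apply Matrix.inv_eq_right_inv
  rw [← map_mul, Matrix.mul_nonsing_inv _ h, map_one]

variable [Algebra ℂ A]

theorem derivation_trace {n : Type*} [Fintype n] (D : Derivation ℂ A A) (K : Matrix n n A) :
    D K.trace = (K.map D).trace := by
  simp [Matrix.trace]

theorem derivation_exponentAt_eq_zero (D : Derivation ℂ A A) {c₆ c₂ κ z : A} {L b : Matrix n n A}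
    {w : n → A} {H : Matrix n n A} {p : n → A} (h₆ : D c₆ = 0) (h₂ : D c₂ = 0) (hκ : D κ = 0)
    (hz : D z = 0) (hL : L.map D = 0) (hb : b.map D = 0) (hw : ∀ i, D (w i) = 0)
    (hH : H.map D = 0) (hp : ∀ i, D (p i) = 0) :
    D (exponentAt c₆ c₂ κ z L b w H p) = 0 := by
  have hsm : ∀ (a : A) (K : Matrix n n A), D a = 0 → K.map D = 0 → (a • K).map D = 0 := by
    intro a K ha hK
    ext1 i j
    have := congrFun (congrFun hK i) j
    simp only [Matrix.map_apply, Matrix.zero_apply] at this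
    simp [ha, this]
  have h1 : (1 : Matrix n n A).map D = 0 := by
    ext i j
    rcases eq_or_ne i j with rfl | h
    · simp
    · simp [h]
  have hmul : ∀ K K' : Matrix n n A, K.map D = 0 → K'.map D = 0 → (K * K').map D = 0 := by
    intro K K' hK hK'
    rw [derivation_matrix_mul, hK, hK']
    simp
  have hadd : ∀ K K' : Matrix n n A, K.map D = 0 → K'.map D = 0 → (K + K').map D = 0 := by
    intro K K' hK hK'
    rw [Matrix.map_add _ (map_add D), hK, hK', add_zero]
  have hsub : ∀ K K' : Matrix n n A, K.map D = 0 → K'.map D = 0 → (K - K').map D = 0 := by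
    intro K K' hK hK'
    rw [Matrix.map_sub _ (map_sub D), hK, hK', sub_zero]
  have hdot : ∀ K : Matrix n n A, K.map D = 0 → D (p ⬝ᵥ K.mulVec w) = 0 := by
    intro K hK
    have hK' : ∀ i j, D (K i j) = 0 := fun i j => congrFun (congrFun hK i) j
    simp [dotProduct, Matrix.mulVec, hK', hw, hp]
  have hκz : D (κ * z) = 0 := by simp [hκ, hz]
  have e1 : D ((H ^ 3).trace) = 0 := by
    rw [derivation_trace, pow_succ, pow_two, hmul _ _ (hmul _ _ hH hH) hH, Matrix.trace_zero]
  have e2 : D ((H ^ 2 * L).trace) = 0 := by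
    rw [derivation_trace, pow_two, hmul _ _ (hmul _ _ hH hH) hL, Matrix.trace_zero]
  have e3 := hdot _ (hmul _ _ hb (hsub _ _ (hsub _ _ (hadd _ _ hL hb) (hsm κ H hκ hH))
    (hsm (κ * z) 1 hκz h1)))
  simp only [exponentAt, map_sub, map_add, Derivation.leibniz, Derivation.leibniz_pow, h₆, h₂, hκ,
    hz, e1, e2, e3, smul_zero, add_zero, sub_zero]

end generic

/-! ### The square root -/

/-- Additivity of the binomial series in its exponent: `1/2 + 1/2 = 1`. -/
theorem subst_binomialSeries_half_mul_self {S τ : Type*} [CommRing S] [Algebra ℂ S]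
    {f : MvPowerSeries τ S} (hf : MvPowerSeries.constantCoeff f = 0) :
    PowerSeries.subst f (PowerSeries.binomialSeries ℂ (1 / 2 : ℚ)) *
      PowerSeries.subst f (PowerSeries.binomialSeries ℂ (1 / 2 : ℚ)) = 1 + f := by
  have hs : PowerSeries.HasSubst f := PowerSeries.HasSubst.of_constantCoeff_zero hf
  rw [← PowerSeries.subst_mul hs, ← PowerSeries.binomialSeries_add]
  have h := PowerSeries.binomialSeries_nat (R := ℚ) (A := ℂ) 1
  norm_num at h ⊢
  rw [h, ← PowerSeries.coe_substAlgHom hs, map_add, map_one, PowerSeries.coe_substAlgHom hs,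
    PowerSeries.subst_X hs]

theorem constantCoeff_subst_of_eq_zero {S τ : Type*} [CommRing S] [Algebra ℂ S]
    {f : MvPowerSeries τ S} (hf : MvPowerSeries.constantCoeff f = 0) (p : PowerSeries ℂ) :
    MvPowerSeries.constantCoeff (PowerSeries.subst f p) =
      algebraMap ℂ S (PowerSeries.constantCoeff p) := by
  have hs : PowerSeries.HasSubst f := PowerSeries.HasSubst.of_constantCoeff_zero hf
  conv_lhs => rw [PowerSeries.eq_X_mul_shift_add_const p]
  rw [PowerSeries.subst_add hs, PowerSeries.subst_mul hs, PowerSeries.subst_X hs, map_add, map_mul,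
    hf, zero_mul, zero_add, ← Polynomial.coe_C, PowerSeries.subst_coe hs, Polynomial.aeval_C]
  rfl

variable {M : ℕ}

theorem constantCoeff_kap : PowerSeries.constantCoeff (kap : Ser M) = 0 := by simp [kap]

/-- The diagonal entries of `√(1 - z̄ Λ⁻²)`. -/
def betaS (lam : Fin M → ℝ) (i : Fin M) : Ser M :=
  PowerSeries.subst (-(kap * zbS * cst ((lam i : ℂ)⁻¹ ^ 2)) : Ser M)
    (PowerSeries.binomialSeries ℂ (1 / 2 : ℚ))

theorem constantCoeff_betaS_arg (lam : Fin M → ℝ) (i : Fin M) :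
    PowerSeries.constantCoeff (-(kap * zbS * cst ((lam i : ℂ)⁻¹ ^ 2)) : Ser M) = 0 := by
  simp [constantCoeff_kap]

theorem betaS_mul_self (lam : Fin M → ℝ) (i : Fin M) :
    betaS lam i * betaS lam i = 1 + -(kap * zbS * cst ((lam i : ℂ)⁻¹ ^ 2)) :=
  subst_binomialSeries_half_mul_self (constantCoeff_betaS_arg lam i)

theorem constantCoeff_betaS (lam : Fin M → ℝ) (i : Fin M) :
    PowerSeries.constantCoeff (betaS lam i) = 1 := by
  have := constantCoeff_subst_of_eq_zero (constantCoeff_betaS_arg lam i)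
    (PowerSeries.binomialSeries ℂ (1 / 2 : ℚ))
  rw [PowerSeries.binomialSeries_constantCoeff, map_one] at this
  exact this

theorem betaS_mem (lam : Fin M → ℝ) (i : Fin M) : betaS lam i ∈ paramRing M :=
  subst_mem (constantCoeff_betaS_arg lam i) (Subalgebra.neg_mem _ (Subalgebra.mul_mem _
    (Subalgebra.mul_mem _ kap_mem zbS_mem) (cst_mem _))) _

/-- The diagonal matrix `B = √(Λ² - z̄)`. -/
def bS (lam : Fin M → ℝ) : Matrix (Fin M) (Fin M) (Ser M) :=
  Matrix.diagonal fun i => cst (lam i) * betaS lam i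

theorem map_bS (D : Derivation ℂ (Ser M) (Ser M)) (lam : Fin M → ℝ) (hκ : D kap = 0)
    (hz : D zbS = 0) : (bS lam).map D = 0 := by
  ext i j : 1
  rcases eq_or_ne i j with rfl | h
  · have : D (betaS lam i) = 0 := derivation_subst_eq_zero _ (constantCoeff_betaS_arg lam i)
      (by simp [hκ, hz]) _
    simp [bS, this]
  · simp [bS, h]

theorem bS_mem (lam : Fin M → ℝ) (i j : Fin M) : bS lam i j ∈ paramRing M :=
  diagonal_mem (fun i => Subalgebra.mul_mem _ (cst_mem _) (betaS_mem lam i)) i j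

theorem lamS_mem (lam : Fin M → ℝ) (i j : Fin M) : lamS lam i j ∈ paramRing M :=
  diagonal_mem (fun _ => cst_mem _) i j

variable {lam : Fin M → ℝ}

theorem bS_mul_self (hlam : ∀ i, 0 < lam i) :
    bS lam * bS lam = lamS lam * lamS lam - (kap * zbS : Ser M) • 1 := by
  rw [bS, lamS, Matrix.diagonal_mul_diagonal, Matrix.diagonal_mul_diagonal, Matrix.smul_one_eq_diagonal,
    Matrix.diagonal_sub]
  congr 1
  ext1 i
  have h : (cst (lam i) : Ser M) * cst (lam i) * cst ((lam i : ℂ)⁻¹ ^ 2) = 1 := by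
    rw [← map_mul, ← map_mul]
    have : (lam i : ℂ) ≠ 0 := by exact_mod_cast (hlam i).ne'
    rw [show (lam i : ℂ) * lam i * (lam i : ℂ)⁻¹ ^ 2 = 1 by field_simp, map_one]
  linear_combination (cst (lam i)) ^ 2 * betaS_mul_self lam i - (kap * zbS) * h

/-- The constant terms. -/
abbrev cc : Ser M →+* MvPolynomial (Coord M) ℂ := PowerSeries.constantCoeff

theorem cc_bS : cc.mapMatrix (bS lam) = cc.mapMatrix (lamS lam) := by
  ext1 i j
  rcases eq_or_ne i j with rfl | h
  · simp [bS, lamS, cc, constantCoeff_betaS]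
  · simp [bS, lamS, h]

end

end KontsevichPenner

/-! ### The integrand as a function of `H'` and `p`, and the translation of `H` -/

namespace KontsevichPenner

noncomputable section

variable {M : ℕ} {lam : Fin M → ℝ}

/-- `Λ + B - H + z`, up to scaling. -/
def numS (lam : Fin M → ℝ) (H : Matrix (Fin M) (Fin M) (Ser M)) :
    Matrix (Fin M) (Fin M) (Ser M) :=
  lamS lam + bS lam - (kap : Ser M) • H + (kap * zS : Ser M) • 1

/-- The exponent as a function of the matrix `H'` and the covector `p`, relative to the Gaussian
weight. -/
def expo (lam : Fin M → ℝ) (H' : Matrix (Fin M) (Fin M) (Ser M)) (p : Fin M → Ser M) : Ser M :=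
  exponentAt (cst (1 / 6)) (cst (1 / 2)) kap zS (lamS lam) (bS lam) wS H' p +
    cst (1 / 2) * (hS ^ 2 * lamS lam).trace

/-- The contribution of the Gaussian weight in `u` and `w`. -/
def gaussU (lam : Fin M → ℝ) : Ser M := cst (1 / 2) * (uS ⬝ᵥ (lamS lam).mulVec wS)

/-- The constant covector `u (2Λ)⁻¹`. -/
def p₀ (lam : Fin M → ℝ) : Fin M → Ser M :=
  Matrix.vecMul uS ((cst (1 / 2) : Ser M) • lamInvS lam)

theorem cst_half_add : (cst (1 / 2) : Ser M) + cst (1 / 2) = 1 := by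
  rw [← map_add]; norm_num

theorem p₀_apply (lam : Fin M → ℝ) (j : Fin M) :
    p₀ lam j = uS j * (cst (1 / 2) * cst (lam j)⁻¹) := by
  rw [p₀, lamInvS, ← Matrix.diagonal_smul, Matrix.vecMul_diagonal]
  rfl

theorem p₀_dotProduct (lam : Fin M → ℝ) (v : Fin M → Ser M) :
    p₀ lam ⬝ᵥ v = uS ⬝ᵥ ((cst (1 / 2) : Ser M) • lamInvS lam).mulVec v := by
  rw [p₀, Matrix.dotProduct_mulVec]

theorem evT_lamS (c : ℂ) : (evT (M := M) c : Ser M →+* Ser M).mapMatrix (lamS lam) = lamS lam := by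
  ext1 i j
  exact (lamS_mem lam i j).1 c

theorem evT_bS (c : ℂ) : (evT (M := M) c : Ser M →+* Ser M).mapMatrix (bS lam) = bS lam := by
  ext1 i j
  exact (bS_mem lam i j).1 c

theorem evT_hS_matrix (c : ℂ) : (evT (M := M) c : Ser M →+* Ser M).mapMatrix hS = hS := by
  ext1 i j
  exact (hS_mem i j).1 c

theorem hS_trace_mem : (hS ^ 2 * lamS lam).trace ∈ paramRing M :=
  trace_mem (matrix_mul_mem (by rw [pow_two]; exact matrix_mul_mem hS_mem hS_mem) (lamS_mem lam))

theorem evT_expo (c : ℂ) (H' : Matrix (Fin M) (Fin M) (Ser M)) (p : Fin M → Ser M) :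
    evT c (expo lam H' p) =
      expo lam ((evT (M := M) c : Ser M →+* Ser M).mapMatrix H') (fun i => evT c (p i)) := by
  have h := map_exponentAt (evT (M := M) c : Ser M →+* Ser M) (cst (1 / 6)) (cst (1 / 2)) kap zS (lamS lam)
    (bS lam) wS H' p
  have e : evT c (exponentAt (cst (1 / 6)) (cst (1 / 2)) kap zS (lamS lam) (bS lam) wS H' p) =
      exponentAt (cst (1 / 6)) (cst (1 / 2)) kap zS (lamS lam) (bS lam) wS
        ((evT (M := M) c : Ser M →+* Ser M).mapMatrix H') (fun i => evT c (p i)) := by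
    refine Eq.trans h ?_
    rw [evT_lamS, evT_bS]
    congr 1
    · exact AlgHom.commutes (evT c) _
    · exact AlgHom.commutes (evT c) _
    · exact kap_mem.1 c
    · exact zS_mem.1 c
    · ext1 i
      exact (wS_mem i).1 c
  rw [expo, map_add, e, map_mul, hS_trace_mem.1, AlgHom.commutes]
  rfl

theorem evT_gaussU (c : ℂ) : evT c (gaussU lam) = gaussU lam := by
  simp [gaussU, dotProduct, Matrix.mulVec, lamS, Matrix.diagonal_apply]

theorem evT_numS (c : ℂ) (H' : Matrix (Fin M) (Fin M) (Ser M)) :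
    (evT (M := M) c : Ser M →+* Ser M).mapMatrix (numS lam H') =
      numS lam ((evT (M := M) c : Ser M →+* Ser M).mapMatrix H') := by
  have h2 : ∀ (a : Ser M) (K : Matrix (Fin M) (Fin M) (Ser M)),
      (evT (M := M) c : Ser M →+* Ser M).mapMatrix (a • K) =
        evT c a • (evT (M := M) c : Ser M →+* Ser M).mapMatrix K := by
    intro a K
    ext i j
    simp
  rw [numS, map_add, map_sub, map_add, h2, h2, evT_lamS, evT_bS, map_mul, map_one, kap_mem.1,
    zS_mem.1]
  rfl

/-- Needed for the exponential to make sense as a formal series. In degree `0` one has `κ = 0` and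
`B = Λ`, the two traces cancel, and `-½ pΛ(2Λ)w + ½uΛw` vanishes exactly because `p = u(2Λ)⁻¹`
there. -/
theorem cc_expo {H' : Matrix (Fin M) (Fin M) (Ser M)} {p : Fin M → Ser M}
    (hlam : ∀ i, 0 < lam i) (hH : cc.mapMatrix H' = cc.mapMatrix hS)
    (hp : ∀ i, cc (p i) = cc (p₀ lam i)) : cc (expo lam H' p + gaussU lam) = 0 := by
  have hp' : cc ∘ p = Matrix.vecMul (cc ∘ uS)
      (cc.mapMatrix ((cst (1 / 2) : Ser M) • lamInvS lam)) := by
    ext1 i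
    rw [Function.comp_apply, hp, p₀]
    simp only [Matrix.vecMul, dotProduct, map_sum, map_mul, RingHom.mapMatrix_apply,
      Matrix.map_apply, Function.comp_apply]
  have h1 : ∀ K : Matrix (Fin M) (Fin M) (Ser M), cc K.trace = (cc.mapMatrix K).trace :=
    fun K => by simp [Matrix.trace]
  have h3 : cc (uS ⬝ᵥ (lamS lam).mulVec wS) =
      (cc ∘ uS) ⬝ᵥ (cc.mapMatrix (lamS lam)).mulVec (cc ∘ wS) := by
    simp [dotProduct, Matrix.mulVec]
  have hLL : cc.mapMatrix (((cst (1 / 2) : Ser M) • lamInvS lam)) * (cc.mapMatrix (lamS lam) *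
      (cc.mapMatrix (lamS lam) + cc.mapMatrix (lamS lam))) = cc.mapMatrix (lamS lam) := by
    rw [← map_add, ← map_mul, ← map_mul]
    congr 1
    rw [Matrix.smul_mul, ← Matrix.mul_assoc, lamInvS_mul_lamS hlam, Matrix.one_mul, smul_add,
      ← add_smul, cst_half_add, one_smul]
  rw [expo, gaussU, map_add, map_add, map_exponentAt, hH, cc_bS, map_mul, map_mul, h1, h3,
    constantCoeff_kap, hp', map_mul, map_pow]
  simp only [exponentAt, zero_mul, zero_smul, sub_zero, mul_zero, zero_sub,
    ← Matrix.dotProduct_mulVec, Matrix.mulVec_mulVec, hLL]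
  ring

theorem cc_sub_smul (H' X : Matrix (Fin M) (Fin M) (Ser M)) {a : Ser M} (ha : cc a = 0) :
    cc.mapMatrix (H' - a • X) = cc.mapMatrix H' := by
  ext1 i j
  simp only [RingHom.mapMatrix_apply, Matrix.map_apply, Matrix.sub_apply, Matrix.smul_apply,
    smul_eq_mul, map_sub, map_mul, ha, zero_mul, sub_zero]

/-- `expo` contains `½ tr H²Λ` for the generic `H`, to undo the weight inside the expectation. A
derivation that is constant along `H'` and `p` sees only this term. -/
theorem expo_eq_zero_of_killed (D : Derivation ℂ (Ser M) (Ser M)) (hκ : D kap = 0)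
    (hz : D zS = 0) (hzb : D zbS = 0) (hw : ∀ i, D (wS i) = 0)
    {H' : Matrix (Fin M) (Fin M) (Ser M)} {p : Fin M → Ser M} (hH : H'.map D = 0)
    (hp : ∀ i, D (p i) = 0) :
    D (expo lam H' p) = cst (1 / 2) * D (hS ^ 2 * lamS lam).trace := by
  rw [expo, map_add, derivation_exponentAt_eq_zero D (by simp) (by simp) hκ hz (map_lamS D lam)
    (map_bS D lam hκ hzb) hw hH hp, Derivation.leibniz]
  simp

theorem numS_map_eq_zero (D : Derivation ℂ (Ser M) (Ser M)) (hκ : D kap = 0)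
    (hz : D zS = 0) (hzb : D zbS = 0) {H' : Matrix (Fin M) (Fin M) (Ser M)} (hH : H'.map D = 0) :
    (numS lam H').map D = 0 := by
  ext1 i j
  have h1 : D (H' i j) = 0 := congrFun (congrFun hH i) j
  have h2 : D (lamS lam i j) = 0 := congrFun (congrFun (map_lamS D lam) i) j
  have h3 : D (bS lam i j) = 0 := congrFun (congrFun (map_bS D lam hκ hzb) i) j
  have h4 : D ((1 : Matrix (Fin M) (Fin M) (Ser M)) i j) = 0 := by
    rcases eq_or_ne i j with rfl | h
    · simp
    · simp [h]
  simp [numS, h1, h2, h3, h4, hκ, hz]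

/-- The determinant factor together with the exponential. -/
def integrandAt (lam : Fin M → ℝ) (H' : Matrix (Fin M) (Fin M) (Ser M)) (p : Fin M → Ser M) :
    Ser M :=
  (numS lam H').det * expS (expo lam H' p + gaussU lam)

theorem evT_integrandAt (hlam : ∀ i, 0 < lam i) (c : ℂ) {H' : Matrix (Fin M) (Fin M) (Ser M)}
    {p : Fin M → Ser M} (hH : cc.mapMatrix H' = cc.mapMatrix hS)
    (hp : ∀ i, cc (p i) = cc (p₀ lam i)) :
    evT c (integrandAt lam H' p) =
      integrandAt lam ((evT (M := M) c : Ser M →+* Ser M).mapMatrix H') (fun i => evT c (p i)) := by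
  rw [integrandAt, integrandAt, map_mul, evT_subst c (cc_expo hlam hH hp), map_add, evT_expo,
    evT_gaussU, ← evT_numS]
  congr 1
  exact RingHom.map_det (evT (M := M) c : Ser M →+* Ser M) _

theorem dH_trace (i j : Fin M) :
    dH i j (hS ^ 2 * lamS lam).trace = (cst (lam i) + cst (lam j)) * hS j i := by
  have h : (hS : Matrix (Fin M) (Fin M) (Ser M)).map (dH i j) = Matrix.single i j 1 := by
    ext1 k l
    rw [Matrix.map_apply, dH_hS, Matrix.single_apply]
  rw [derivation_trace, pow_two, derivation_matrix_mul, derivation_matrix_mul, h, map_lamS,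
    Matrix.mul_zero, add_zero, Matrix.add_mul, Matrix.trace_add, Matrix.mul_assoc,
    Matrix.trace_single_mul, Matrix.trace_mul_comm, ← Matrix.mul_assoc, Matrix.trace_mul_comm,
    Matrix.trace_single_mul]
  simp [lamS, Matrix.mul_diagonal, Matrix.diagonal_mul]
  ring

/-- Invariance under a translation of `H` by a matrix of rank one. -/
theorem expect_translate (hlam : ∀ i, 0 < lam i) (n : ℕ) :
    expect₀ lam n (integrandAt lam (hS - (kap : Ser M) • Matrix.vecMulVec wS (p₀ lam)) (p₀ lam)) =
      expect₀ lam n (integrandAt lam hS (p₀ lam)) := by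
  set H' : Matrix (Fin M) (Fin M) (Ser M) :=
    hS - (tS * kap : Ser M) • Matrix.vecMulVec wS (p₀ lam) with hH'
  have hcc : cc.mapMatrix H' = cc.mapMatrix hS :=
    cc_sub_smul _ _ (by rw [map_mul, constantCoeff_kap, mul_zero])
  have hp₀ : ∀ c i, evT c (p₀ lam i) = p₀ lam i := by
    intro c i
    simp [p₀_apply]
  have hW : ∀ c, (evT (M := M) c : Ser M →+* Ser M).mapMatrix H' =
      hS - (cst c * kap : Ser M) • Matrix.vecMulVec wS (p₀ lam) := by
    intro c
    ext1 i j
    simp [hH', Matrix.vecMulVec_apply, hp₀]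
  refine expect_evT_eq (F := integrandAt lam H' (p₀ lam)) ?_ ?_ ?_ n
  · rw [evT_integrandAt hlam 0 hcc fun _ => rfl, hW]
    simp [hp₀]
  · rw [evT_integrandAt hlam 1 hcc fun _ => rfl, hW]
    simp [hp₀]
  intro m
  set F := integrandAt lam H' (p₀ lam) with hF
  have hdT : ∀ i, dT (p₀ lam i) = 0 := fun i => by simp [p₀_apply]
  have hdH : ∀ i j k, dH i j (p₀ lam k) = 0 := fun i j k => by simp [p₀_apply]
  -- Transport along the family: `H'` is constant for `δ`, so `δ` acts on `F` only through the term
  -- that compensates the weight.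
  set δ : Derivation ℂ (Ser M) (Ser M) :=
    dT + ∑ i, ∑ j, (kap * (wS i * p₀ lam j)) • dH i j with hδ
  have hδ' : ∀ x, δ x = dT x + ∑ i, ∑ j, kap * (wS i * p₀ lam j) * dH i j x := by
    intro x
    simp only [hδ, Derivation.add_apply]
    congr 1
    rw [← Derivation.coeFnAddMonoidHom_apply, map_sum, Finset.sum_apply]
    refine Finset.sum_congr rfl fun i _ => ?_
    rw [map_sum, Finset.sum_apply]
    rfl
  have hδκ : δ kap = 0 := by simp [hδ']
  have hδz : δ zS = 0 := by simp [hδ']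
  have hδzb : δ zbS = 0 := by simp [hδ']
  have hδw : ∀ i, δ (wS i) = 0 := fun i => by simp [hδ']
  have hδu : ∀ i, δ (uS i) = 0 := fun i => by simp [hδ']
  have hδp : ∀ i, δ (p₀ lam i) = 0 := fun i => by simp [hδ', hdT, hdH]
  have hδt : δ tS = 1 := by simp [hδ']
  have hδh : ∀ i j, δ (hS i j) = kap * (wS i * p₀ lam j) := by
    intro i j
    simp [hδ', dH_hS, ite_and]
  have hδH : H'.map δ = 0 := by
    ext1 i j
    simp [hH', Matrix.vecMulVec_apply, hδh, hδw, hδp, hδκ, hδt]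
    ring
  have hδg : δ (gaussU lam) = 0 := by
    simp [gaussU, dotProduct, Matrix.mulVec_diagonal, lamS, hδu, hδw]
  have hδF : δ F = F * (cst (1 / 2) * δ (hS ^ 2 * lamS lam).trace) := by
    rw [hF, integrandAt, Derivation.leibniz, derivation_expS _ (cc_expo hlam hcc fun _ => rfl),
      derivation_det_eq_zero _ (numS_map_eq_zero δ hδκ hδz hδzb hδH), map_add,
      expo_eq_zero_of_killed δ hδκ hδz hδzb hδw hδH hδp, hδg]
    simp only [smul_eq_mul]
    ring
  have hT : dT (hS ^ 2 * lamS lam).trace = 0 := hS_trace_mem.2.1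
  -- The velocity `κ w_i p_j` does not involve `H`, so no Jacobian appears, and `dT F` is minus a
  -- sum of terms that `expect_dH` annihilates.
  have hdF : dT F = -∑ i, ∑ j, (dH i j (kap * (wS i * p₀ lam j) * F) -
      cst ((lam i + lam j) / 2) * (hS j i * (kap * (wS i * p₀ lam j) * F))) := by
    have h1 := hδ' F
    rw [hδF, hδ', hT, zero_add] at h1
    rw [← sub_eq_iff_eq_add.2 h1, Finset.mul_sum, Finset.mul_sum, ← Finset.sum_sub_distrib,
      ← Finset.sum_neg_distrib]
    refine Finset.sum_congr rfl fun i _ => ?_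
    rw [Finset.mul_sum, Finset.mul_sum, ← Finset.sum_sub_distrib, ← Finset.sum_neg_distrib]
    refine Finset.sum_congr rfl fun j _ => ?_
    have h2 : dH i j (kap * (wS i * p₀ lam j)) = 0 := by simp [hdH]
    rw [Derivation.leibniz, h2, dH_trace, show (cst ((lam i + lam j) / 2) : Ser M) =
      cst (1 / 2) * (cst (lam i) + cst (lam j)) by
        rw [← map_add, ← map_mul]; congr 1; ring]
    simp only [smul_eq_mul]
    ring
  rw [hdF, map_neg, map_sum]
  simp only [map_sum]
  rw [neg_eq_zero]
  refine Finset.sum_eq_zero fun i _ => Finset.sum_eq_zero fun j _ => ?_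
  rw [map_sub, expect_dH hlam, ← Algebra.smul_def, map_smul, smul_eq_mul, sub_self]

end

end KontsevichPenner

/-! ### The change of the covector -/

namespace KontsevichPenner

noncomputable section

variable {M : ℕ} {lam : Fin M → ℝ}

/-- The constant matrix `(2Λ)⁻¹`. -/
abbrev halfInv (lam : Fin M → ℝ) : Matrix (Fin M) (Fin M) (Ser M) :=
  (cst (1 / 2) : Ser M) • lamInvS lam

theorem halfInv_mul (hlam : ∀ i, 0 < lam i) :
    halfInv lam * ((cst 2 : Ser M) • lamS lam) = 1 := by
  rw [halfInv, Matrix.smul_mul, Matrix.mul_smul, lamInvS_mul_lamS hlam, smul_smul, ← map_mul]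
  norm_num

theorem numS_mem {H' : Matrix (Fin M) (Fin M) (Ser M)} (h : ∀ i j, H' i j ∈ paramRing M)
    (i j : Fin M) : numS lam H' i j ∈ paramRing M := by
  simp only [numS, Matrix.add_apply, Matrix.sub_apply, Matrix.smul_apply, smul_eq_mul]
  exact Subalgebra.add_mem _ (Subalgebra.sub_mem _ (Subalgebra.add_mem _ (lamS_mem _ _ _)
    (bS_mem _ _ _)) (Subalgebra.mul_mem _ kap_mem (h _ _)))
    (Subalgebra.mul_mem _ (Subalgebra.mul_mem _ kap_mem zS_mem) (one_matrix_mem _ _))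

theorem cc_numS (H' : Matrix (Fin M) (Fin M) (Ser M)) :
    cc.mapMatrix (numS lam H') = cc.mapMatrix ((cst 2 : Ser M) • lamS lam) := by
  have h : cc.mapMatrix (numS lam H') = cc.mapMatrix (lamS lam) + cc.mapMatrix (bS lam) := by
    rw [← map_add]
    ext1 i j
    simp only [numS, RingHom.mapMatrix_apply, Matrix.map_apply, Matrix.add_apply,
      Matrix.sub_apply, Matrix.smul_apply, smul_eq_mul, map_add, map_sub, map_mul,
      constantCoeff_kap, zero_mul, sub_zero, add_zero]
  rw [h, cc_bS, ← map_add, ← two_smul (Ser M),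
    show (cst 2 : Ser M) = 2 from map_ofNat (algebraMap ℂ (Ser M)) 2]

theorem isUnit_cc_lamS (hlam : ∀ i, 0 < lam i) :
    IsUnit (cc.mapMatrix ((cst 2 : Ser M) • lamS lam)).det := by
  refine Matrix.isUnit_det_of_left_inverse (B := cc.mapMatrix (halfInv lam)) ?_
  rw [← map_mul, halfInv_mul hlam, map_one]

theorem isUnit_det_numS (hlam : ∀ i, 0 < lam i) (H' : Matrix (Fin M) (Fin M) (Ser M)) :
    IsUnit (numS lam H').det :=
  isUnit_det_of_map_constantCoeff (cc_numS H') (isUnit_cc_lamS hlam)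

/-- Invariance under the linear change of the covector `p` from `u (2Λ)⁻¹` to
`u (Λ + B - H + z)⁻¹`. -/
theorem expect_change_covector (hlam : ∀ i, 0 < lam i) (n : ℕ) :
    expect₀ lam n ((numS lam hS)⁻¹.det *
      integrandAt lam (hS - (kap : Ser M) • Matrix.vecMulVec wS
        (Matrix.vecMul uS (numS lam hS)⁻¹)) (Matrix.vecMul uS (numS lam hS)⁻¹)) =
    expect₀ lam n ((halfInv lam).det *
      integrandAt lam (hS - (kap : Ser M) • Matrix.vecMulVec wS (p₀ lam)) (p₀ lam)) := by
  set V : Matrix (Fin M) (Fin M) (Ser M) := numS lam hS - (cst 2 : Ser M) • lamS lam with hV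
  -- The inverse matrix is interpolated linearly, from `2Λ` to `Λ + B - κH + κz`. It stays
  -- invertible because `V` vanishes modulo `ε`.
  set K : Matrix (Fin M) (Fin M) (Ser M) := (cst 2 : Ser M) • lamS lam + (tS : Ser M) • V with hK
  have hVmem : ∀ i j, V i j ∈ paramRing M := fun i j =>
    Subalgebra.sub_mem _ (numS_mem hS_mem i j) (Subalgebra.mul_mem _ (cst_mem _) (lamS_mem _ _ _))
  have hLmem : ∀ i j, ((cst 2 : Ser M) • lamS lam) i j ∈ paramRing M := fun i j =>
    Subalgebra.mul_mem _ (cst_mem _) (lamS_mem _ _ _)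
  have hVcc : cc.mapMatrix V = 0 := by rw [hV, map_sub, cc_numS, sub_self]
  have hKcc : cc.mapMatrix K = cc.mapMatrix ((cst 2 : Ser M) • lamS lam) := by
    rw [hK, map_add]
    ext1 i j
    have : cc (V i j) = 0 := congrFun (congrFun hVcc i) j
    simp only [Matrix.add_apply, RingHom.mapMatrix_apply, Matrix.map_apply, Matrix.smul_apply,
      smul_eq_mul, map_mul, this, mul_zero, add_zero]
  have hKu : IsUnit K.det := isUnit_det_of_map_constantCoeff hKcc (isUnit_cc_lamS hlam)
  have hKev : ∀ c, (evT (M := M) c : Ser M →+* Ser M).mapMatrix K =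
      (cst 2 : Ser M) • lamS lam + (cst c : Ser M) • V := by
    intro c
    ext1 i j
    have h1 := (hVmem i j).1 c
    have h2 := (hLmem i j).1 c
    have h3 : K i j = ((cst 2 : Ser M) • lamS lam) i j + tS * V i j := rfl
    rw [RingHom.mapMatrix_apply, Matrix.map_apply, h3]
    generalize hv : V i j = v at *
    generalize hl : ((cst 2 : Ser M) • lamS lam) i j = l at *
    rw [map_add, map_mul]
    simp only [RingHom.coe_coe]
    rw [h1, h2, evT_tS, Matrix.add_apply, hl]
    exact congrArg (l + cst c * ·) hv.symm
  set N := K⁻¹ with hN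
  have hNcc : cc.mapMatrix N = cc.mapMatrix (halfInv lam) := by
    rw [hN, map_inv_of_isUnit_det cc hKu, hKcc]
    apply Matrix.inv_eq_left_inv
    rw [← map_mul, halfInv_mul hlam, map_one]
  have hKT : K.map dT = V := by
    ext1 i j
    simp [hK, (hVmem i j).2.1, (lamS_mem lam i j).2.1]
  have hKU : ∀ k, K.map (dU k) = 0 := by
    intro k
    ext1 i j
    simp [hK, (hVmem i j).2.2, (lamS_mem lam i j).2.2]
  have hNU : ∀ k, N.map (dU k) = 0 := fun k => derivation_inv_eq_zero _ hKu (hKU k)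
  have hNT : N.map dT = (-(N * V)) * N := by
    rw [hN, derivation_inv _ hKu, hKT, Matrix.neg_mul]
  have hQU : ∀ k, (-(N * V)).map (dU k) = 0 := by
    intro k
    have := derivation_matrix_mul (dU k) N V
    rw [hNU, map_matrix_eq_zero fun i j => (hVmem i j).2.2 k, Matrix.zero_mul,
      Matrix.mul_zero, add_zero] at this
    ext1 i j
    have := congrFun (congrFun this i) j
    simp only [Matrix.map_apply, Matrix.zero_apply] at this
    simp [this]
  set p := Matrix.vecMul uS N with hp
  set H' : Matrix (Fin M) (Fin M) (Ser M) := hS - (kap : Ser M) • Matrix.vecMulVec wS p with hH'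
  have hcc : cc.mapMatrix H' = cc.mapMatrix hS := cc_sub_smul _ _ constantCoeff_kap
  have hpcc : ∀ i, cc (p i) = cc (p₀ lam i) := by
    intro i
    have h1 : ∀ k, cc (N k i) = cc (halfInv lam k i) := fun k =>
      congrFun (congrFun hNcc k) i
    simp only [hp, p₀, Matrix.vecMul, dotProduct, map_sum, map_mul, h1]
  set g := Matrix.vecMul uS (-(N * V)) with hg
  -- Since `N` has `t`-derivative `-NVN`, the covector `p = uN` satisfies `dT p = gN = ∑ g_k
  -- ∂p/∂u_k`. So `δ` kills `p`, and with it every factor that depends on `t` and `u` through `p`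
  -- only.
  set δ : Derivation ℂ (Ser M) (Ser M) := dT - ∑ k, g k • dU k with hδ
  have hδ' : ∀ x, δ x = dT x - ∑ k, g k * dU k x := by
    intro x
    simp only [hδ, Derivation.sub_apply]
    congr 1
    rw [← Derivation.coeFnAddMonoidHom_apply, map_sum, Finset.sum_apply]
    rfl
  have hδκ : δ kap = 0 := by simp [hδ']
  have hδz : δ zS = 0 := by simp [hδ']
  have hδzb : δ zbS = 0 := by simp [hδ']
  have hδw : ∀ i, δ (wS i) = 0 := fun i => by simp [hδ']
  have hδh : ∀ i j, δ (hS i j) = 0 := fun i j => by simp [hδ']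
  have hδp : ∀ j, δ (p j) = 0 := by
    intro j
    have h1 : dT (p j) = Matrix.vecMul g N j := by
      rw [hp, congrFun (derivation_vecMul dT N uS) j, hNT, hg, Matrix.vecMul_vecMul]
      simp [Matrix.vecMul, dotProduct]
    have h2 : ∀ k, dU k (p j) = N k j := by
      intro k
      rw [hp, congrFun (derivation_vecMul (dU k) N uS) j, hNU]
      simp [Matrix.vecMul, dotProduct]
    rw [hδ', h1]
    simp only [h2, Matrix.vecMul, dotProduct, sub_self]
  have hδH : H'.map δ = 0 := by
    ext1 i j
    simp [hH', Matrix.vecMulVec_apply, hδh, hδw, hδp, hδκ]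
  have hP : dT (numS lam H').det = ∑ k, g k * dU k (numS lam H').det := by
    rw [← sub_eq_zero, ← hδ']
    exact derivation_det_eq_zero _ (numS_map_eq_zero δ hδκ hδz hδzb hδH)
  have hG : dT (expo lam H' p) = ∑ k, g k * dU k (expo lam H' p) := by
    rw [← sub_eq_zero, ← hδ', expo_eq_zero_of_killed δ hδκ hδz hδzb hδw hδH hδp, hδ',
      hS_trace_mem.2.1]
    simp [hS_trace_mem.2.2]
  have key := expectInt_linear_change hlam hNT hNU hQU hP hG (cc_expo hlam hcc hpcc)
  have hevN : ∀ c, (evT (M := M) c : Ser M →+* Ser M).mapMatrix N =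
      ((cst 2 : Ser M) • lamS lam + (cst c : Ser M) • V)⁻¹ := by
    intro c
    rw [hN, map_inv_of_isUnit_det _ hKu, hKev]
  have hevp : ∀ c, (fun i => evT c (p i)) =
      Matrix.vecMul uS ((cst 2 : Ser M) • lamS lam + (cst c : Ser M) • V)⁻¹ := by
    intro c
    ext1 j
    rw [← hevN]
    simp [hp, Matrix.vecMul, dotProduct]
  have hevH : ∀ c, (evT (M := M) c : Ser M →+* Ser M).mapMatrix H' =
      hS - (kap : Ser M) • Matrix.vecMulVec wS
        (Matrix.vecMul uS ((cst 2 : Ser M) • lamS lam + (cst c : Ser M) • V)⁻¹) := by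
    intro c
    rw [← hevp]
    ext1 i j
    simp [hH', Matrix.vecMulVec_apply]
  have hev : ∀ c, evT c (N.det * integrandAt lam H' p) =
      ((cst 2 : Ser M) • lamS lam + (cst c : Ser M) • V)⁻¹.det * integrandAt lam
      (hS - (kap : Ser M) • Matrix.vecMulVec wS
        (Matrix.vecMul uS ((cst 2 : Ser M) • lamS lam + (cst c : Ser M) • V)⁻¹))
      (Matrix.vecMul uS ((cst 2 : Ser M) • lamS lam + (cst c : Ser M) • V)⁻¹) := by
    intro c
    rw [map_mul, evT_integrandAt hlam c hcc hpcc, hevH, hevp, ← hevN]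
    congr 1
    exact RingHom.map_det (evT (M := M) c : Ser M →+* Ser M) _
  have hinv0 : ((cst 2 : Ser M) • lamS lam + (cst 0 : Ser M) • V)⁻¹ = halfInv lam := by
    rw [show (cst 0 : Ser M) = 0 from map_zero _, zero_smul, add_zero]
    exact Matrix.inv_eq_left_inv (halfInv_mul hlam)
  have hinv1 : (cst 2 : Ser M) • lamS lam + (cst 1 : Ser M) • V = numS lam hS := by
    rw [show (cst 1 : Ser M) = 1 from map_one _, one_smul, hV, add_sub_cancel]
  refine expect_evT_eq (F := N.det * integrandAt lam H' p) ?_ ?_ ?_ n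
  · rw [hev, hinv0]
    rfl
  · rw [hev, hinv1]
  · intro m
    rw [integrandAt, ← mul_assoc]
    exact key m

end

end KontsevichPenner

/-! ### The shift of `z` and the assembly of the changes of variables -/

namespace KontsevichPenner

noncomputable section

variable {M : ℕ} {lam : Fin M → ℝ}

theorem expect_cst_mul (τ : ℕ → ℂ) (n : ℕ) (d : ℂ) (F : Ser M) :
    expect lam τ n (cst d * F) = d * expect lam τ n F := by
  rw [cst, ← Algebra.smul_def, map_smul, smul_eq_mul]

theorem det_one_add_vecMulVec (v p : Fin M → Ser M) :
    (1 + Matrix.vecMulVec v p).det = 1 + p ⬝ᵥ v := by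
  rw [Matrix.vecMulVec_eq Unit, Matrix.det_one_add_replicateCol_mul_replicateRow]

/-- The exponent of the integrand after the change of variables, as a function of `z`. -/
def expoZ (ξ : Ser M) : Ser M :=
  cst (1 / 6) * (kap * ((hS ^ 3).trace + ξ ^ 3)) +
    cst (1 / 2) * (kap * (uS ⬝ᵥ (hS + ξ • 1).mulVec wS))

theorem expoZ_eq (ξ : Ser M) : expoZ ξ = cst (1 / 6) * (kap * ((hS ^ 3).trace + ξ ^ 3)) +
    cst (1 / 2) * (kap * (uS ⬝ᵥ hS.mulVec wS + ξ * (uS ⬝ᵥ wS))) := by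
  rw [expoZ, Matrix.add_mulVec, Matrix.smul_mulVec, Matrix.one_mulVec, dotProduct_add,
    dotProduct_smul, smul_eq_mul]

theorem hS_cube_mem : (hS ^ 3).trace ∈ paramRing M := by
  rw [pow_succ, pow_two]
  exact trace_mem (matrix_mul_mem (matrix_mul_mem hS_mem hS_mem) hS_mem)

theorem cc_expoZ (ξ : Ser M) : cc (expoZ ξ) = 0 := by
  rw [expoZ]
  simp only [map_add, map_mul, constantCoeff_kap, zero_mul, mul_zero, add_zero]

theorem evT_expoZ (c : ℂ) (ξ : Ser M) : evT c (expoZ ξ) = expoZ (evT c ξ) := by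
  rw [expoZ_eq, expoZ_eq]
  simp [hS_cube_mem.1 c, dotProduct, Matrix.mulVec]

theorem derivation_expoZ (D : Derivation ℂ (Ser M) (Ser M)) (hκ : D kap = 0)
    (hh : ∀ i j, D (hS i j) = 0) (hu : ∀ i, D (uS i) = 0) (hw : ∀ i, D (wS i) = 0) (ξ : Ser M) :
    D (expoZ ξ) = (cst (1 / 6) * (kap * (3 * ξ ^ 2)) + cst (1 / 2) * (kap * (uS ⬝ᵥ wS))) * D ξ := by
  have h1 : D (hS ^ 3).trace = 0 := by
    have hm : hS.map D = 0 := map_matrix_eq_zero hh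
    rw [derivation_trace, pow_succ, pow_two, derivation_matrix_mul, derivation_matrix_mul, hm]
    simp
  have h2 : D (uS ⬝ᵥ wS) = 0 := by simp [dotProduct, hu, hw]
  have h3 : D (uS ⬝ᵥ hS.mulVec wS) = 0 := by simp [dotProduct, Matrix.mulVec, hu, hw, hh]
  rw [expoZ_eq]
  simp only [map_add, Derivation.leibniz, Derivation.leibniz_pow, h1, h2, h3, hκ,
    Derivation.map_algebraMap, smul_eq_mul, nsmul_eq_mul, mul_zero, add_zero, zero_add]
  norm_num
  ring

/-- Invariance under the nonlinear change of the variable `z`. -/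
theorem expect_shift_z (hlam : ∀ i, 0 < lam i) (n : ℕ) :
    expect₀ lam n ((numS lam hS)⁻¹.det *
      integrandAt lam (hS - (kap : Ser M) • Matrix.vecMulVec wS
        (Matrix.vecMul uS (numS lam hS)⁻¹)) (Matrix.vecMul uS (numS lam hS)⁻¹)) =
    expect₀ lam n (expS (expoZ zS)) := by
  set N := (numS lam hS)⁻¹ with hN
  have hu := isUnit_det_numS hlam (hS : Matrix (Fin M) (Fin M) (Ser M))
  set p := Matrix.vecMul uS N with hp
  set y : Ser M := kap * (p ⬝ᵥ wS) with hy
  set r : Ser M := kap ^ 2 * (p ⬝ᵥ N.mulVec wS) with hr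
  have hpN : uS = Matrix.vecMul p (numS lam hS) := by
    rw [hp, Matrix.vecMul_vecMul, hN, Matrix.nonsing_inv_mul _ hu, Matrix.vecMul_one]
  -- The translation of `H` adds the rank-one matrix `κ² w p` to `Λ + B - κH + κz`, so the matrix
  -- determinant lemma applies.
  have hdet : N.det * (numS lam (hS - (kap : Ser M) • Matrix.vecMulVec wS p)).det = 1 + r := by
    have h1 : numS lam (hS - (kap : Ser M) • Matrix.vecMulVec wS p) =
        numS lam hS + Matrix.vecMulVec ((kap ^ 2 : Ser M) • wS) p := by
      rw [numS, numS, Matrix.smul_vecMulVec, smul_sub, smul_smul, ← pow_two]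
      abel
    rw [← Matrix.det_mul, h1, Matrix.mul_add, hN, Matrix.nonsing_inv_mul _ hu,
      Matrix.mul_vecMulVec, det_one_add_vecMulVec, Matrix.mulVec_smul, dotProduct_smul, hr,
      smul_eq_mul]
  have hexp : expo lam (hS - (kap : Ser M) • Matrix.vecMulVec wS p) p + gaussU lam =
      expoZ (zS - y) + cst (1 / 2) * (y * zbS) := by
    refine exponentAt_rankOne ?_ (bS_mul_self hlam) hpN
    rw [← map_ofNat (algebraMap ℂ (Ser M)) 3, ← map_mul]
    norm_num
  have hNm : ∀ i j, evT 0 (N i j) = N i j ∧ evT 1 (N i j) = N i j := by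
    have : ∀ c, (evT (M := M) c : Ser M →+* Ser M).mapMatrix N = N := by
      intro c
      rw [hN, map_inv_of_isUnit_det _ hu, evT_numS, evT_hS_matrix]
    exact fun i j => ⟨congrFun (congrFun (this 0) i) j, congrFun (congrFun (this 1) i) j⟩
  have hNT : N.map dT = 0 := derivation_inv_eq_zero _ hu
    (numS_map_eq_zero _ (by simp) (by simp) (by simp) (map_matrix_eq_zero (by simp)))
  have hNZ : N.map dZ = (-kap : Ser M) • (N * N) := by
    have h1 : (numS lam hS).map dZ = (kap : Ser M) • 1 := by
      have e1 := map_lamS dZ lam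
      have e2 := map_bS dZ lam (by simp) (by simp)
      ext1 i j
      have f1 : dZ (lamS lam i j) = 0 := congrFun (congrFun e1 i) j
      have f2 : dZ (bS lam i j) = 0 := congrFun (congrFun e2 i) j
      rcases eq_or_ne i j with rfl | h
      · simp [numS, f1, f2]
      · simp [numS, f1, f2, h]
    rw [hN, derivation_inv _ hu, h1, Matrix.mul_smul, Matrix.mul_one, Matrix.smul_mul, neg_smul]
  have hpT : ∀ j, dT (p j) = 0 := by
    intro j
    rw [hp, congrFun (derivation_vecMul dT N uS) j, hNT]
    simp [Matrix.vecMul, dotProduct]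
  have hyT : dT y = 0 := by simp [hy, dotProduct, hpT]
  have hrT : dT r = 0 := by
    have : ∀ i j, dT (N i j) = 0 := fun i j => congrFun (congrFun hNT i) j
    simp [hr, dotProduct, Matrix.mulVec, hpT, this]
  -- Thus `1 + r = 1 - ∂y/∂z` is the Jacobian of `z ↦ z - y` at fixed `z̄`. That `y` also depends on
  -- `z̄`, through `B`, plays no role.
  have hyZ : dZ y = -r := by
    have h1 : (fun i => dZ (p i)) = (-kap : Ser M) • Matrix.vecMul p N := by
      rw [hp, derivation_vecMul, hNZ, Matrix.vecMul_vecMul]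
      ext1 i
      simp [Matrix.vecMul, dotProduct, Finset.mul_sum]
      refine Finset.sum_congr rfl fun k _ => ?_
      ring
    have h2 : (fun i => dZ (wS i)) = (0 : Fin M → Ser M) := funext fun i => dZ_wS i
    rw [hy, Derivation.leibniz, derivation_dotProduct, h1, hr, h2, smul_dotProduct,
      Matrix.dotProduct_mulVec p N wS, dZ_kap, dotProduct_zero]
    simp only [smul_eq_mul]
    ring
  have hevp : ∀ j, evT 0 (p j) = p j ∧ evT 1 (p j) = p j := by
    intro j
    simp [hp, Matrix.vecMul, dotProduct, hNm]
  have hevy : evT 0 y = y ∧ evT 1 y = y := by simp [hy, dotProduct, hevp]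
  have hevr : evT 0 r = r ∧ evT 1 r = r := by simp [hr, dotProduct, Matrix.mulVec, hevp, hNm]
  -- The substitution `z ↦ z - ty`: the last term turns the weight `e^{-½zz̄}` into `e^{-½(z -
  -- ty)z̄}`.
  set e : Ser M := expoZ (zS - tS * y) + cst (1 / 2) * (tS * (y * zbS)) with he
  have he0 : cc e = 0 := by
    rw [he, map_add, cc_expoZ, hy]
    simp only [map_mul, constantCoeff_kap, zero_mul, mul_zero, add_zero]
  refine expect_evT_eq (F := (1 + tS * r) * expS e) ?_ ?_ ?_ n
  · rw [map_mul, evT_subst _ he0, he]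
    simp [evT_expoZ]
  · rw [integrandAt, ← mul_assoc N.det, hdet, hexp, map_mul, evT_subst _ he0, he]
    simp [evT_expoZ, hevy, hevr]
  intro m
  set f' : Ser M := cst (1 / 6) * (kap * (3 * (zS - tS * y) ^ 2)) + cst (1 / 2) *
    (kap * (uS ⬝ᵥ wS)) with hf'
  have heT : dT e = f' * (-y) + cst (1 / 2) * (y * zbS) := by
    rw [he, map_add, derivation_expoZ _ (by simp) (by simp) (by simp) (by simp), ← hf']
    simp [hyT]
  have heZ : dZ e = f' * (1 + tS * r) - cst (1 / 2) * (tS * (r * zbS)) := by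
    rw [he, map_add, derivation_expoZ _ (by simp) (by simp) (by simp) (by simp), ← hf']
    simp [hyZ]
    ring
  -- A pure divergence in `z` with respect to the weight, annihilated by `expect_dZ`.
  have key : dT ((1 + tS * r) * expS e) = -(dZ (y * expS e) -
      cst (1 / 2) * (zbS * (y * expS e))) := by
    rw [Derivation.leibniz, Derivation.leibniz, derivation_expS _ he0, derivation_expS _ he0, heT,
      heZ, hyZ, map_add, Derivation.leibniz, hrT, dT_tS, Derivation.map_one_eq_zero]
    simp only [smul_eq_mul]
    ring
  rw [key, map_neg, map_sub, expect_dZ, ← Algebra.smul_def, map_smul, smul_eq_mul, sub_self,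
    neg_zero]

/-- An integrand that does not involve `z̄` may be evaluated at `z = 0`. -/
theorem expect_expoZ (n : ℕ) :
    expect₀ lam n (expS (expoZ (zS : Ser M))) = expect₀ lam n (expS (expoZ (0 : Ser M))) := by
  refine expect_evT_eq (F := expS (expoZ (tS * zS))) ?_ ?_ ?_ n
  · rw [evT_subst _ (cc_expoZ _), evT_expoZ]
    simp
  · rw [evT_subst _ (cc_expoZ _), evT_expoZ]
    simp
  intro m
  set f' : Ser M := cst (1 / 6) * (kap * (3 * (tS * zS) ^ 2)) + cst (1 / 2) *
    (kap * (uS ⬝ᵥ wS)) with hf'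
  -- The `t`-derivative is `z` times a series free of `z̄`; under the expectation, multiplication by
  -- `z` is `2 ∂/∂z̄`.
  have h1 : dT (expS (expoZ (tS * zS))) = zS * (expS (expoZ (tS * zS)) * (f' : Ser M)) := by
    rw [derivation_expS _ (cc_expoZ _), derivation_expoZ _ (by simp) (by simp) (by simp) (by simp),
      ← hf']
    simp
    ring
  have h2 : dZb (expS (expoZ (tS * zS)) * (f' : Ser M)) = 0 := by
    have h3 : dZb (3 : Ser M) = 0 := by exact_mod_cast Derivation.map_natCast dZb 3
    have hf : dZb (f' : Ser M) = 0 := by simp [hf', dotProduct, h3]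
    rw [Derivation.leibniz, derivation_expS _ (cc_expoZ _),
      derivation_expoZ _ (by simp) (by simp) (by simp) (by simp), hf]
    simp
  have h3 := expect_dZb (lam := lam) (fun k => ((k : ℂ) + 1)⁻¹) m
    (expS (expoZ (tS * zS)) * (f' : Ser M))
  rw [h2, map_zero] at h3
  rw [h1]
  simpa using h3.symm

/-- The equality of the two formal integrals in the ring of formal integrands. -/
theorem expect_openIntegrand (hlam : ∀ i, 0 < lam i) (n : ℕ) :
    expect₀ lam n ((halfInv lam * numS lam hS).det *
      Ring.inverse (halfInv lam * (bS lam * (lamS lam + bS lam - (kap : Ser M) • hS -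
        (kap * zS : Ser M) • 1)) * lamInvS lam).det *
      expS (cst (1 / 6) * (kap * ((hS ^ 3).trace + zS ^ 3)))) =
    expect₀ lam n (Ring.inverse (1 - ((kap : Ser M) • hS) * lamInvS lam).det *
      expS (cst (1 / 6) * (kap * (hS ^ 3).trace))) := by
  have hLi : ∀ i j, lamInvS lam i j ∈ paramRing M := fun i j => diagonal_mem (fun _ => cst_mem _) i j
  have hhi : ∀ i j, halfInv lam i j ∈ paramRing M := fun i j =>
    Subalgebra.mul_mem _ (cst_mem _) (hLi i j)
  have hκh : ∀ i j, ((kap : Ser M) • hS) i j ∈ paramRing M := fun i j =>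
    Subalgebra.mul_mem _ kap_mem (hS_mem i j)
  have hdet : ∃ d : ℂ, (halfInv lam).det = cst d := by
    refine ⟨(1 / 2) ^ M * ∏ i, (lam i : ℂ)⁻¹, ?_⟩
    rw [halfInv, Matrix.det_smul, lamInvS, Matrix.det_diagonal, Fintype.card_fin]
    simp only [cst, map_mul, map_pow, map_prod]
  obtain ⟨d, hd⟩ := hdet
  set Den : Matrix (Fin M) (Fin M) (Ser M) := lamS lam + bS lam - (kap : Ser M) • hS -
    (kap * zS : Ser M) • 1 with hDen
  have hDenmem : ∀ i j, Den i j ∈ paramRing M := fun i j =>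
    Subalgebra.sub_mem _ (Subalgebra.sub_mem _ (Subalgebra.add_mem _ (lamS_mem _ _ _)
      (bS_mem _ _ _)) (hκh i j))
      (Subalgebra.mul_mem _ (Subalgebra.mul_mem _ kap_mem zS_mem) (one_matrix_mem _ _))
  -- Chosen so that `Λ + K = (2Λ)⁻¹B(Λ + B - κH - κz)`. The constant `(2Λ)⁻¹` makes `K` vanish
  -- modulo `ε`, as `expect_gaussian` requires.
  set K := halfInv lam * (bS lam * Den) - lamS lam with hK
  have hKmem : ∀ i j, K i j ∈ paramRing M := fun i j =>
    Subalgebra.sub_mem _ (matrix_mul_mem hhi (matrix_mul_mem (bS_mem lam) hDenmem) i j)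
      (lamS_mem _ _ _)
  have hKcc : cc.mapMatrix K = 0 := by
    have e1 : cc.mapMatrix Den = cc.mapMatrix ((cst 2 : Ser M) • lamS lam) := by
      rw [← cc_numS hS]
      ext1 i j
      simp only [hDen, numS, RingHom.mapMatrix_apply, Matrix.map_apply, Matrix.add_apply,
        Matrix.sub_apply, Matrix.smul_apply, smul_eq_mul, map_add, map_sub, map_mul,
        constantCoeff_kap, zero_mul, sub_zero, add_zero]
    rw [hK, map_sub, map_mul, map_mul, e1, cc_bS, ← map_mul, ← map_mul, Matrix.mul_smul,
      ← Matrix.smul_mul, ← Matrix.mul_assoc, halfInv_mul hlam, Matrix.one_mul, sub_self]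
  have hKcc' : ∀ i j, cc (K i j) = 0 := fun i j => congrFun (congrFun hKcc i) j
  have hKL : 1 + K * lamInvS lam = halfInv lam * (bS lam * Den) * lamInvS lam := by
    rw [hK, Matrix.sub_mul, lamS_mul_lamInvS hlam]
    abel
  have hS1 : cst (1 / 6) * (kap * ((hS ^ 3).trace + zS ^ 3)) ∈ paramRing M :=
    Subalgebra.mul_mem _ (cst_mem _) (Subalgebra.mul_mem _ kap_mem (Subalgebra.add_mem _ hS_cube_mem
      (Subalgebra.pow_mem _ zS_mem 3)))
  have hS2 : cst (1 / 6) * (kap * (hS ^ 3).trace) ∈ paramRing M :=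
    Subalgebra.mul_mem _ (cst_mem _) (Subalgebra.mul_mem _ kap_mem hS_cube_mem)
  have gA := expect_gaussian hlam hKmem hS1
    (det_mem (matrix_mul_mem hhi (numS_mem (lam := lam) hS_mem))) hKcc'
    (by simp [constantCoeff_kap]) n
  rw [hKL] at gA
  -- The Penner determinant arises from the same formula with `K = -κH`.
  have gE := expect_gaussian hlam (K := -((kap : Ser M) • hS)) (c := 1)
    (fun i j => Subalgebra.neg_mem _ (hκh i j)) hS2 (Subalgebra.one_mem _)
    (by simp [constantCoeff_kap]) (by simp [constantCoeff_kap]) n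
  rw [one_mul, one_mul, Matrix.neg_mul, ← sub_eq_add_neg] at gE
  rw [← gA, ← gE]
  have eE : cst (1 / 6) * (kap * (hS ^ 3).trace) -
      cst (1 / 2) * (uS ⬝ᵥ (-((kap : Ser M) • hS)).mulVec wS) = expoZ (0 : Ser M) := by
    rw [expoZ_eq, Matrix.neg_mulVec, dotProduct_neg, Matrix.smul_mulVec, dotProduct_smul,
      smul_eq_mul]
    ring
  have eA : cst (1 / 6) * (kap * ((hS ^ 3).trace + zS ^ 3)) -
      cst (1 / 2) * (uS ⬝ᵥ K.mulVec wS) = expo lam hS (p₀ lam) + gaussU lam := by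
    rw [expo, exponentAt, gaussU, hK, p₀_dotProduct, Matrix.sub_mulVec, dotProduct_sub,
      Matrix.mulVec_mulVec]
    ring
  -- The chain is run from the Penner side. The constant `det (2Λ)⁻¹` left by
  -- `expect_change_covector` is the one carried by the numerator on the other side.
  rw [eA, eE, ← expect_expoZ, ← expect_shift_z hlam, expect_change_covector hlam, hd,
    expect_cst_mul, expect_translate hlam, Matrix.det_mul, hd, mul_assoc, expect_cst_mul]
  rfl

end

end KontsevichPenner

namespace KontsevichPenner

noncomputable section

variable {M : ℕ} {lam : Fin M → ℝ}

/-! ### The integrand over an arbitrary ring of coefficients -/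

section generic

variable {S τ : Type*} [CommRing S] [Algebra ℂ S]

/-- The diagonal matrix `√(1 - ζ Λ⁻²)`. -/
def sqrtDiagonal (lam : Fin M → ℝ) (ζ : MvPowerSeries τ S) :
    Matrix (Fin M) (Fin M) (MvPowerSeries τ S) :=
  Matrix.diagonal fun i => PowerSeries.subst (-(((lam i : ℂ)⁻¹ ^ 2) • ζ))
    (PowerSeries.binomialSeries ℂ (1 / 2 : ℚ))

/-- The denominator `1 + √(1 - ζ Λ⁻²) - ε³ H Λ⁻¹ - ε² z Λ⁻¹`. -/
def openDenominator (lam : Fin M → ℝ) (H : Matrix (Fin M) (Fin M) (MvPowerSeries τ S))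
    (ε z ζ : MvPowerSeries τ S) : Matrix (Fin M) (Fin M) (MvPowerSeries τ S) :=
  1 + sqrtDiagonal lam ζ - (ε • H) * gradedLamInv ε lam - z • gradedLamInv ε lam

/-- The integrand on `H_M × ℂ`, as a function of `H`, of the grading parameter `ε`, of `z`, and of
`ζ = z̄ ε⁴`. -/
def openSeries (lam : Fin M → ℝ) (H : Matrix (Fin M) (Fin M) (MvPowerSeries τ S))
    (ε z ζ : MvPowerSeries τ S) : MvPowerSeries τ S :=
  PowerSeries.subst ((1 / 6 : ℂ) • (((ε • H) ^ 3).trace + z ^ 3)) (PowerSeries.exp ℂ) *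
    (1 + sqrtDiagonal lam ζ - (ε • H) * gradedLamInv ε lam + z • gradedLamInv ε lam).det *
    Ring.inverse (openDenominator lam H ε z ζ).det * Ring.inverse (sqrtDiagonal lam ζ).det

/-- The integrand on `H_M`. -/
def pennerSeries (lam : Fin M → ℝ) (H : Matrix (Fin M) (Fin M) (MvPowerSeries τ S))
    (ε : MvPowerSeries τ S) : MvPowerSeries τ S :=
  PowerSeries.subst ((1 / 6 : ℂ) • ((ε • H) ^ 3).trace) (PowerSeries.exp ℂ) *
    Ring.inverse (1 - (ε • H) * gradedLamInv ε lam).det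

variable {H : Matrix (Fin M) (Fin M) (MvPowerSeries τ S)} {ε z ζ : MvPowerSeries τ S}

theorem constantCoeff_root_arg (hζ : MvPowerSeries.constantCoeff ζ = 0) (c : ℂ) :
    MvPowerSeries.constantCoeff (-(c • ζ)) = 0 := by
  rw [map_neg, MvPowerSeries.constantCoeff_smul, hζ, smul_zero, neg_zero]

theorem mapMatrix_sqrtDiagonal (hζ : MvPowerSeries.constantCoeff ζ = 0) :
    MvPowerSeries.constantCoeff.mapMatrix (sqrtDiagonal lam ζ) = 1 := by
  rw [sqrtDiagonal, RingHom.mapMatrix_apply, Matrix.diagonal_map (map_zero _),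
    ← Matrix.diagonal_one]
  congr 1
  ext1 i
  rw [constantCoeff_subst_of_eq_zero (constantCoeff_root_arg hζ _),
    PowerSeries.binomialSeries_constantCoeff, map_one]

theorem mapMatrix_smul_eq_zero {n S S' τ : Type*} [Fintype n] [DecidableEq n]
    [CommRing S] [CommRing S'] {ε : MvPowerSeries τ S} (φ : MvPowerSeries τ S →+* S') (h : φ ε = 0)
    (K : Matrix n n (MvPowerSeries τ S)) : φ.mapMatrix (ε • K) = 0 := by
  ext i j
  simp [h]

theorem isUnit_of_mapMatrix {n S τ : Type*} [Fintype n] [DecidableEq n] [CommRing S]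
    {K : Matrix n n (MvPowerSeries τ S)} {K₀ : Matrix n n S} (h : MvPowerSeries.constantCoeff.mapMatrix K = K₀)
    (h₀ : IsUnit K₀.det) : IsUnit K.det := by
  rw [MvPowerSeries.isUnit_iff_constantCoeff, RingHom.map_det, h]
  exact h₀

theorem isUnit_sqrtDiagonal (hζ : MvPowerSeries.constantCoeff ζ = 0) :
    IsUnit (sqrtDiagonal lam ζ).det :=
  isUnit_of_mapMatrix (mapMatrix_sqrtDiagonal hζ) (by simp)

theorem isUnit_openDenominator (hε : MvPowerSeries.constantCoeff ε = 0)
    (hz : MvPowerSeries.constantCoeff z = 0) (hζ : MvPowerSeries.constantCoeff ζ = 0) :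
    IsUnit (openDenominator lam H ε z ζ).det := by
  refine isUnit_of_mapMatrix (K₀ := (2 : ℂ) • 1) ?_ ?_
  · rw [openDenominator, map_sub, map_sub, map_add, map_one, mapMatrix_sqrtDiagonal hζ,
      Matrix.smul_mul, mapMatrix_smul_eq_zero _ hε, mapMatrix_smul_eq_zero _ hz, sub_zero, sub_zero,
      two_smul]
  · rw [Matrix.det_smul_of_tower, Matrix.det_one, ← Algebra.algebraMap_eq_smul_one]
    exact (IsUnit.mk0 _ (pow_ne_zero _ two_ne_zero)).map (algebraMap ℂ S)

theorem isUnit_pennerDenominator (hε : MvPowerSeries.constantCoeff ε = 0) :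
    IsUnit (1 - (ε • H) * gradedLamInv ε lam).det := by
  refine isUnit_of_mapMatrix (K₀ := 1) ?_ (by simp)
  rw [map_sub, map_one, Matrix.smul_mul, mapMatrix_smul_eq_zero _ hε, sub_zero]

variable {S' τ' : Type*} [CommRing S'] [Algebra ℂ S']
  (φ : MvPowerSeries τ S →ₐ[ℂ] MvPowerSeries τ' S')

theorem mapMatrix_gradedLamInv :
    φ.mapMatrix (gradedLamInv ε lam) = gradedLamInv (φ ε) lam := by
  rw [gradedLamInv, AlgHom.mapMatrix_apply, Matrix.diagonal_map (map_zero _), gradedLamInv]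
  simp

theorem mapMatrix_smul (K : Matrix (Fin M) (Fin M) (MvPowerSeries τ S)) :
    φ.mapMatrix (ε • K) = φ ε • φ.mapMatrix K := by
  ext1 i j
  simp

/-- Compatibility of a homomorphism with the substitution of series without constant term. -/
def CommutesWithSubst : Prop := ∀ f, MvPowerSeries.constantCoeff f = 0 → ∀ p : PowerSeries ℂ,
  φ (PowerSeries.subst f p) = PowerSeries.subst (φ f) p

variable {φ}

theorem map_sqrtDiagonal (hφ : CommutesWithSubst φ) (hζ : MvPowerSeries.constantCoeff ζ = 0) :
    φ.mapMatrix (sqrtDiagonal lam ζ) = sqrtDiagonal lam (φ ζ) := by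
  rw [sqrtDiagonal, AlgHom.mapMatrix_apply, Matrix.diagonal_map (map_zero _), sqrtDiagonal]
  congr 1
  ext1 i
  rw [hφ _ (constantCoeff_root_arg hζ _), map_neg, map_smul]

/-- The integrand is compatible with homomorphisms that respect substitutions. -/
theorem map_openSeries (hφ : CommutesWithSubst φ)
    (hε : MvPowerSeries.constantCoeff ε = 0) (hz : MvPowerSeries.constantCoeff z = 0) (hζ : MvPowerSeries.constantCoeff ζ = 0) :
    φ (openSeries lam H ε z ζ) = openSeries lam (φ.mapMatrix H) (φ ε) (φ z) (φ ζ) := by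
  have he : MvPowerSeries.constantCoeff ((1 / 6 : ℂ) • (((ε • H) ^ 3).trace + z ^ 3)) = 0 := by
    have : MvPowerSeries.constantCoeff ((ε • H) ^ 3).trace = 0 := by
      rw [AddMonoidHom.map_trace, ← RingHom.mapMatrix_apply, map_pow, mapMatrix_smul_eq_zero _ hε]
      simp
    rw [MvPowerSeries.constantCoeff_smul, map_add, map_pow, hz, this]
    simp
  rw [openSeries, map_mul, map_mul, map_mul, hφ _ he,
    map_ringInverse_of_isUnit φ (isUnit_openDenominator hε hz hζ),
    map_ringInverse_of_isUnit φ (isUnit_sqrtDiagonal hζ), AlgHom.map_det, AlgHom.map_det,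
    AlgHom.map_det, map_sqrtDiagonal hφ hζ, openDenominator, openSeries, openDenominator]
  simp only [map_sub, map_add, map_one, map_mul, mapMatrix_smul, mapMatrix_gradedLamInv,
    map_sqrtDiagonal hφ hζ, map_smul, map_pow]
  rw [AddMonoidHom.map_trace φ, ← AlgHom.mapMatrix_apply, map_pow, mapMatrix_smul]

theorem map_pennerSeries (hφ : CommutesWithSubst φ) (hε : MvPowerSeries.constantCoeff ε = 0) :
    φ (pennerSeries lam H ε) = pennerSeries lam (φ.mapMatrix H) (φ ε) := by
  have he : MvPowerSeries.constantCoeff ((1 / 6 : ℂ) • ((ε • H) ^ 3).trace) = 0 := by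
    have : MvPowerSeries.constantCoeff ((ε • H) ^ 3).trace = 0 := by
      rw [AddMonoidHom.map_trace, ← RingHom.mapMatrix_apply, map_pow, mapMatrix_smul_eq_zero _ hε]
      simp
    rw [MvPowerSeries.constantCoeff_smul, this, smul_zero]
  rw [pennerSeries, map_mul, hφ _ he, map_ringInverse_of_isUnit φ (isUnit_pennerDenominator hε),
    AlgHom.map_det, pennerSeries]
  simp only [map_sub, map_one, map_mul, mapMatrix_smul, mapMatrix_gradedLamInv, map_smul]
  rw [AddMonoidHom.map_trace φ, ← AlgHom.mapMatrix_apply, map_pow, mapMatrix_smul]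

end generic

/-! ### Comparison with the integrands over `ℂ` -/

/-- The inverse `⁻¹` of series is tied to coefficients in a field, whereas `Ring.inverse` also
serves for polynomial coefficients. -/
theorem inv_eq_ringInverse {σ : Type*} {f : MvPowerSeries σ ℂ} (hf : IsUnit f) :
    f⁻¹ = Ring.inverse f := by
  have h := (MvPowerSeries.isUnit_iff_constantCoeff.1 hf).ne_zero
  rw [MvPowerSeries.inv_eq_iff_mul_eq_one h, Ring.inverse_mul_cancel f hf]

/-- The variable `z̄` enters only through `z̄Λ⁻²`, hence always with `ε⁴`; this is why `ζ = z̄ε⁴`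
can be a variable of its own. -/
theorem openIntegrand_eq (lam : Fin M → ℝ) (H : Matrix (Fin M) (Fin M) ℂ) :
    openIntegrand lam H = openSeries lam (H.map (algebraMap ℂ _)) epsVar zVar
      (zbarVar * epsVar ^ 4) := by
  have hr : sqrtMatrix lam = sqrtDiagonal lam (zbarVar * epsVar ^ 4) := by
    rw [sqrtMatrix, sqrtDiagonal]
    congr 1
    ext1 i
    rw [sqrtOneAdd, gradedLamInv, Matrix.diagonal_apply_eq, smul_pow, ← pow_mul, mul_smul_comm]
  have hε : MvPowerSeries.constantCoeff epsVar = 0 := MvPowerSeries.constantCoeff_X _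
  have hz : MvPowerSeries.constantCoeff zVar = 0 := MvPowerSeries.constantCoeff_X _
  have hζ : MvPowerSeries.constantCoeff (zbarVar * epsVar ^ 4) = 0 := by
    rw [map_mul, map_pow, hε]; simp
  have hd := inv_eq_ringInverse
    (isUnit_openDenominator (lam := lam) (H := H.map (algebraMap ℂ _)) hε hz hζ)
  rw [openIntegrand, hr, inv_eq_ringInverse (isUnit_sqrtDiagonal hζ), openSeries, ← hd]
  rfl

theorem pennerIntegrand_eq (lam : Fin M → ℝ) (H : Matrix (Fin M) (Fin M) ℂ) :
    pennerIntegrand 1 lam H = pennerSeries lam (H.map (algebraMap ℂ _))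
      (PowerSeries.X : PowerSeries ℂ) := by
  have hε : MvPowerSeries.constantCoeff (PowerSeries.X : PowerSeries ℂ) = 0 :=
    MvPowerSeries.constantCoeff_X _
  rw [pennerIntegrand, pow_one, pennerSeries]
  congr 1
  exact inv_eq_ringInverse (isUnit_pennerDenominator (H := H.map (algebraMap ℂ _)) hε)

/-! ### Comparison with the formal integrands -/

theorem bS_eq (lam : Fin M → ℝ) :
    bS lam = sqrtDiagonal lam (PowerSeries.X ^ 3 * zbS : Ser M) * lamS lam := by
  rw [bS, sqrtDiagonal, lamS, Matrix.diagonal_mul_diagonal]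
  congr 1
  ext1 i
  rw [betaS, mul_comm, kap, Algebra.smul_def, mul_comm (algebraMap _ _ _)]

theorem gradedLamInv_X (lam : Fin M → ℝ) :
    gradedLamInv (PowerSeries.X : Ser M) lam = (PowerSeries.X ^ 2 : Ser M) • lamInvS lam := by
  rw [gradedLamInv, lamInvS, ← Matrix.diagonal_smul]
  congr 1
  ext1 i
  rw [Pi.smul_apply, smul_eq_mul, Algebra.smul_def, mul_comm]

theorem smul_X_mul_gradedLamInv (lam : Fin M → ℝ) (K : Matrix (Fin M) (Fin M) (Ser M)) :
    ((PowerSeries.X : Ser M) • K) * gradedLamInv (PowerSeries.X : Ser M) lam =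
      ((kap : Ser M) • K) * lamInvS lam := by
  rw [gradedLamInv_X, Matrix.mul_smul, Matrix.smul_mul, smul_smul, Matrix.smul_mul, kap,
    ← pow_succ]

theorem smul_trace_smul_pow (K : Matrix (Fin M) (Fin M) (Ser M)) :
    (1 / 6 : ℂ) • (((PowerSeries.X : Ser M) • K) ^ 3).trace =
      cst (1 / 6) * (kap * (K ^ 3).trace) := by
  rw [smul_pow, Matrix.trace_smul, smul_eq_mul, Algebra.smul_def, kap]

theorem pennerSeries_hS (lam : Fin M → ℝ) : pennerSeries lam hS (PowerSeries.X : Ser M) =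
    Ring.inverse (1 - ((kap : Ser M) • hS) * lamInvS lam).det *
      expS (cst (1 / 6) * (kap * (hS ^ 3).trace)) := by
  rw [pennerSeries, smul_X_mul_gradedLamInv, smul_trace_smul_pow, mul_comm]

/-- With `B = βL`, every matrix is a product, and numerator and denominator share the factor `det K
· det L`. -/
theorem det_prefactor {A n : Type*} [CommRing A] [Fintype n] [DecidableEq n]
    (K L Li β h : Matrix n n A) (κ z : A) (hL : Li * L = 1) (hK : IsUnit K.det) :
    (K * (L + β * L - κ • h + z • 1)).det *
      Ring.inverse (K * (β * L * (L + β * L - κ • h - z • 1)) * Li).det =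
    (1 + β - (κ • h) * Li + z • Li).det * Ring.inverse (1 + β - (κ • h) * Li - z • Li).det *
      Ring.inverse β.det := by
  have hnum : L + β * L - κ • h + z • 1 = (1 + β - (κ • h) * Li + z • Li) * L := by
    rw [Matrix.add_mul, Matrix.sub_mul, Matrix.add_mul, Matrix.one_mul, Matrix.mul_assoc,
      hL, Matrix.mul_one, Matrix.smul_mul, hL]
  have hden : L + β * L - κ • h - z • 1 = (1 + β - (κ • h) * Li - z • Li) * L := by
    rw [Matrix.sub_mul, Matrix.sub_mul, Matrix.add_mul, Matrix.one_mul, Matrix.mul_assoc,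
      hL, Matrix.mul_one, Matrix.smul_mul, hL]
  have hu : K.det * L.det * Ring.inverse (K.det * L.det) = 1 :=
    Ring.mul_inverse_cancel _ (hK.mul (Matrix.isUnit_det_of_left_inverse hL))
  have hdL : Li.det * L.det = 1 := by rw [← Matrix.det_mul, hL, Matrix.det_one]
  rw [hnum, hden]
  simp only [Matrix.det_mul]
  set a := (1 + β - (κ • h) * Li + z • Li).det
  set d := (1 + β - (κ • h) * Li - z • Li).det
  have hd : K.det * (β.det * L.det * (d * L.det)) * Li.det = (K.det * L.det) * (d * β.det) := by
    linear_combination K.det * β.det * L.det * d * hdL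
  rw [hd, Ring.mul_inverse_rev, Ring.mul_inverse_rev d]
  linear_combination (a * Ring.inverse d * Ring.inverse β.det) * hu

/-- With `z` replaced by `εz` and `ζ` by `ε³z̄`, the powers of `ε` combine to `κ` in every factor.
The constant matrices `halfInv` and `lamInvS`, inserted for the Gaussian integration, cancel. -/
theorem openSeries_hS (hlam : ∀ i, 0 < lam i) :
    openSeries lam hS (PowerSeries.X : Ser M) (PowerSeries.X * zS) (PowerSeries.X ^ 3 * zbS) =
    (halfInv lam * numS lam hS).det *
      Ring.inverse (halfInv lam * (bS lam * (lamS lam + bS lam - (kap : Ser M) • hS -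
        (kap * zS : Ser M) • 1)) * lamInvS lam).det *
      expS (cst (1 / 6) * (kap * ((hS ^ 3).trace + zS ^ 3))) := by
  have hz : (PowerSeries.X * zS : Ser M) • gradedLamInv (PowerSeries.X : Ser M) lam =
      (kap * zS : Ser M) • lamInvS lam := by
    rw [gradedLamInv_X, smul_smul, kap, mul_right_comm, ← pow_succ']
  have he : (1 / 6 : ℂ) • ((((PowerSeries.X : Ser M) • (hS : Matrix (Fin M) (Fin M) (Ser M))) ^ 3).trace + (PowerSeries.X * zS) ^ 3) =
      cst (1 / 6) * (kap * ((hS ^ 3).trace + zS ^ 3)) := by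
    rw [smul_pow, Matrix.trace_smul, smul_eq_mul, Algebra.smul_def, mul_pow, ← mul_add, kap]
  have key := det_prefactor (halfInv lam) (lamS lam) (lamInvS lam)
    (sqrtDiagonal lam (PowerSeries.X ^ 3 * zbS : Ser M)) hS kap (kap * zS) (lamInvS_mul_lamS hlam)
    (Matrix.isUnit_det_of_right_inverse (halfInv_mul hlam))
  rw [numS, bS_eq, key, openSeries, openDenominator, smul_X_mul_gradedLamInv, hz, he]
  have comm : ∀ a b c d : Ser M, a * b * c * d = b * c * d * a := fun a b c d => by ring
  exact comm _ _ _ _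

end

end KontsevichPenner

namespace KontsevichPenner

noncomputable section

variable {M : ℕ} {lam : Fin M → ℝ}

/-! ### Substitutions and coefficients -/

theorem commutesWithSubst_map {S S' τ : Type*} [CommRing S] [Algebra ℂ S] [CommRing S']
    [Algebra ℂ S'] (h : S →ₐ[ℂ] S') :
    CommutesWithSubst (MvPowerSeries.mapAlgHom (σ := τ) h) :=
  fun _ hf p => map_subst_algHom h hf p

theorem commutesWithSubst_subst {S σ τ : Type*} [CommRing S] [Algebra ℂ S]
    {a : σ → MvPowerSeries τ S} (ha : MvPowerSeries.HasSubst a) :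
    CommutesWithSubst ((MvPowerSeries.substAlgHom (R := S) ha).restrictScalars ℂ) := by
  intro f hf p
  rw [AlgHom.restrictScalars_apply, AlgHom.restrictScalars_apply, MvPowerSeries.substAlgHom_apply,
    MvPowerSeries.substAlgHom_apply, PowerSeries.subst_def, PowerSeries.subst_def]
  exact MvPowerSeries.subst_comp_subst_apply
    (PowerSeries.HasSubst.of_constantCoeff_zero hf).const ha p

theorem powerSeries_C_smul {S : Type*} [CommRing S] [Algebra ℂ S] (c : ℂ) (s : S) :
    PowerSeries.C (c • s) = c • PowerSeries.C s := by
  rw [Algebra.smul_def, map_mul, Algebra.smul_def, PowerSeries.algebraMap_apply]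

/-- The exponent of `zᵃ z̄ᵇ εᵐ`. -/
abbrev exponent (a b m : ℕ) : Fin 3 →₀ ℕ :=
  Finsupp.single 0 a + Finsupp.single 1 b + Finsupp.single 2 m

theorem exponent_self (d : Fin 3 →₀ ℕ) : exponent (d 0) (d 1) (d 2) = d := by
  ext i
  fin_cases i <;> simp [exponent]

theorem exponent_inj {a b m a' b' m' : ℕ} :
    exponent a b m = exponent a' b' m' ↔ a = a' ∧ b = b' ∧ m = m' := by
  refine ⟨fun h => ?_, by rintro ⟨rfl, rfl, rfl⟩; rfl⟩
  have h0 := DFunLike.congr_fun h 0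
  have h1 := DFunLike.congr_fun h 1
  have h2 := DFunLike.congr_fun h 2
  simp [exponent] at h0 h1 h2
  exact ⟨h0, h1, h2⟩

theorem prod_fin_three {A : Type*} [CommMonoid A] (d : Fin 3 →₀ ℕ) (a : Fin 3 → A) :
    (d.prod fun s e => a s ^ e) = a 0 ^ d 0 * a 1 ^ d 1 * a 2 ^ d 2 := by
  rw [Finsupp.prod_fintype _ _ fun _ => pow_zero _, Fin.prod_univ_three]

/-- The substitution `z̄ ↦ z̄ ε⁴`. -/
def shiftVars : Fin 3 → MvPowerSeries (Fin 3) ℂ := ![zVar, zbarVar * epsVar ^ 4, epsVar]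

theorem hasSubst_shiftVars : MvPowerSeries.HasSubst shiftVars := by
  refine MvPowerSeries.hasSubst_of_constantCoeff_zero fun s => ?_
  fin_cases s <;> simp [shiftVars, zVar, epsVar, zbarVar]

/-- Distinct monomials go to distinct monomials, and `z̄ᵇ` acquires `ε⁴ᵇ`. -/
theorem coeff_subst_shiftVars (f : MvPowerSeries (Fin 3) ℂ) (a b m : ℕ) :
    MvPowerSeries.coeff (exponent a b m) (MvPowerSeries.subst shiftVars f) =
      if 4 * b ≤ m then MvPowerSeries.coeff (exponent a b (m - 4 * b)) f else 0 := by
  have hp : ∀ d : Fin 3 →₀ ℕ, (d.prod fun s e => shiftVars s ^ e) =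
      MvPowerSeries.monomial (exponent (d 0) (d 1) (4 * d 1 + d 2)) 1 := by
    intro d
    rw [prod_fin_three, shiftVars]
    simp only [Matrix.cons_val, mul_pow, ← pow_mul, zVar, zbarVar, epsVar]
    rw [MvPowerSeries.X_pow_eq, MvPowerSeries.X_pow_eq, MvPowerSeries.X_pow_eq,
      MvPowerSeries.X_pow_eq, MvPowerSeries.monomial_mul_monomial,
      MvPowerSeries.monomial_mul_monomial, MvPowerSeries.monomial_mul_monomial, mul_one, mul_one,
      mul_one, exponent, Finsupp.single_add]
    congr 1
    simp only [add_assoc]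
  rw [MvPowerSeries.coeff_subst hasSubst_shiftVars]
  simp only [hp, MvPowerSeries.coeff_monomial, exponent_inj]
  split_ifs with h
  · rw [finsum_eq_single _ (exponent a b (m - 4 * b))]
    · rw [if_pos (by simp [exponent]; omega), smul_eq_mul, mul_one]
    · intro d hd
      rw [if_neg, smul_zero]
      rintro ⟨h0, h1, h2⟩
      refine hd ?_
      rw [← exponent_self d, exponent_inj]
      omega
  · refine finsum_eq_zero_of_forall_eq_zero fun d => ?_
    rw [if_neg (by omega), smul_zero]

/-! ### Polynomial dependence on `H` -/

/-- The polynomials in the coordinates of `H`. -/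
abbrev HPoly (M : ℕ) := MvPolynomial (Fin M × Fin M) ℂ

/-- The generic Hermitian matrix. -/
def genericH (M : ℕ) : Matrix (Fin M) (Fin M) (HPoly M) := Matrix.of fun i j =>
  if i < j then MvPolynomial.X (i, j) + Complex.I • MvPolynomial.X (j, i)
  else if j < i then MvPolynomial.X (j, i) - Complex.I • MvPolynomial.X (i, j)
  else MvPolynomial.X (i, i)

/-- The value of a polynomial at a point. -/
def evalH (x : Fin M → Fin M → ℝ) : HPoly M →ₐ[ℂ] ℂ := MvPolynomial.aeval fun p => (x p.1 p.2 : ℂ)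

theorem mapMatrix_evalH (x : Fin M → Fin M → ℝ) :
    (evalH x).mapMatrix (genericH M) = hermitian x := by
  ext i j
  simp only [genericH, hermitian, evalH, AlgHom.mapMatrix_apply, Matrix.map_apply, Matrix.of_apply]
  split_ifs <;> simp [mul_comm]

/-- The inclusion of the polynomials in `H` in the polynomials in all coordinates. -/
def inclH : HPoly M →ₐ[ℂ] MvPolynomial (Coord M) ℂ := MvPolynomial.rename Sum.inl

theorem map_inclH_genericH (i j : Fin M) : PowerSeries.C (inclH (genericH M i j)) = hS i j := by
  simp only [genericH, hS, inclH, Matrix.of_apply, coordS]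
  split_ifs <;> simp [powerSeries_C_smul]

variable (lam) in
/-- The generic integrand on `H_M × ℂ`. -/
def genericOpen : MvPowerSeries (Fin 3) (HPoly M) :=
  openSeries lam ((genericH M).map MvPowerSeries.C) (MvPowerSeries.X 2) (MvPowerSeries.X 0)
    (MvPowerSeries.X 1)

variable (lam) in
/-- The generic integrand on `H_M`. -/
def genericPenner : PowerSeries (HPoly M) :=
  pennerSeries lam ((genericH M).map PowerSeries.C) (PowerSeries.X : PowerSeries (HPoly M))

theorem mapMatrix_C {S S' τ : Type*} [CommRing S] [Algebra ℂ S] [CommRing S'] [Algebra ℂ S']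
    (h : S →ₐ[ℂ] S') (K : Matrix (Fin M) (Fin M) S) :
    (MvPowerSeries.mapAlgHom (σ := τ) h).mapMatrix (K.map MvPowerSeries.C) =
      (h.mapMatrix K).map MvPowerSeries.C := by
  ext1 i j
  exact MvPowerSeries.map_C _ _

/-- The integrand at a given Hermitian matrix and the integrand in `Ser M` are two specializations
of `genericOpen`. This is the one with `ζ = z̄ε⁴`; the other is `openSeries_hS_eq`. Coefficients of
the two can thereby be compared. -/
theorem openIntegrand_hermitian (x : Fin M → Fin M → ℝ) : openIntegrand lam (hermitian x) =
    MvPowerSeries.subst shiftVars (MvPowerSeries.mapAlgHom (evalH x) (genericOpen lam)) := by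
  have h1 : MvPowerSeries.mapAlgHom (evalH x) (genericOpen lam) =
      openSeries lam ((hermitian x).map MvPowerSeries.C) epsVar zVar zbarVar := by
    rw [genericOpen, map_openSeries (commutesWithSubst_map _) (MvPowerSeries.constantCoeff_X _)
      (MvPowerSeries.constantCoeff_X _) (MvPowerSeries.constantCoeff_X _), mapMatrix_C,
      mapMatrix_evalH]
    congr 1 <;> exact MvPowerSeries.map_X _ _
  have h2 := map_openSeries (lam := lam) (H := (hermitian x).map MvPowerSeries.C)
    (commutesWithSubst_subst hasSubst_shiftVars) (ε := epsVar) (z := zVar)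
    (ζ := zbarVar) (MvPowerSeries.constantCoeff_X _) (MvPowerSeries.constantCoeff_X _)
    (MvPowerSeries.constantCoeff_X _)
  simp only [AlgHom.restrictScalars_apply, MvPowerSeries.substAlgHom_apply] at h2
  rw [h1, h2, openIntegrand_eq]
  congr 1
  · ext1 i j
    change _ = MvPowerSeries.substAlgHom hasSubst_shiftVars (MvPowerSeries.C (hermitian x i j))
    rw [MvPowerSeries.substAlgHom_apply, MvPowerSeries.subst_C]
    rfl
  · exact (MvPowerSeries.subst_X hasSubst_shiftVars 2).symm
  · exact (MvPowerSeries.subst_X hasSubst_shiftVars 0).symm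
  · exact (MvPowerSeries.subst_X hasSubst_shiftVars 1).symm

/-- The coefficients of the integrand on `H_M × ℂ` are polynomials in the coordinates of `H`. -/
theorem openCoeff_hermitian (a b m : ℕ) (x : Fin M → Fin M → ℝ) :
    openCoeff lam a b m (hermitian x) = if 4 * b ≤ m then
      evalH x (MvPowerSeries.coeff (exponent a b (m - 4 * b)) (genericOpen lam)) else 0 := by
  rw [openCoeff, openIntegrand_hermitian, coeff_subst_shiftVars]
  rfl

theorem coeff_pennerIntegrand_hermitian (m : ℕ) (x : Fin M → Fin M → ℝ) :
    PowerSeries.coeff m (pennerIntegrand 1 lam (hermitian x)) =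
      evalH x (PowerSeries.coeff m (genericPenner lam)) := by
  have h1 : MvPowerSeries.mapAlgHom (evalH x) (genericPenner lam) =
      pennerSeries lam ((hermitian x).map MvPowerSeries.C) (PowerSeries.X : PowerSeries ℂ) := by
    rw [genericPenner, map_pennerSeries (ε := PowerSeries.X) (commutesWithSubst_map _)
      (MvPowerSeries.constantCoeff_X _)]
    congr 1
    · exact (mapMatrix_C (evalH x) (genericH M)).trans (by rw [mapMatrix_evalH])
    · exact MvPowerSeries.map_X _ _
  rw [pennerIntegrand_eq]
  exact (congrArg (PowerSeries.coeff m) h1).symm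

theorem coeff_pennerSeries_hS (m : ℕ) :
    PowerSeries.coeff m (pennerSeries lam hS (PowerSeries.X : Ser M)) =
      inclH (PowerSeries.coeff m (genericPenner lam)) := by
  have h1 : MvPowerSeries.mapAlgHom inclH (genericPenner lam) =
      pennerSeries lam hS (PowerSeries.X : Ser M) := by
    rw [genericPenner, map_pennerSeries (ε := PowerSeries.X) (commutesWithSubst_map _)
      (MvPowerSeries.constantCoeff_X _)]
    congr 1
    · ext1 i j
      exact (MvPowerSeries.map_C _ _).trans (map_inclH_genericH i j)
    · exact MvPowerSeries.map_X _ _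
  exact (congrArg (PowerSeries.coeff m) h1).symm

/-- The polynomial `z` in the real coordinates of `z`. -/
def zPoly : MvPolynomial (Fin 2) ℂ := MvPolynomial.X 0 + Complex.I • MvPolynomial.X 1

/-- The polynomial `z̄` in the real coordinates of `z`. -/
def zbPoly : MvPolynomial (Fin 2) ℂ := MvPolynomial.X 0 - Complex.I • MvPolynomial.X 1

/-- The inclusion of the polynomials in `z` in the polynomials in all coordinates. -/
def inclZ : MvPolynomial (Fin 2) ℂ →ₐ[ℂ] MvPolynomial (Coord M) ℂ :=
  MvPolynomial.rename (Sum.inr ∘ Sum.inl)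

theorem C_inclZ_zPoly : PowerSeries.C (inclZ zPoly) = (zS : Ser M) := by
  simp [inclZ, zPoly, zS, coordS, powerSeries_C_smul]

theorem C_inclZ_zbPoly : PowerSeries.C (inclZ zbPoly) = (zbS : Ser M) := by
  simp [inclZ, zbPoly, zbS, coordS, powerSeries_C_smul]

/-- The substitution `z ↦ ε z`, `z̄ ε⁴ ↦ ε³ z̄`. -/
def rescaledVars : Fin 3 → Ser M :=
  ![PowerSeries.X * zS, PowerSeries.X ^ 3 * zbS, PowerSeries.X]

theorem hasSubst_rescaledVars : MvPowerSeries.HasSubst (rescaledVars (M := M)) := by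
  refine MvPowerSeries.hasSubst_of_constantCoeff_zero fun s => ?_
  change PowerSeries.constantCoeff (rescaledVars s) = 0
  fin_cases s <;> simp [rescaledVars]

theorem openSeries_hS_eq :
    openSeries lam hS (PowerSeries.X : Ser M) (PowerSeries.X * zS) (PowerSeries.X ^ 3 * zbS) =
      MvPowerSeries.subst rescaledVars (MvPowerSeries.mapAlgHom inclH (genericOpen lam)) := by
  have h1 : MvPowerSeries.mapAlgHom inclH (genericOpen lam) =
      openSeries lam ((inclH.mapMatrix (genericH M)).map MvPowerSeries.C) (MvPowerSeries.X 2)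
        (MvPowerSeries.X 0) (MvPowerSeries.X 1) := by
    rw [genericOpen, map_openSeries (commutesWithSubst_map _) (MvPowerSeries.constantCoeff_X _)
      (MvPowerSeries.constantCoeff_X _) (MvPowerSeries.constantCoeff_X _), mapMatrix_C]
    congr 1 <;> exact MvPowerSeries.map_X _ _
  have h2 := map_openSeries (lam := lam)
    (H := (inclH.mapMatrix (genericH M)).map (MvPowerSeries.C (σ := Fin 3)))
    (commutesWithSubst_subst hasSubst_rescaledVars) (ε := MvPowerSeries.X 2)
    (z := MvPowerSeries.X 0) (ζ := MvPowerSeries.X 1) (MvPowerSeries.constantCoeff_X _)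
    (MvPowerSeries.constantCoeff_X _) (MvPowerSeries.constantCoeff_X _)
  simp only [AlgHom.restrictScalars_apply, MvPowerSeries.substAlgHom_apply] at h2
  rw [h1, h2]
  congr 1
  · ext1 i j
    change _ = MvPowerSeries.substAlgHom hasSubst_rescaledVars
      (MvPowerSeries.C (inclH (genericH M i j)))
    rw [MvPowerSeries.substAlgHom_apply, MvPowerSeries.subst_C]
    exact (map_inclH_genericH i j).symm
  · exact (MvPowerSeries.subst_X (hasSubst_rescaledVars (M := M)) 2).symm
  · exact (MvPowerSeries.subst_X (hasSubst_rescaledVars (M := M)) 0).symm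
  · exact (MvPowerSeries.subst_X (hasSubst_rescaledVars (M := M)) 1).symm

/-- For `d 0 = d 1 = b` the degree is `4b + d 2`, as in the original grading. So the rescaling is
invisible on the terms with non-zero expectation. -/
theorem coeff_prod_rescaledVars (d : Fin 3 →₀ ℕ) (n : ℕ) :
    PowerSeries.coeff n (d.prod fun s e => (rescaledVars s : Ser M) ^ e) =
      if n = d 0 + 3 * d 1 + d 2 then inclZ (zPoly ^ d 0 * zbPoly ^ d 1) else 0 := by
  have h : (d.prod fun s e => (rescaledVars s : Ser M) ^ e) =
      PowerSeries.X ^ (d 0 + 3 * d 1 + d 2) *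
        PowerSeries.C (inclZ (zPoly ^ d 0 * zbPoly ^ d 1)) := by
    rw [prod_fin_three, rescaledVars]
    simp only [Matrix.cons_val, map_mul, map_pow, C_inclZ_zPoly, C_inclZ_zbPoly]
    ring
  rw [h, PowerSeries.coeff_mul_C, PowerSeries.coeff_X_pow]
  split_ifs <;> simp

end

end KontsevichPenner

namespace KontsevichPenner

noncomputable section

variable {M : ℕ} {lam : Fin M → ℝ}

/-! ### Expectations of the coefficients -/

theorem momentFunctional_inl_mul_inr {σ σ' : Type*} [Fintype σ] [Fintype σ']
    (μ : σ ⊕ σ' → ℕ → ℂ) (F : MvPolynomial σ ℂ) (G : MvPolynomial σ' ℂ) :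
    momentFunctional μ (MvPolynomial.rename Sum.inl F * MvPolynomial.rename Sum.inr G) =
      momentFunctional (fun s => μ (Sum.inl s)) F * momentFunctional (fun s => μ (Sum.inr s)) G := by
  classical
  induction F using MvPolynomial.induction_on' with
  | add p q hp hq => rw [map_add, add_mul, map_add, hp, hq, map_add, add_mul]
  | monomial d a =>
    induction G using MvPolynomial.induction_on' with
    | add p q hp hq => rw [map_add, mul_add, map_add, hp, hq, map_add, mul_add]
    | monomial e b =>
      have h1 : ∀ s, (d.mapDomain Sum.inl + e.mapDomain Sum.inr : σ ⊕ σ' →₀ ℕ) (Sum.inl s) =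
          d s := by
        intro s
        rw [Finsupp.add_apply, Finsupp.mapDomain_apply Sum.inl_injective,
          Finsupp.mapDomain_of_notMem_range _ _ (by simp), add_zero]
      have h2 : ∀ s, (d.mapDomain Sum.inl + e.mapDomain Sum.inr : σ ⊕ σ' →₀ ℕ) (Sum.inr s) =
          e s := by
        intro s
        rw [Finsupp.add_apply, Finsupp.mapDomain_apply Sum.inr_injective,
          Finsupp.mapDomain_of_notMem_range _ _ (by simp), zero_add]
      rw [MvPolynomial.rename_monomial, MvPolynomial.rename_monomial, MvPolynomial.monomial_mul,
        momentFunctional_monomial, momentFunctional_monomial, momentFunctional_monomial,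
        Fintype.prod_sum_type]
      simp only [h1, h2]
      ring

variable (lam) in
/-- The decay rates of the coordinates of `H`. -/
def rateH (p : Fin M × Fin M) : ℝ := if p.1 = p.2 then lam p.1 else lam p.1 + lam p.2

theorem rateH_pos (hlam : ∀ i, 0 < lam i) (p : Fin M × Fin M) : 0 < rateH lam p := by
  rw [rateH]
  split_ifs
  · exact hlam _
  · exact add_pos (hlam _) (hlam _)

variable (lam) in
/-- The expectation of a polynomial in the coordinates of `H`. -/
def expectH : HPoly M →ₗ[ℂ] ℂ := momentFunctional fun p => gaussMoment (rateH lam p)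

/-- The expectation of a polynomial in the coordinates of `z`. -/
def expectZ : MvPolynomial (Fin 2) ℂ →ₗ[ℂ] ℂ := momentFunctional fun _ => gaussMoment 1

theorem coordMoment_zero (hlam : ∀ i, 0 < lam i) (s : Coord M) :
    coordMoment lam (fun k => 0 ^ k) s 0 = 1 := by
  rcases s with p | s | s | s
  · exact gaussMoment_zero (rateH_pos hlam p)
  · exact gaussMoment_zero one_pos
  · exact gaussMoment_zero (hlam _)
  · exact pow_zero 0

theorem momentFunctional_inclH (hlam : ∀ i, 0 < lam i) (F : HPoly M) :
    momentFunctional (coordMoment lam fun k => 0 ^ k) (inclH F) = expectH lam F :=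
  momentFunctional_rename _ _ Sum.inl_injective (fun s _ => coordMoment_zero hlam s) F

theorem momentFunctional_inclH_mul_inclZ (hlam : ∀ i, 0 < lam i) (F : HPoly M)
    (G : MvPolynomial (Fin 2) ℂ) :
    momentFunctional (coordMoment lam fun k => 0 ^ k) (inclH F * inclZ G) =
      expectH lam F * expectZ G := by
  have h : inclH F * inclZ G = MvPolynomial.rename (Sum.map id Sum.inl)
      (MvPolynomial.rename Sum.inl F * MvPolynomial.rename Sum.inr G) := by
    rw [map_mul, MvPolynomial.rename_rename, MvPolynomial.rename_rename]
    rfl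
  rw [h, momentFunctional_rename _ _ (Function.injective_id.sumMap Sum.inl_injective)
    (fun s _ => coordMoment_zero hlam s), momentFunctional_inl_mul_inr]
  rfl

theorem expectZ_pderiv (s : Fin 2) (F : MvPolynomial (Fin 2) ℂ) :
    expectZ (MvPolynomial.pderiv s F) = expectZ (MvPolynomial.X s * F) := by
  rw [expectZ, momentFunctional_pderiv _ s 1
    (fun k => by simpa using gaussMoment_succ one_pos k) F, one_mul]

theorem expectZ_zPoly_mul (F : MvPolynomial (Fin 2) ℂ) : expectZ (zPoly * F) =
    expectZ (MvPolynomial.pderiv 0 F + Complex.I • MvPolynomial.pderiv 1 F) := by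
  rw [zPoly, add_mul, smul_mul_assoc, map_add, map_add, map_smul, map_smul, expectZ_pderiv,
    expectZ_pderiv]

theorem expectZ_zbPoly_mul (F : MvPolynomial (Fin 2) ℂ) : expectZ (zbPoly * F) =
    expectZ (MvPolynomial.pderiv 0 F - Complex.I • MvPolynomial.pderiv 1 F) := by
  rw [zbPoly, sub_mul, smul_mul_assoc, map_sub, map_sub, map_smul, map_smul, expectZ_pderiv,
    expectZ_pderiv]

/-- This expresses the rotation invariance of the weight. In terms of moments, multiplication by `z`
is `∂₀ + i∂₁ = 2∂/∂z̄` under the expectation, so `(a + 1, b)` reduces to `(a, b - 1)` with the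
factor `2b`, and pure powers `z̄ᵇ` with `b > 0` have expectation zero. -/
theorem expectZ_eq_zero {a b : ℕ} (h : a ≠ b) : expectZ (zPoly ^ a * zbPoly ^ b) = 0 := by
  have z0 : MvPolynomial.pderiv 0 zPoly = 1 := by simp [zPoly, MvPolynomial.pderiv_X]
  have z1 : MvPolynomial.pderiv 1 zPoly = MvPolynomial.C Complex.I := by
    simp [zPoly, MvPolynomial.pderiv_X, MvPolynomial.smul_eq_C_mul]
  have b0 : MvPolynomial.pderiv 0 zbPoly = 1 := by simp [zbPoly, MvPolynomial.pderiv_X]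
  have b1 : MvPolynomial.pderiv 1 zbPoly = -MvPolynomial.C Complex.I := by
    simp [zbPoly, MvPolynomial.pderiv_X, MvPolynomial.smul_eq_C_mul]
  have hI : (MvPolynomial.C Complex.I * MvPolynomial.C Complex.I : MvPolynomial (Fin 2) ℂ) = -1 := by
    rw [← map_mul, Complex.I_mul_I, map_neg, map_one]
  induction a generalizing b with
  | zero =>
    obtain ⟨b, rfl⟩ := Nat.exists_eq_succ_of_ne_zero h.symm
    rw [pow_zero, one_mul, pow_succ', expectZ_zbPoly_mul, Derivation.leibniz_pow,
      Derivation.leibniz_pow, b0, b1, MvPolynomial.smul_eq_C_mul]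
    convert map_zero expectZ
    simp only [smul_eq_mul, nsmul_eq_mul]
    linear_combination ((b : MvPolynomial (Fin 2) ℂ) * zbPoly ^ (b - 1)) * hI
  | succ a ih =>
    have key : expectZ (zPoly ^ (a + 1) * zbPoly ^ b) =
        (2 * b : ℂ) * expectZ (zPoly ^ a * zbPoly ^ (b - 1)) := by
      rw [pow_succ', mul_assoc, expectZ_zPoly_mul]
      refine Eq.trans (congrArg expectZ ?_) (map_smul expectZ (2 * b : ℂ) _)
      rw [Derivation.leibniz,
        Derivation.leibniz, Derivation.leibniz_pow, Derivation.leibniz_pow, Derivation.leibniz_pow,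
        Derivation.leibniz_pow, z0, z1, b0, b1, MvPolynomial.smul_eq_C_mul,
        MvPolynomial.smul_eq_C_mul]
      simp only [smul_eq_mul, nsmul_eq_mul, map_mul, map_natCast, map_ofNat]
      linear_combination ((a : MvPolynomial (Fin 2) ℂ) * zPoly ^ (a - 1) * zbPoly ^ b -
        zPoly ^ a * b * zbPoly ^ (b - 1)) * hI
    rw [key]
    rcases b with _ | b
    · simp
    · rw [Nat.add_sub_cancel, ih (by omega), mul_zero]

theorem expect_pennerSeries (hlam : ∀ i, 0 < lam i) (n : ℕ) :
    expect₀ lam n (pennerSeries lam hS (PowerSeries.X : Ser M)) =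
      expectH lam (PowerSeries.coeff n (genericPenner lam)) := by
  rw [← momentFunctional_inclH hlam, ← coeff_pennerSeries_hS]
  rfl

/-- Terms with unequal powers of `z` and `z̄` drop out by `expectZ_eq_zero`; for power `b` of both,
degree `n` leaves `ε` the exponent `n - 4b`. -/
theorem expect_openSeries (hlam : ∀ i, 0 < lam i) (n : ℕ) :
    expect₀ lam n (openSeries lam hS (PowerSeries.X : Ser M) (PowerSeries.X * zS)
      (PowerSeries.X ^ 3 * zbS)) = ∑ b ∈ Finset.range (n / 4 + 1),
        expectH lam (MvPowerSeries.coeff (exponent b b (n - 4 * b)) (genericOpen lam)) *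
          expectZ (zPoly ^ b * zbPoly ^ b) := by
  set g := MvPowerSeries.mapAlgHom inclH (genericOpen lam) with hg
  have hc : ∀ d, MvPowerSeries.coeff d g = inclH (MvPowerSeries.coeff d (genericOpen lam)) :=
    fun d => rfl
  have h1 : PowerSeries.coeff n (MvPowerSeries.subst rescaledVars g) = ∑ᶠ d : Fin 3 →₀ ℕ,
      inclH (MvPowerSeries.coeff d (genericOpen lam)) *
        PowerSeries.coeff n (d.prod fun s e => (rescaledVars s : Ser M) ^ e) :=
    MvPowerSeries.coeff_subst (hasSubst_rescaledVars (M := M)) g (Finsupp.single () n)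
  have h2 : (fun d : Fin 3 →₀ ℕ => inclH (MvPowerSeries.coeff d (genericOpen lam)) *
      PowerSeries.coeff n (d.prod fun s e => (rescaledVars s : Ser M) ^ e)).HasFiniteSupport :=
    MvPowerSeries.coeff_subst_finite (hasSubst_rescaledVars (M := M)) g (Finsupp.single () n)
  have h3 : expect₀ lam n (MvPowerSeries.subst rescaledVars g) = ∑ᶠ d : Fin 3 →₀ ℕ,
      if n = d 0 + 3 * d 1 + d 2 then
        expectH lam (MvPowerSeries.coeff d (genericOpen lam)) *
          expectZ (zPoly ^ d 0 * zbPoly ^ d 1) else 0 := by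
    change momentFunctional _ (PowerSeries.coeff n (MvPowerSeries.subst rescaledVars g)) = _
    rw [h1, map_finsum _ h2]
    refine finsum_congr fun d => ?_
    rw [coeff_prod_rescaledVars]
    split_ifs
    · exact momentFunctional_inclH_mul_inclZ hlam _ _
    · rw [mul_zero, map_zero]
  rw [openSeries_hS_eq, h3, finsum_eq_sum_of_support_subset (s :=
    (Finset.range (n / 4 + 1)).image fun b => exponent b b (n - 4 * b))]
  · rw [Finset.sum_image]
    · refine Finset.sum_congr rfl fun b hb => ?_
      rw [Finset.mem_range] at hb
      have e0 : exponent b b (n - 4 * b) 0 = b := by simp [exponent]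
      have e1 : exponent b b (n - 4 * b) 1 = b := by simp [exponent]
      have e2 : exponent b b (n - 4 * b) 2 = n - 4 * b := by simp [exponent]
      rw [e0, e1, e2, if_pos (by omega)]
    · intro b _ b' _ h
      exact (exponent_inj.1 h).1
  · intro d hd
    rw [Function.mem_support] at hd
    split_ifs at hd with h
    · have hab : d 0 = d 1 := by
        by_contra hne
        exact hd (by rw [expectZ_eq_zero hne, mul_zero])
      rw [Finset.coe_image, Set.mem_image]
      refine ⟨d 0, by simp; omega, ?_⟩
      have hd' := exponent_self d
      rw [← hab] at hd'
      exact (exponent_inj.2 ⟨rfl, rfl, by omega⟩).trans hd'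
    · exact absurd rfl hd

end

end KontsevichPenner

namespace KontsevichPenner

noncomputable section

variable {M : ℕ} {lam : Fin M → ℝ}

/-! ### Gaussian integrals -/

open MeasureTheory

/-- An integral of polynomials in some functions, from the integrals of the monomials. -/
theorem integral_eq_momentFunctional {Ω σ : Type*} [MeasurableSpace Ω] [Fintype σ] {ν : Measure Ω}
    {w : Ω → ℂ} {f : σ → Ω → ℂ} {μ : σ → ℕ → ℂ} {Z : ℂ}
    (h : ∀ d : σ →₀ ℕ, Integrable (fun x => w x * ∏ s, f s x ^ d s) ν)
    (h' : ∀ d : σ →₀ ℕ, ∫ x, w x * ∏ s, f s x ^ d s ∂ν = Z * ∏ s, μ s (d s))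
    (F : MvPolynomial σ ℂ) :
    Integrable (fun x => w x * MvPolynomial.aeval (fun s => f s x) F) ν ∧
      ∫ x, w x * MvPolynomial.aeval (fun s => f s x) F ∂ν = Z * momentFunctional μ F := by
  induction F using MvPolynomial.induction_on' with
  | add p q hp hq =>
    simp only [map_add, mul_add]
    exact ⟨hp.1.add hq.1, by rw [integral_add hp.1 hq.1, hp.2, hq.2]⟩
  | monomial d a =>
    have e : (fun x => w x * MvPolynomial.aeval (fun s => f s x) (MvPolynomial.monomial d a)) =
        fun x => a * (w x * ∏ s, f s x ^ d s) := by
      ext x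
      rw [MvPolynomial.aeval_monomial, Finsupp.prod_fintype _ _ fun _ => pow_zero _]
      simp only [Algebra.algebraMap_self, RingHom.id_apply]
      ring
    rw [e]
    refine ⟨(h d).const_mul a, ?_⟩
    rw [integral_const_mul, h', momentFunctional_monomial]
    ring

/-- The normalization of the Gaussian measure on the line. -/
def gaussNorm (c : ℝ) : ℂ := ∫ x : ℝ, Complex.exp (-(c / 2) * (x : ℂ) ^ 2)

theorem integral_pow_mul_gauss {c : ℝ} (hc : 0 < c) (k : ℕ) :
    (∫ x : ℝ, (x : ℂ) ^ k * Complex.exp (-(c / 2) * x ^ 2)) = gaussNorm c * gaussMoment c k := by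
  rw [gaussMoment, gaussNorm, mul_div_cancel₀ _ (integral_gauss_ne_zero hc)]

theorem gaussNorm_one_mul_self : gaussNorm 1 * gaussNorm 1 = 2 * Real.pi := by
  have h := integral_gaussian (1 / 2)
  have e : gaussNorm 1 = ((∫ x : ℝ, Real.exp (-(1 / 2) * x ^ 2) : ℝ) : ℂ) := by
    rw [gaussNorm, ← integral_complex_ofReal]
    congr 1
    ext x
    push_cast
    rfl
  rw [e, h, ← Complex.ofReal_mul, Real.mul_self_sqrt (by positivity)]
  push_cast
  ring

theorem hermitian_mul_hermitian (x : Fin M → Fin M → ℝ) (i j : Fin M) :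
    hermitian x i j * hermitian x j i =
      (x i j : ℂ) ^ 2 + if i = j then 0 else (x j i : ℂ) ^ 2 := by
  have hI := Complex.I_mul_I
  rcases lt_trichotomy i j with h | h | h
  · simp only [hermitian, Matrix.of_apply, h, h.not_gt, h.ne, if_true, if_false]
    linear_combination (-(x j i : ℂ) ^ 2) * hI
  · subst h
    simp only [hermitian, Matrix.of_apply, lt_irrefl, if_true, if_false]
    ring
  · simp only [hermitian, Matrix.of_apply, h, h.not_gt, h.ne', if_true, if_false]
    linear_combination (-(x i j : ℂ) ^ 2) * hI

/-- For `i ≠ j`, `|h_ij|²` is counted once with `λ_i` and once with `λ_j`, whence the rate `λ_i +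
λ_j` of both real coordinates of the entry. -/
theorem trace_hermitian_sq (x : Fin M → Fin M → ℝ) : (hermitian x ^ 2 * Lam lam).trace =
    ∑ i, ∑ j, (rateH lam (i, j) : ℂ) * (x i j : ℂ) ^ 2 := by
  have h1 : (hermitian x ^ 2 * Lam lam).trace = ∑ i, ∑ j, ((lam i : ℂ) * (x i j : ℂ) ^ 2 +
      if i = j then 0 else (lam i : ℂ) * (x j i : ℂ) ^ 2) := by
    refine Finset.sum_congr rfl fun i _ => ?_
    rw [Matrix.diag_apply, Lam, Matrix.mul_diagonal, pow_two, Matrix.mul_apply, Finset.sum_mul]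
    refine Finset.sum_congr rfl fun j _ => ?_
    rw [hermitian_mul_hermitian]
    split_ifs <;> ring
  have h2 : ∑ i, ∑ j, (if i = j then 0 else (lam i : ℂ) * (x j i : ℂ) ^ 2) =
      ∑ i, ∑ j, if i = j then 0 else (lam j : ℂ) * (x i j : ℂ) ^ 2 := by
    rw [Finset.sum_comm]
    simp only [eq_comm]
  rw [h1]
  simp only [Finset.sum_add_distrib]
  rw [h2]
  simp only [← Finset.sum_add_distrib]
  refine Finset.sum_congr rfl fun i _ => Finset.sum_congr rfl fun j _ => ?_
  rw [rateH]
  split_ifs with h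
  · simp
  · push_cast
    ring

theorem gaussH_hermitian (x : Fin M → Fin M → ℝ) : gaussH lam (hermitian x) =
    ∏ i, ∏ j, Complex.exp (-(rateH lam (i, j) / 2) * (x i j : ℂ) ^ 2) := by
  rw [gaussH, trace_hermitian_sq]
  simp only [← Complex.exp_sum]
  congr 1
  simp only [Finset.mul_sum]
  refine Finset.sum_congr rfl fun i _ => Finset.sum_congr rfl fun j _ => ?_
  ring

variable (lam) in
/-- The normalization of the Gaussian measure on `H_M`. -/
def normH : ℂ := ∏ i, ∏ j, gaussNorm (rateH lam (i, j))

/-- Integrals of polynomials in `H` against the Gaussian weight. -/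
theorem integral_gaussH_mul (hlam : ∀ i, 0 < lam i) (F : HPoly M) :
    Integrable (fun x : Fin M → Fin M → ℝ => gaussH lam (hermitian x) * evalH x F) ∧
      ∫ x : Fin M → Fin M → ℝ, gaussH lam (hermitian x) * evalH x F =
        normH lam * expectH lam F := by
  have e : ∀ (d : Fin M × Fin M →₀ ℕ), (fun x : Fin M → Fin M → ℝ => gaussH lam (hermitian x) *
      ∏ p : Fin M × Fin M, (x p.1 p.2 : ℂ) ^ d p) = fun x => ∏ i, ∏ j, ((x i j : ℂ) ^ d (i, j) *
        Complex.exp (-(rateH lam (i, j) / 2) * (x i j : ℂ) ^ 2)) := by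
    intro d
    ext x
    simp only [gaussH_hermitian, Fintype.prod_prod_type, Finset.prod_mul_distrib]
    ring
  have key := integral_eq_momentFunctional (ν := (volume : Measure (Fin M → Fin M → ℝ)))
    (w := fun x => gaussH lam (hermitian x)) (f := fun p x => (x p.1 p.2 : ℂ))
    (μ := fun p => gaussMoment (rateH lam p)) (Z := normH lam) (fun d => ?_) (fun d => ?_) F
  · exact key
  · rw [e]
    have hi : ∀ i, Integrable fun y : Fin M → ℝ => ∏ j, ((y j : ℂ) ^ d (i, j) *
        Complex.exp (-(rateH lam (i, j) / 2) * (y j : ℂ) ^ 2)) := fun i =>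
      Integrable.fintype_prod (f := fun j (t : ℝ) => (t : ℂ) ^ d (i, j) *
        Complex.exp (-(rateH lam (i, j) / 2) * (t : ℂ) ^ 2)) fun j =>
        integrable_pow_mul_gauss (rateH_pos hlam _) _
    exact Integrable.fintype_prod (f := fun i (y : Fin M → ℝ) => ∏ j, ((y j : ℂ) ^ d (i, j) *
        Complex.exp (-(rateH lam (i, j) / 2) * (y j : ℂ) ^ 2))) hi
  · rw [e, integral_fintype_prod_volume_eq_prod (fun i (y : Fin M → ℝ) => ∏ j,
      ((y j : ℂ) ^ d (i, j) * Complex.exp (-(rateH lam (i, j) / 2) * (y j : ℂ) ^ 2))), normH,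
      Fintype.prod_prod_type, ← Finset.prod_mul_distrib]
    refine Finset.prod_congr rfl fun i _ => ?_
    rw [integral_fintype_prod_volume_eq_prod (fun j (t : ℝ) => (t : ℂ) ^ d (i, j) *
        Complex.exp (-(rateH lam (i, j) / 2) * (t : ℂ) ^ 2)), ← Finset.prod_mul_distrib]
    exact Finset.prod_congr rfl fun j _ => integral_pow_mul_gauss (rateH_pos hlam _) _

/-- Integrals of polynomials in `z` and `z̄` against the Gaussian weight. -/
theorem integral_gaussZ_mul (a b : ℕ) :
    Integrable (fun z : ℂ => gaussZ z * (z ^ a * starRingEnd ℂ z ^ b)) ∧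
      ∫ z : ℂ, gaussZ z * (z ^ a * starRingEnd ℂ z ^ b) =
        2 * Real.pi * expectZ (zPoly ^ a * zbPoly ^ b) := by
  have e : ∀ z : ℂ, MvPolynomial.aeval (fun s => (![(z.re : ℂ), (z.im : ℂ)] : Fin 2 → ℂ) s)
      (zPoly ^ a * zbPoly ^ b) = z ^ a * starRingEnd ℂ z ^ b := by
    intro z
    have h1 : z = z.re + Complex.I * z.im := by rw [mul_comm]; exact (Complex.re_add_im z).symm
    have h2 : starRingEnd ℂ z = z.re - Complex.I * z.im := by
      rw [mul_comm]
      apply Complex.ext <;> simp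
    simp only [zPoly, zbPoly, map_mul, map_pow, map_add, map_sub, map_smul, MvPolynomial.aeval_X,
      smul_eq_mul, Matrix.cons_val]
    rw [← h1, ← h2]
  have e' : ∀ (d : Fin 2 →₀ ℕ) (z : ℂ), gaussZ z *
      ∏ s, (![(z.re : ℂ), (z.im : ℂ)] : Fin 2 → ℂ) s ^ d s = (fun p : ℝ × ℝ =>
        ((p.1 : ℂ) ^ d 0 * Complex.exp (-((1 : ℝ) / 2) * (p.1 : ℂ) ^ 2)) *
        ((p.2 : ℂ) ^ d 1 * Complex.exp (-((1 : ℝ) / 2) * (p.2 : ℂ) ^ 2)))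
        (Complex.measurableEquivRealProd z) := by
    intro d z
    have h3 : gaussZ z = Complex.exp (-((1 : ℝ) / 2) * (z.re : ℂ) ^ 2) *
        Complex.exp (-((1 : ℝ) / 2) * (z.im : ℂ) ^ 2) := by
      rw [gaussZ, ← Complex.exp_add, Complex.mul_conj, Complex.normSq_apply]
      congr 1
      push_cast
      ring
    simp only [h3, Fin.prod_univ_two, Matrix.cons_val, Complex.measurableEquivRealProd_apply]
    ring
  have hint : ∀ d : Fin 2 →₀ ℕ, Integrable (fun p : ℝ × ℝ =>
        ((p.1 : ℂ) ^ d 0 * Complex.exp (-((1 : ℝ) / 2) * (p.1 : ℂ) ^ 2)) *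
        ((p.2 : ℂ) ^ d 1 * Complex.exp (-((1 : ℝ) / 2) * (p.2 : ℂ) ^ 2))) := fun d =>
    (integrable_pow_mul_gauss one_pos (d 0)).mul_prod (integrable_pow_mul_gauss one_pos (d 1))
  have key := integral_eq_momentFunctional (ν := (volume : Measure ℂ)) (w := gaussZ)
    (f := fun s z => (![(z.re : ℂ), (z.im : ℂ)] : Fin 2 → ℂ) s)
    (μ := fun _ => gaussMoment 1) (Z := 2 * Real.pi) (fun d => ?_) (fun d => ?_)
    (zPoly ^ a * zbPoly ^ b)
  · simp only [e] at key
    exact key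
  · simp only [e']
    exact (Complex.volume_preserving_equiv_real_prod.integrable_comp_emb
      Complex.measurableEquivRealProd.measurableEmbedding).2 (hint d)
  · simp only [e']
    rw [Complex.volume_preserving_equiv_real_prod.integral_comp'
      (g := fun p : ℝ × ℝ => ((p.1 : ℂ) ^ d 0 * Complex.exp (-((1 : ℝ) / 2) * (p.1 : ℂ) ^ 2)) *
        ((p.2 : ℂ) ^ d 1 * Complex.exp (-((1 : ℝ) / 2) * (p.2 : ℂ) ^ 2))),
      Measure.volume_eq_prod, integral_prod_mul (fun t : ℝ => (t : ℂ) ^ d 0 *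
        Complex.exp (-((1 : ℝ) / 2) * (t : ℂ) ^ 2)) (fun t : ℝ => (t : ℂ) ^ d 1 *
        Complex.exp (-((1 : ℝ) / 2) * (t : ℂ) ^ 2)), integral_pow_mul_gauss one_pos,
      integral_pow_mul_gauss one_pos, Fin.prod_univ_two, ← gaussNorm_one_mul_self]
    ring

/-- Each term of the integral over `H_M × ℂ` converges absolutely. -/
theorem integral_openTerm (hlam : ∀ i, 0 < lam i) (a b m : ℕ) :
    Integrable (openTerm lam a b m) ∧ ∫ p, openTerm lam a b m p =
      if 4 * b ≤ m then normH lam *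
        expectH lam (MvPowerSeries.coeff (exponent a b (m - 4 * b)) (genericOpen lam)) *
          (2 * Real.pi * expectZ (zPoly ^ a * zbPoly ^ b)) else 0 := by
  split_ifs with h
  · have e : openTerm lam a b m = fun p : (Fin M → Fin M → ℝ) × ℂ =>
        (gaussH lam (hermitian p.1) * evalH p.1
          (MvPowerSeries.coeff (exponent a b (m - 4 * b)) (genericOpen lam))) *
        (gaussZ p.2 * (p.2 ^ a * starRingEnd ℂ p.2 ^ b)) := by
      ext p
      rw [openTerm, openCoeff_hermitian, if_pos h]
      ring
    have h1 := integral_gaussH_mul hlam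
      (MvPowerSeries.coeff (exponent a b (m - 4 * b)) (genericOpen lam))
    have h2 := integral_gaussZ_mul a b
    rw [e]
    refine ⟨h1.1.mul_prod h2.1, ?_⟩
    rw [Measure.volume_eq_prod, integral_prod_mul (fun x : Fin M → Fin M → ℝ =>
      gaussH lam (hermitian x) * evalH x (MvPowerSeries.coeff (exponent a b (m - 4 * b))
        (genericOpen lam))) (fun z : ℂ => gaussZ z * (z ^ a * starRingEnd ℂ z ^ b)), h1.2, h2.2]
  · have e : openTerm lam a b m = fun _ => 0 := by
      ext p
      rw [openTerm, openCoeff_hermitian, if_neg h]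
      ring
    rw [e]
    exact ⟨integrable_zero _ _ _, integral_zero _ _⟩

/-- Only finitely many terms contribute to each degree. -/
theorem support_integral_openTerm (hlam : ∀ i, 0 < lam i) (m : ℕ) :
    (Function.support fun ab : ℕ × ℕ => ∫ p, openTerm lam ab.1 ab.2 m p) ⊆
      ((Finset.range (m / 4 + 1)).image fun b => (b, b) : Finset (ℕ × ℕ)) := by
  rintro ⟨a, b⟩ hab
  rw [Function.mem_support, (integral_openTerm hlam a b m).2] at hab
  split_ifs at hab with h
  · have : a = b := by
      by_contra hne
      exact hab (by rw [expectZ_eq_zero hne, mul_zero, mul_zero])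
    subst this
    rw [Finset.coe_image, Set.mem_image]
    exact ⟨a, by simp; omega, rfl⟩
  · exact absurd rfl hab

theorem integral_pennerTerm (hlam : ∀ i, 0 < lam i) (m : ℕ) :
    Integrable (pennerTerm 1 lam m) ∧ ∫ x, pennerTerm 1 lam m x =
      normH lam * expectH lam (PowerSeries.coeff m (genericPenner lam)) := by
  have e : pennerTerm 1 lam m = fun x => gaussH lam (hermitian x) * evalH x
      (PowerSeries.coeff m (genericPenner lam)) := by
    ext x
    rw [pennerTerm, coeff_pennerIntegrand_hermitian]
  rw [e]
  exact integral_gaussH_mul hlam _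

/-- Both integrals carry the normalization `normH`, and `1/2π` cancels the mass of the Gaussian on
`ℂ`. What remains is `expect_openIntegrand`, degree by degree. -/
theorem openFormalIntegral_eq_pennerFormalIntegral (hlam : ∀ i, 0 < lam i) :
    openFormalIntegral lam = pennerFormalIntegral 1 lam := by
  ext m
  have h := expect_openIntegrand hlam m
  rw [← openSeries_hS hlam, ← pennerSeries_hS, expect_openSeries hlam,
    expect_pennerSeries hlam] at h
  have hπ : (2 * Real.pi : ℂ) ≠ 0 := by
    exact_mod_cast mul_ne_zero two_ne_zero Real.pi_ne_zero
  rw [openFormalIntegral, pennerFormalIntegral, PowerSeries.coeff_mk, PowerSeries.coeff_mk,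
    (integral_pennerTerm hlam m).2, ← h,
    finsum_eq_sum_of_support_subset _ (support_integral_openTerm hlam m), Finset.sum_image
      (fun b _ b' _ hb => congrArg Prod.fst hb), Finset.mul_sum, Finset.mul_sum]
  refine Finset.sum_congr rfl fun b hb => ?_
  rw [Finset.mem_range] at hb
  rw [(integral_openTerm hlam b b m).2, if_pos (by omega)]
  field_simp

end

end KontsevichPenner

theorem mainTheorem9 (M : ℕ) (lam : Fin M → ℝ) (hlam : ∀ i, 0 < lam i) :
    (∀ a b m : ℕ, MeasureTheory.Integrable (KontsevichPenner.openTerm lam a b m)) ∧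
    (∀ m : ℕ, {ab : ℕ × ℕ | (∫ p, KontsevichPenner.openTerm lam ab.1 ab.2 m p) ≠ 0}.Finite) ∧
    (∀ m : ℕ, MeasureTheory.Integrable (KontsevichPenner.pennerTerm 1 lam m)) ∧
    KontsevichPenner.openFormalIntegral lam = KontsevichPenner.pennerFormalIntegral 1 lam :=
  ⟨fun a b m => (KontsevichPenner.integral_openTerm hlam a b m).1,
    fun m => (Finset.finite_toSet _).subset (KontsevichPenner.support_integral_openTerm hlam m),
    fun m => (KontsevichPenner.integral_pennerTerm hlam m).1,
    KontsevichPenner.openFormalIntegral_eq_pennerFormalIntegral hlam⟩
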